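/- Let $K$ be a field and let $\Sigma$ be a rational pointed fan in $\mathbb{R}^d$, that is, a finite non-empty collection of cones in $\mathbb{R}^d$, each generated by finitely many rational vectors and containing no line, such that for every $C\in\Sigma$ and every cone $C'\subseteq C$ one has $C'\in\Sigma$ if and only if $C'$ is a face of $C$, and such that $C\cap C'$ is a common face of $C$ and $C'$ for all $C,C'\in\Sigma$. For $C\in\Sigma$ let $e_C=\operatorname{relint}(C)\cap\mathbb{S}^{d-1}$, and let $|\Gamma_\Sigma|=\bigcup_{C\in\Sigma}e_C$, a subspace of the unit sphere $\mathbb{S}^{d-1}$. Let $\varepsilon$ be an incidence function on $\Sigma$: to all $D,E\in\Sigma$ with $\dim D=\dim E+1$ it assigns $\varepsilon(D,E)\in\{0,1,-1\}$ such that $\varepsilon(D,E)\neq 0$ if and only if $E$ is a face of $D$; $\varepsilon(D,0)=1$ if $\dim D=1$; and $\varepsilon(D,E_1)\varepsilon(E_1,F)+\varepsilon(D,E_2)\varepsilon(E_2,F)=0$ whenever $F$ is a face of $D$ with $\dim D=\dim F+2$ and $E_1\neq E_2$ are the two cones of dimension $\dim F+1$ that are faces of $D$ and have $F$ as a face. For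 $C\in\Sigma$ let $\operatorname{star}_\Sigma(C)=\{D\in\Sigma: C\subseteq D\}$, and let $\mathcal{C}^{\bullet}_{\operatorname{star}_\Sigma(C)}$ be the cochain complex of $K$-vector spaces with $$\mathcal{C}^i=\bigoplus_{D\in\operatorname{star}_\Sigma(C),\ \dim D=i+1}K D,\qquad \partial(D)=\sum_{E\in\operatorname{star}_\Sigma(C),\ \dim E=\dim D+1}\varepsilon(E,D)\,E ,$$ whose cohomology in degree $i$ is denoted by $\tilde H^i(\mathcal{C}^{\bullet}_{\operatorname{star}_\Sigma(C)})$. Then for every $0\neq C\in\Sigma$, every $p\in e_C$ and every $i\in\mathbb{Z}$ there is an isomorphism of $K$-vector spaces $$H_i(|\Gamma_\Sigma|,|\Gamma_\Sigma|\setminus\{p\})\cong\tilde H^i(\mathcal{C}^{\bullet}_{\operatorname{star}_\Sigma(C)}).$$ Moreover, for every $i\in\mathbb{Z}$, $$\tilde H_i(|\Gamma_\Sigma|)\cong\tilde H^i(\mathcal{C}^{\bullet}_{\operatorname{star}_\Sigma(0)}).$$ Here $H_i(X,X\setminus\{p\})$ is relative singular homology and $\tilde H_i(X)$ is reduced singular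 homology, both with coefficients in $K$; in particular $\tilde H_{-1}(\emptyset)=K$. -/

import Mathlib

noncomputable section

open CategoryTheory Limits AlgebraicTopology

universe u

/-! ### Rational pointed fans -/

/-- A cone in `ℝ^d`, i.e. a set containing `0` and closed under sums and under multiplication by
nonnegative reals. -/
abbrev RealCone (d : ℕ) : Type := PointedCone ℝ (EuclideanSpace ℝ (Fin d))

namespace RealCone

variable {d : ℕ}

/-- The cone is generated by finitely many vectors with rational coordinates. -/
def IsRational (C : RealCone d) : Prop :=
  ∃ G : Finset (Fin d → ℚ), C = Submodule.span {c : ℝ // 0 ≤ c}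
    ((fun q : Fin d → ℚ => WithLp.toLp 2 (fun j => (q j : ℝ))) '' (G : Set (Fin d → ℚ)))

/-- The cone contains no line. -/
def IsPointed (C : RealCone d) : Prop :=
  ∀ x ∈ C, -x ∈ C → x = 0

/-- The dimension of a cone is the dimension of the vector space it generates. -/
def dim (C : RealCone d) : ℕ :=
  Module.finrank ℝ (Submodule.span ℝ (C : Set (EuclideanSpace ℝ (Fin d))))

/-- The open cell `e_C = relint C ∩ S^{d-1}`. -/
def openCell (C : RealCone d) : Set (EuclideanSpace ℝ (Fin d)) :=
  intrinsicInterior ℝ (C : Set (EuclideanSpace ℝ (Fin d))) ∩ Metric.sphere 0 1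

end RealCone

/-- A rational pointed fan in `ℝ^d`: a finite nonempty collection of rational pointed cones such
that a cone contained in a member of the collection belongs to the collection if and only if it is
a face of that member, and such that any two members meet in a common face. -/
structure RationalPointedFan (d : ℕ) where
  cones : Finset (RealCone d)
  nonempty : cones.Nonempty
  rational : ∀ C ∈ cones, C.IsRational
  pointed : ∀ C ∈ cones, C.IsPointed
  isFaceOf_iff_mem : ∀ C ∈ cones, ∀ C' : RealCone d, C' ≤ C →
    (PointedCone.IsFaceOf C' C ↔ C' ∈ cones)
  inter_isFaceOf : ∀ C ∈ cones, ∀ C' ∈ cones,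
    PointedCone.IsFaceOf (C ⊓ C') C ∧ PointedCone.IsFaceOf (C ⊓ C') C'

namespace RationalPointedFan

variable {d : ℕ}

/-- The space `|Γ_Φ|`, the union of the open cells `e_C` for `C ∈ Φ`. -/
def cellSpace (Φ : RationalPointedFan d) : Set (EuclideanSpace ℝ (Fin d)) :=
  ⋃ C ∈ Φ.cones, C.openCell

/-! ### The complex of a star -/

/-- An incidence function on the fan `Φ` (equivalently on the regular cell complex `Γ_Φ`, where
`e_0 = ∅` is the cell of dimension `-1`). Only the values on pairs of cones of `Φ` whose
dimensions differ by one matter. -/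
structure IncidenceFunction (Φ : RationalPointedFan d) where
  toFun : RealCone d → RealCone d → ℤ
  mem_values : ∀ D ∈ Φ.cones, ∀ E ∈ Φ.cones, D.dim = E.dim + 1 →
    toFun D E = 0 ∨ toFun D E = 1 ∨ toFun D E = -1
  ne_zero_iff : ∀ D ∈ Φ.cones, ∀ E ∈ Φ.cones, D.dim = E.dim + 1 →
    (toFun D E ≠ 0 ↔ PointedCone.IsFaceOf E D)
  ray_zero : ∀ D ∈ Φ.cones, D.dim = 1 → toFun D ⊥ = 1
  /-- If `F` is a face of `D` of codimension `2` and `E₁`, `E₂` are the two intermediate faces, then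
  `ε(D,E₁) ε(E₁,F) + ε(D,E₂) ε(E₂,F) = 0`. -/
  diamond : ∀ D ∈ Φ.cones, ∀ F ∈ Φ.cones, D.dim = F.dim + 2 →
    ∀ E₁ ∈ Φ.cones, ∀ E₂ ∈ Φ.cones, E₁ ≠ E₂ → E₁.dim = F.dim + 1 → E₂.dim = F.dim + 1 →
    PointedCone.IsFaceOf F E₁ → PointedCone.IsFaceOf E₁ D →
    PointedCone.IsFaceOf F E₂ → PointedCone.IsFaceOf E₂ D →
    toFun D E₁ * toFun E₁ F + toFun D E₂ * toFun E₂ F = 0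

/-- The star of a cone `C` in the fan. -/
def star (Φ : RationalPointedFan d) (C : RealCone d) : Set (RealCone d) :=
  {D | D ∈ Φ.cones ∧ C ≤ D}

/-- The cones of dimension `i + 1` in the star of `C`. -/
def starBasis (Φ : RationalPointedFan d) (C : RealCone d) (i : ℤ) : Type :=
  {D : RealCone d // D ∈ Φ.star C ∧ (D.dim : ℤ) = i + 1}

instance (Φ : RationalPointedFan d) (C : RealCone d) (i : ℤ) : Fintype (Φ.starBasis C i) :=
  (Φ.cones.finite_toSet.subset (t := {D | D ∈ Φ.star C ∧ (D.dim : ℤ) = i + 1})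
    (fun _ h => h.1.1)).fintype

variable (K : Type u) [Field K]

/-- The `K`-vector space `𝒞^i` with basis the cones of dimension `i + 1` in the star of `C`
(a finite direct sum of copies of `K`, written as functions on the basis). -/
abbrev StarCochains (Φ : RationalPointedFan d) (C : RealCone d) (i : ℤ) : Type u :=
  Φ.starBasis C i → K

/-- The differential `𝒞^i → 𝒞^j`, used for `j = i + 1` only; it sends the basis element `D` to
`∑_E ε(E,D) E`. -/
def starDifferential (Φ : RationalPointedFan d) (ε : Φ.IncidenceFunction) (C : RealCone d) (i j : ℤ) :
    Φ.StarCochains K C i →ₗ[K] Φ.StarCochains K C j :=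
  Matrix.mulVecLin (Matrix.of fun (E : Φ.starBasis C j) (D : Φ.starBasis C i) =>
    (ε.toFun E.1 D.1 : K))

/-- The cohomology `ker (𝒞^i → 𝒞^{i+1}) / im (𝒞^{i-1} → 𝒞^i)` of the complex of the star of `C`,
for every integer `i`. -/
abbrev StarCohomology (Φ : RationalPointedFan d) (ε : Φ.IncidenceFunction) (C : RealCone d) (i : ℤ) :
    Type u :=
  LinearMap.ker (Φ.starDifferential K ε C i (i + 1)) ⧸
    (LinearMap.range (Φ.starDifferential K ε C (i - 1) i)).submoduleOf
      (LinearMap.ker (Φ.starDifferential K ε C i (i + 1)))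

end RationalPointedFan

/-! ### Reduced and local singular homology -/

section Homology

variable (K : Type u) [Field K]

/-- The singular chain complex of a space with coefficients in `K`. -/
abbrev singularChains (X : TopCat.{0}) : ChainComplex (ModuleCat.{u} K) ℕ :=
  ((singularChainComplexFunctor.{0} (ModuleCat.{u} K)).obj (ModuleCat.of K K)).obj X

/-- The homology of an `ℕ`-indexed chain complex in an arbitrary integral degree; it is zero in
negative degrees. -/
def intHomology (A : ChainComplex (ModuleCat.{u} K) ℕ) : ℤ → ModuleCat.{u} K
  | Int.ofNat n => A.homology n
  | Int.negSucc _ => ModuleCat.of K PUnit.{u + 1}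

/-- The augmentation `C_0(X) ⟶ K`, sending each point of `X` to `1`. -/
def augmentation (X : TopCat.{0}) : (singularChains K X).X 0 ⟶ ModuleCat.of K K :=
  Sigma.desc (fun _ => 𝟙 (ModuleCat.of K K))

lemma d_comp_eq_zero_of_ι_comp (S : SSet.{0}) (R : ModuleCat.{u} K)
    (f : (S.chainComplex R).X 0 ⟶ R) (h : ∀ y, S.ιChainComplex y ≫ f = 𝟙 R) :
    (S.chainComplex R).d 1 0 ≫ f = 0 := by
  refine SSet.chainComplex_hom_ext fun x => ?_
  rw [← Category.assoc, SSet.ιChainComplex_d S R x]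
  simp [Fin.sum_univ_two, h]

lemma d_augmentation (X : TopCat.{0}) :
    (singularChains K X).d 1 0 ≫ augmentation K X = 0 :=
  d_comp_eq_zero_of_ι_comp K (TopCat.toSSet.obj X) (ModuleCat.of K K) (augmentation K X)
    (fun _ => Sigma.ι_desc _ _)

/-- The augmented singular chain complex `⋯ ⟶ C_1(X) ⟶ C_0(X) ⟶ K`, with `K` in position `0` and
`C_n(X)` in position `n + 1`. -/
def augmentedSingularChains (X : TopCat.{0}) : ChainComplex (ModuleCat.{u} K) ℕ :=
  (singularChains K X).augment (augmentation K X) (d_augmentation K X)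

/-- Reduced singular homology in degree `i ∈ ℤ`, so that the reduced homology of the empty space
is `K` in degree `-1`. -/
def reducedHomology (X : TopCat.{0}) (i : ℤ) : ModuleCat.{u} K :=
  intHomology K (augmentedSingularChains K X) (i + 1)

/-- The relative singular chain complex `C(X) / C(A)` of a space `X` and a subspace `A`. -/
def relativeSingularChains (X : TopCat.{0}) (A : Set X) : ChainComplex (ModuleCat.{u} K) ℕ :=
  cokernel (((singularChainComplexFunctor.{0} (ModuleCat.{u} K)).obj (ModuleCat.of K K)).map
    (TopCat.ofHom (⟨Subtype.val, continuous_subtype_val⟩ : C(A, X))))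

/-- The local homology `H_i(X, X ∖ {p})`. -/
def localHomology (X : TopCat.{0}) (p : X) (i : ℤ) : ModuleCat.{u} K :=
  intHomology K (relativeSingularChains K X {p}ᶜ) i

end Homology

end

/-! The fan carries an augmented cellular chain complex with one generator for each cone, the zero
cone playing the empty cell, and with boundary given by `ε`. The relations of `ε` and the fact that
exactly two faces lie between a cone and a face of codimension two make it a complex. Dividing out
the cones that do not contain `C` leaves a complex on the star of `C` whose differentials are the
transposes of those of the star complex. A matrix over a field has the rank of its transpose, so the
homology of the first complex and the cohomology of the second have equal finite dimension
(`Matrix.nonempty_homology_transpose_equiv`). The passage from homology to cohomology happens only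
there and is not natural. It remains to see that cellular chains compute singular homology,
absolutely for the zero cone and relative to the cells outside the star for `C ≠ 0`.

Singular chains are taken in all degrees at once, with the empty simplex included, so homology is
automatically reduced. `RelAcyclic` expresses the vanishing of the homology of a quotient, and long
exact sequences are replaced by its two-out-of-three rules and by the second isomorphism theorem.
Homotopy invariance (`relAcyclic_of_deformation`) and small simplices (`relAcyclic_small`) come from
operators on tuples of points of convex sets that are natural for affine maps.

The geometry rests on one retraction. For `p` in the relative interior of `C`, push points in
direction `-p` until they leave the cones containing `C`. This deforms the punctured support minus
the ray of `p` onto the union of the cones not containing `C` (`IsSubfan.relAcyclic_away`). Together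
with radial projection to the sphere it turns local homology at `p` into the homology of a pair of
subfans, and together with small simplices it gives excision for a maximal cone
(`IsSubfan.relAcyclic_excision`).

Closed cells are acyclic, so a chain map from cellular to singular chains can be built cone by cone
(`exists_isCellular`). Its mapping cone is acyclic on every subfan containing the zero cone
(`IsCellMap.relAcyclic`). The proof is by induction on the number of cones, with a Mayer–Vietoris
argument that splits off a cone `D` of largest dimension. It needs the cellular complex of the faces
of `D` to be acyclic: a facet `F` and `D` cancel each other, and the remaining faces form a smaller
subfan whose space is acyclic (`IsSubfan.relAcyclic_boundary_away`). Finally `IsChainModel` links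
these ungraded chains to the augmented and relative singular complexes. -/

noncomputable section

/-! ### Relative acyclicity in a differential module -/

section RelAcyclic

variable {K M : Type*} [Ring K] [AddCommGroup M] [Module K M]

/-- `RelAcyclic d A B` says that the quotient `B / A` of two submodules of a differential module
has vanishing homology. -/
def RelAcyclic (d : M →ₗ[K] M) (A B : Submodule K M) : Prop :=
  ∀ z ∈ B, d z ∈ A → ∃ y ∈ B, z - d y ∈ A

namespace RelAcyclic

variable {d : M →ₗ[K] M} {A B C : Submodule K M}

/-- For `A ≤ B ≤ C` the long exact sequence of `B/A`, `C/A`, `C/B` shows that if two of them are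
acyclic, so is the third. This lemma and the next two are the three cases, by diagram chase. -/
lemma trans (hd : ∀ x, d (d x) = 0) (hAB : A ≤ B) (hBC : B ≤ C)
    (h₁ : RelAcyclic d A B) (h₂ : RelAcyclic d B C) : RelAcyclic d A C := by
  intro z hz hdz
  obtain ⟨y, hy, hzy⟩ := h₂ z hz (hAB hdz)
  obtain ⟨y', hy', hzy'⟩ := h₁ _ hzy (by simpa [hd] using hdz)
  exact ⟨y + y', C.add_mem hy (hBC hy'), by simpa [sub_sub] using hzy'⟩

lemma cancel_left (hd : ∀ x, d (d x) = 0) (hAB : A ≤ B) (hBC : B ≤ C)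
    (h₁ : RelAcyclic d A B) (h₂ : RelAcyclic d A C) : RelAcyclic d B C := by
  intro z hz hdz
  obtain ⟨y, hy, hzy⟩ := h₁ _ hdz (by simp [hd])
  obtain ⟨y', hy', hzy'⟩ := h₂ (z - y) (C.sub_mem hz (hBC hy)) (by simpa using hzy)
  refine ⟨y', hy', ?_⟩
  have := B.add_mem (hAB hzy') hy
  rwa [show z - y - d y' + y = z - d y' by abel] at this

lemma cancel_right (hd : ∀ x, d (d x) = 0) (hAB : A ≤ B) (hBC : B ≤ C)
    (h₁ : RelAcyclic d B C) (h₂ : RelAcyclic d A C) : RelAcyclic d A B := by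
  intro z hz hdz
  obtain ⟨y, hy, hzy⟩ := h₂ z (hBC hz) hdz
  have hdy : d y ∈ B := by simpa using B.sub_mem hz (hAB hzy)
  obtain ⟨y', -, hy'⟩ := h₁ y hy hdy
  exact ⟨_, hy', by simpa [hd] using hzy⟩

/-- By the second isomorphism theorem `(A ⊔ B)/B` is `A/(A ⊓ B)`. This is the algebraic half of
excision and Mayer–Vietoris. -/
lemma sup_of_inf (hA : ∀ x ∈ A, d x ∈ A) (hB : ∀ x ∈ B, d x ∈ B)
    (h : RelAcyclic d (A ⊓ B) A) : RelAcyclic d B (A ⊔ B) := by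
  intro z hz hdz
  obtain ⟨a, ha, b, hb, rfl⟩ := Submodule.mem_sup.1 hz
  have hda : d a ∈ B := by simpa using B.sub_mem hdz (hB b hb)
  obtain ⟨y, hy, hay⟩ := h a ha ⟨hA a ha, hda⟩
  refine ⟨y, Submodule.mem_sup_left hy, ?_⟩
  have := B.add_mem hay.2 hb
  rwa [show a - d y + b = a + b - d y by abel] at this

end RelAcyclic

end RelAcyclic

/-! ### Chains on tuples of points -/

section TupleChain

/-- Formal linear combinations of finite tuples of points of `Y`. -/
abbrev TupleChain (K : Type*) [Field K] (Y : Type*) := (Σ n : ℕ, Fin n → Y) →₀ K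

namespace TupleChain

variable {K : Type*} [Field K] {Y Z Y' Z' : Type*}

/-- The basis chain given by a tuple. -/
abbrev of (K : Type*) [Field K] {Y : Type*} {n : ℕ} (v : Fin n → Y) : TupleChain K Y :=
  Finsupp.single ⟨n, v⟩ 1

/-- The boundary of a tuple. -/
def boundaryTuple (K : Type*) [Field K] {Y : Type*} : (Σ n : ℕ, Fin n → Y) → TupleChain K Y
  | ⟨0, _⟩ => 0
  | ⟨n + 1, v⟩ => ∑ i : Fin (n + 1), (-1 : K) ^ (i : ℕ) • of K (v ∘ i.succAbove)

/-- The alternating sum of the faces, including the empty face of a point. -/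
def boundary (K : Type*) [Field K] (Y : Type*) : TupleChain K Y →ₗ[K] TupleChain K Y :=
  Finsupp.linearCombination K (boundaryTuple K)

/-- The cone with apex `b`. -/
def cone (K : Type*) [Field K] {Y : Type*} (b : Y) : TupleChain K Y →ₗ[K] TupleChain K Y :=
  Finsupp.lmapDomain K K fun v => ⟨v.1 + 1, Fin.cons b v.2⟩

/-- The map on chains induced by a map of points. -/
def map (K : Type*) [Field K] {Y Z : Type*} (g : Y → Z) : TupleChain K Y →ₗ[K] TupleChain K Z :=
  Finsupp.lmapDomain K K fun v => ⟨v.1, g ∘ v.2⟩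

@[simp] lemma boundary_of_zero (v : Fin 0 → Y) : boundary K Y (of K v) = 0 := by
  simp [boundary, boundaryTuple]

lemma boundary_of_succ {n : ℕ} (v : Fin (n + 1) → Y) :
    boundary K Y (of K v) = ∑ i : Fin (n + 1), (-1 : K) ^ (i : ℕ) • of K (v ∘ i.succAbove) := by
  simp [boundary, boundaryTuple]

@[simp] lemma cone_of (b : Y) {n : ℕ} (v : Fin n → Y) :
    cone K b (of K v) = of K (Fin.cons b v : Fin (n + 1) → Y) := by
  simp [cone, Finsupp.lmapDomain_apply, Finsupp.mapDomain_single]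

@[simp] lemma map_of (g : Y → Z) {n : ℕ} (v : Fin n → Y) :
    map K g (of K v) = of K (g ∘ v) := by
  simp [map, Finsupp.lmapDomain_apply, Finsupp.mapDomain_single]

lemma hom_ext {M : Type*} [AddCommGroup M] [Module K M] {f g : TupleChain K Y →ₗ[K] M}
    (h : ∀ n (v : Fin n → Y), f (of K v) = g (of K v)) (x : TupleChain K Y) : f x = g x := by
  refine DFunLike.congr_fun (Finsupp.lhom_ext' fun v => LinearMap.ext_ring ?_) x
  exact h v.1 v.2

/-- Deleting the apex gives back `x`; deleting another point gives a cone over a face, with shifted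
sign. Since a point has the empty tuple as its face, the formula needs no correction in low degree.
-/
lemma boundary_cone (b : Y) (x : TupleChain K Y) :
    boundary K Y (cone K b x) = x - cone K b (boundary K Y x) := by
  refine hom_ext (f := boundary K Y ∘ₗ cone K b)
    (g := LinearMap.id - cone K b ∘ₗ boundary K Y) (fun n v => ?_) x
  rcases n with _ | n
  · simp only [LinearMap.comp_apply, cone_of, boundary_of_succ, LinearMap.sub_apply,
      LinearMap.id_apply, boundary_of_zero, map_zero, sub_zero]
    simp only [Nat.reduceAdd, Finset.univ_unique, Fin.default_eq_zero, Finset.sum_singleton,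
      Fin.val_zero, pow_zero, one_smul]
    rw [Subsingleton.elim ((Fin.cons b v : Fin 1 → Y) ∘ Fin.succAbove 0) v]
  · simp only [LinearMap.comp_apply, cone_of, boundary_of_succ, LinearMap.sub_apply,
      LinearMap.id_apply, map_sum, map_smul]
    rw [Fin.sum_univ_succ, sub_eq_add_neg, ← Finset.sum_neg_distrib]
    congr 1
    · simp only [Fin.val_zero, pow_zero, one_smul]
      rfl
    · refine Finset.sum_congr rfl fun i _ => ?_
      rw [Fin.val_succ, pow_succ, mul_neg_one, neg_smul]
      congr 3
      funext j
      refine Fin.cases ?_ (fun j => ?_) j <;> simp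

lemma boundary_boundary (x : TupleChain K Y) : boundary K Y (boundary K Y x) = 0 := by
  refine hom_ext (f := boundary K Y ∘ₗ boundary K Y) (g := 0) (fun n v => ?_) x
  induction n with
  | zero => simp
  | succ n ih =>
    -- A nonempty tuple is the cone over its tail with apex its first point, so the cone formula
    -- gives the induction.
    have hv : of K v = cone K (v 0) (of K (Fin.tail v)) := by
      rw [cone_of, Fin.cons_self_tail]
    have := ih (Fin.tail v)
    simp only [LinearMap.comp_apply, LinearMap.zero_apply] at this ⊢
    rw [hv, boundary_cone, map_sub, boundary_cone, this]
    simp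

lemma map_boundary (g : Y → Z) (x : TupleChain K Y) :
    boundary K Z (map K g x) = map K g (boundary K Y x) := by
  refine hom_ext (f := boundary K Z ∘ₗ map K g) (g := map K g ∘ₗ boundary K Y) (fun n v => ?_) x
  rcases n with _ | n
  · simp
  · simp only [LinearMap.comp_apply, map_of, boundary_of_succ, map_sum, map_smul,
      Function.comp_assoc]

lemma map_cone (g : Y → Z) (b : Y) (x : TupleChain K Y) :
    map K g (cone K b x) = cone K (g b) (map K g x) := by
  refine hom_ext (f := map K g ∘ₗ cone K b) (g := cone K (g b) ∘ₗ map K g) (fun n v => ?_) x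
  simp only [LinearMap.comp_apply, cone_of, map_of, Fin.comp_cons]

/-- The subdivision of a tuple obtained by inductively coning off the subdivided boundary. -/
def subdivTuple (K : Type*) [Field K] {Y : Type*} (b : ∀ n, (Fin (n + 1) → Y) → Y) :
    ∀ n : ℕ, (Fin n → Y) → TupleChain K Y
  | 0, v => of K v
  | n + 1, v => cone K (b n v)
      (∑ i : Fin (n + 1), (-1 : K) ^ (i : ℕ) • subdivTuple K b n (v ∘ i.succAbove))

/-- Subdivision of chains, with `b` choosing the centre of each tuple. -/
def subdiv (K : Type*) [Field K] {Y : Type*} (b : ∀ n, (Fin (n + 1) → Y) → Y) :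
    TupleChain K Y →ₗ[K] TupleChain K Y :=
  Finsupp.linearCombination K fun v => subdivTuple K b v.1 v.2

variable {b : ∀ n, (Fin (n + 1) → Y) → Y}

lemma subdiv_of {n : ℕ} (v : Fin n → Y) : subdiv K b (of K v) = subdivTuple K b n v := by
  simp [subdiv]

lemma subdiv_of_zero (v : Fin 0 → Y) : subdiv K b (of K v) = of K v := by
  simp [subdiv_of, subdivTuple]

lemma subdiv_of_succ {n : ℕ} (v : Fin (n + 1) → Y) :
    subdiv K b (of K v) = cone K (b n v) (subdiv K b (boundary K Y (of K v))) := by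
  simp only [boundary_of_succ, map_sum, map_smul, subdiv_of]
  simp [subdivTuple]

lemma boundary_subdiv (x : TupleChain K Y) :
    boundary K Y (subdiv K b x) = subdiv K b (boundary K Y x) := by
  refine hom_ext (f := boundary K Y ∘ₗ subdiv K b) (g := subdiv K b ∘ₗ boundary K Y)
    (fun n v => ?_) x
  simp only [LinearMap.comp_apply]
  induction n with
  | zero => simp [subdiv_of_zero]
  | succ n ih =>
    have hb : boundary K Y (subdiv K b (boundary K Y (of K v))) =
        subdiv K b (boundary K Y (boundary K Y (of K v))) := by
      simp only [boundary_of_succ, map_sum, map_smul, ih]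
    rw [subdiv_of_succ, boundary_cone, hb, boundary_boundary]
    simp

lemma map_subdiv {b' : ∀ n, (Fin (n + 1) → Z) → Z} (g : Y → Z)
    (hg : ∀ n v, g (b n v) = b' n (g ∘ v)) (x : TupleChain K Y) :
    map K g (subdiv K b x) = subdiv K b' (map K g x) := by
  refine hom_ext (f := map K g ∘ₗ subdiv K b) (g := subdiv K b' ∘ₗ map K g) (fun n v => ?_) x
  simp only [LinearMap.comp_apply]
  induction n with
  | zero => simp [subdiv_of_zero]
  | succ n ih =>
    rw [subdiv_of_succ, map_cone, map_of, subdiv_of_succ, hg, ← map_of, map_boundary]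
    simp only [boundary_of_succ, map_sum, map_smul, ih]

/-- The value on a tuple of the chain homotopy between two maps `α` and `β` obtained by coning. -/
def homotopyTuple (α β : TupleChain K Y →ₗ[K] TupleChain K Z) (c : ∀ n, (Fin (n + 1) → Y) → Z) :
    ∀ n : ℕ, (Fin n → Y) → TupleChain K Z
  | 0, _ => 0
  | n + 1, v => cone K (c n v) (α (of K v) - β (of K v) -
      ∑ i : Fin (n + 1), (-1 : K) ^ (i : ℕ) • homotopyTuple α β c n (v ∘ i.succAbove))

/-- The chain homotopy between two chain maps obtained by coning. -/
def homotopy (α β : TupleChain K Y →ₗ[K] TupleChain K Z) (c : ∀ n, (Fin (n + 1) → Y) → Z) :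
    TupleChain K Y →ₗ[K] TupleChain K Z :=
  Finsupp.linearCombination K fun v => homotopyTuple α β c v.1 v.2

section Homotopy

variable {α β : TupleChain K Y →ₗ[K] TupleChain K Z} {c : ∀ n, (Fin (n + 1) → Y) → Z}

lemma homotopy_of {n : ℕ} (v : Fin n → Y) :
    homotopy α β c (of K v) = homotopyTuple α β c n v := by
  simp [homotopy]

lemma homotopy_of_zero (v : Fin 0 → Y) : homotopy α β c (of K v) = 0 := by
  simp [homotopy_of, homotopyTuple]

lemma homotopy_of_succ {n : ℕ} (v : Fin (n + 1) → Y) :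
    homotopy α β c (of K v) = cone K (c n v) (α (of K v) - β (of K v) -
      homotopy α β c (boundary K Y (of K v))) := by
  simp only [boundary_of_succ, map_sum, map_smul, homotopy_of, homotopyTuple]

/-- By induction `α - β - H∂` takes cycles as values on nonempty tuples, and coning a cycle produces
a chain bounded by it. Agreement on the empty tuple starts the induction. -/
lemma boundary_homotopy (hα : ∀ x, boundary K Z (α x) = α (boundary K Y x))
    (hβ : ∀ x, boundary K Z (β x) = β (boundary K Y x))
    (h₀ : ∀ v : Fin 0 → Y, α (of K v) = β (of K v)) (x : TupleChain K Y) :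
    boundary K Z (homotopy α β c x) + homotopy α β c (boundary K Y x) = α x - β x := by
  refine hom_ext (f := boundary K Z ∘ₗ homotopy α β c + homotopy α β c ∘ₗ boundary K Y)
    (g := α - β) (fun n v => ?_) x
  simp only [LinearMap.comp_apply, LinearMap.add_apply, LinearMap.sub_apply]
  induction n with
  | zero => simp [homotopy_of_zero, h₀]
  | succ n ih =>
    have hb : boundary K Z (homotopy α β c (boundary K Y (of K v))) +
        homotopy α β c (boundary K Y (boundary K Y (of K v))) =
        α (boundary K Y (of K v)) - β (boundary K Y (of K v)) := by
      conv_lhs => rw [boundary_of_succ]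
      conv_rhs => rw [boundary_of_succ]
      simp only [map_sum, map_smul, ← Finset.sum_add_distrib, ← Finset.sum_sub_distrib,
        ← smul_add, ← smul_sub, ih]
    rw [boundary_boundary, map_zero, add_zero] at hb
    rw [homotopy_of_succ, boundary_cone, map_sub (boundary K Z), map_sub (boundary K Z), hα, hβ, hb]
    simp

lemma map_homotopy {α' β' : TupleChain K Y' →ₗ[K] TupleChain K Z'}
    {c' : ∀ n, (Fin (n + 1) → Y') → Z'} (g : Y → Y') (g' : Z → Z')
    (hα : ∀ x, map K g' (α x) = α' (map K g x)) (hβ : ∀ x, map K g' (β x) = β' (map K g x))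
    (hg : ∀ n v, g' (c n v) = c' n (g ∘ v)) (x : TupleChain K Y) :
    map K g' (homotopy α β c x) = homotopy α' β' c' (map K g x) := by
  refine hom_ext (f := map K g' ∘ₗ homotopy α β c) (g := homotopy α' β' c' ∘ₗ map K g)
    (fun n v => ?_) x
  simp only [LinearMap.comp_apply]
  induction n with
  | zero => simp [homotopy_of_zero]
  | succ n ih =>
    rw [homotopy_of_succ, map_cone, map_of, homotopy_of_succ, hg, ← map_of, map_boundary,
      map_sub (map K g'), map_sub (map K g'), hα, hβ]
    simp only [boundary_of_succ, map_sum, map_smul, ih]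

end Homotopy

end TupleChain

end TupleChain

end

noncomputable section

/-! ### Affine simplices -/

section Affine

variable {V W : Type*} [NormedAddCommGroup V] [NormedSpace ℝ V]
  [NormedAddCommGroup W] [NormedSpace ℝ W]

/-- The affine simplex in a convex set with given vertices. -/
def affineSimplex {s : Set V} (hs : Convex ℝ s) {n : ℕ} (v : Fin n → s) :
    C(stdSimplex ℝ (Fin n), s) where
  toFun t := ⟨∑ i, t.1 i • (v i : V),
    hs.sum_mem (fun i _ => t.2.1 i) t.2.2 (fun i _ => (v i).2)⟩
  continuous_toFun := Continuous.subtype_mk (continuous_finsetSum _ fun i _ =>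
    ((continuous_apply i).comp continuous_subtype_val).smul continuous_const) _

lemma coe_affineSimplex {s : Set V} (hs : Convex ℝ s) {n : ℕ} (v : Fin n → s)
    (t : stdSimplex ℝ (Fin n)) : (affineSimplex hs v t : V) = ∑ i, t.1 i • (v i : V) := rfl

/-- A map between convex sets that is compatible with affine simplices. -/
def IsAffineBetween {s : Set V} (hs : Convex ℝ s) {t : Set W} (ht : Convex ℝ t) (g : s → t) :
    Prop :=
  ∀ (n : ℕ) (v : Fin n → s) (u : stdSimplex ℝ (Fin n)),
    g (affineSimplex hs v u) = affineSimplex ht (g ∘ v) u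

/-- Convex combinations of convex combinations are again convex combinations. Through this,
operators on tuples that commute with affine maps become well-defined natural operators on singular
chains. -/
lemma isAffineBetween_affineSimplex {s : Set V} (hs : Convex ℝ s) {m : ℕ} (w : Fin m → s) :
    IsAffineBetween (convex_stdSimplex ℝ (Fin m)) hs (affineSimplex hs w) := by
  intro n v u
  ext
  simp only [coe_affineSimplex, Function.comp_apply, Finset.sum_apply, Pi.smul_apply, smul_eq_mul,
    Finset.sum_smul, Finset.smul_sum, mul_smul]
  rw [Finset.sum_comm]

/-- The vertices of the standard simplex. -/
def stdVertex (n : ℕ) (i : Fin n) : stdSimplex ℝ (Fin n) :=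
  ⟨Pi.single i 1, single_mem_stdSimplex ℝ i⟩

@[simp] lemma affineSimplex_stdVertex {s : Set V} (hs : Convex ℝ s) {n : ℕ} (v : Fin n → s)
    (i : Fin n) : affineSimplex hs v (stdVertex n i) = v i := by
  ext
  rw [coe_affineSimplex, Finset.sum_eq_single i]
  · simp [stdVertex]
  · intro j _ hj
    simp [stdVertex, hj]
  · simp

lemma affineSimplex_vertices (n : ℕ) :
    affineSimplex (convex_stdSimplex ℝ (Fin n)) (stdVertex n) = ContinuousMap.id _ := by
  ext1 t
  apply Subtype.ext
  funext i
  rw [coe_affineSimplex]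
  simp [stdVertex, Finset.sum_apply, Pi.single_apply]

/-- The barycentre of the standard simplex. -/
def stdBarycenter (n : ℕ) : stdSimplex ℝ (Fin (n + 1)) :=
  ⟨fun _ => ((n : ℝ) + 1)⁻¹, fun _ => by positivity, by
    simp; field_simp⟩

/-- The barycentre of a nonempty tuple in a convex set. -/
def barycenter {s : Set V} (hs : Convex ℝ s) (n : ℕ) (v : Fin (n + 1) → s) : s :=
  affineSimplex hs v (stdBarycenter n)

/-- The inclusion of the `i`-th face of the standard simplex. -/
def stdFace {n : ℕ} (i : Fin (n + 1)) : C(stdSimplex ℝ (Fin n), stdSimplex ℝ (Fin (n + 1))) :=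
  affineSimplex (convex_stdSimplex ℝ (Fin (n + 1))) (stdVertex (n + 1) ∘ i.succAbove)

lemma affineSimplex_comp_stdFace {s : Set V} (hs : Convex ℝ s) {n : ℕ} (v : Fin (n + 1) → s)
    (i : Fin (n + 1)) :
    (affineSimplex hs v).comp (stdFace i) = affineSimplex hs (v ∘ i.succAbove) := by
  ext1 u
  rw [ContinuousMap.comp_apply, stdFace, isAffineBetween_affineSimplex]
  congr 2
  funext j
  simp

end Affine

/-! ### Singular chains -/

/-- Singular simplices of all dimensions, including the empty simplex. -/
abbrev SingularSimplex (X : Type*) [TopologicalSpace X] :=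
  Σ n : ℕ, C(stdSimplex ℝ (Fin n), X)

/-- Singular chains of all degrees. The chains on simplices with `n` vertices form the part of
degree `n - 1` of the augmented singular chain complex. -/
abbrev SingularChain (K : Type*) [Field K] (X : Type*) [TopologicalSpace X] :=
  SingularSimplex X →₀ K

namespace SingularChain

variable {K : Type*} [Field K] {X Y Z : Type*} [TopologicalSpace X] [TopologicalSpace Y]
  [TopologicalSpace Z]

/-- The basis chain given by a simplex. -/
abbrev of (K : Type*) [Field K] {X : Type*} [TopologicalSpace X] {n : ℕ}
    (σ : C(stdSimplex ℝ (Fin n), X)) : SingularChain K X :=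
  Finsupp.single ⟨n, σ⟩ 1

/-- The boundary of a simplex. -/
def boundarySimplex (K : Type*) [Field K] {X : Type*} [TopologicalSpace X] :
    SingularSimplex X → SingularChain K X
  | ⟨0, _⟩ => 0
  | ⟨n + 1, σ⟩ => ∑ i : Fin (n + 1), (-1 : K) ^ (i : ℕ) • of K (σ.comp (stdFace i))

/-- The singular boundary operator. -/
def boundary (K : Type*) [Field K] (X : Type*) [TopologicalSpace X] :
    SingularChain K X →ₗ[K] SingularChain K X :=
  Finsupp.linearCombination K (boundarySimplex K)

/-- The map induced by a continuous map. -/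
def map (K : Type*) [Field K] {X Y : Type*} [TopologicalSpace X] [TopologicalSpace Y]
    (f : C(X, Y)) : SingularChain K X →ₗ[K] SingularChain K Y :=
  Finsupp.lmapDomain K K fun σ => ⟨σ.1, f.comp σ.2⟩

@[simp] lemma boundary_of_zero (σ : C(stdSimplex ℝ (Fin 0), X)) :
    boundary K X (of K σ) = 0 := by
  simp [boundary, boundarySimplex]

lemma boundary_of_succ {n : ℕ} (σ : C(stdSimplex ℝ (Fin (n + 1)), X)) :
    boundary K X (of K σ) =
      ∑ i : Fin (n + 1), (-1 : K) ^ (i : ℕ) • of K (σ.comp (stdFace i)) := by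
  simp [boundary, boundarySimplex]

@[simp] lemma map_of (f : C(X, Y)) {n : ℕ} (σ : C(stdSimplex ℝ (Fin n), X)) :
    map K f (of K σ) = of K (f.comp σ) := by
  simp [map, Finsupp.lmapDomain_apply, Finsupp.mapDomain_single]

lemma hom_ext {M : Type*} [AddCommGroup M] [Module K M] {f g : SingularChain K X →ₗ[K] M}
    (h : ∀ n (σ : C(stdSimplex ℝ (Fin n), X)), f (of K σ) = g (of K σ))
    (x : SingularChain K X) : f x = g x := by
  refine DFunLike.congr_fun (Finsupp.lhom_ext' fun v => LinearMap.ext_ring ?_) x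
  exact h v.1 v.2

lemma boundary_map (f : C(X, Y)) (x : SingularChain K X) :
    boundary K Y (map K f x) = map K f (boundary K X x) := by
  refine hom_ext (f := boundary K Y ∘ₗ map K f) (g := map K f ∘ₗ boundary K X) (fun n v => ?_) x
  rcases n with _ | n
  · simp
  · simp only [LinearMap.comp_apply, map_of, boundary_of_succ, map_sum, map_smul,
      ContinuousMap.comp_assoc]

section Push

variable {V W : Type*} [NormedAddCommGroup V] [NormedSpace ℝ V]
  [NormedAddCommGroup W] [NormedSpace ℝ W] {s : Set V} {t : Set W}

/-- The singular chain obtained from a chain of affine simplices by composition with `f`. -/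
def push (K : Type*) [Field K] (hs : Convex ℝ s) (f : C(s, X)) :
    TupleChain K s →ₗ[K] SingularChain K X :=
  Finsupp.lmapDomain K K fun v => ⟨v.1, f.comp (affineSimplex hs v.2)⟩

@[simp] lemma push_of (hs : Convex ℝ s) (f : C(s, X)) {n : ℕ} (v : Fin n → s) :
    push K hs f (TupleChain.of K v) = of K (f.comp (affineSimplex hs v)) := by
  simp [push, Finsupp.lmapDomain_apply, Finsupp.mapDomain_single]

lemma boundary_push (hs : Convex ℝ s) (f : C(s, X)) (x : TupleChain K s) :
    boundary K X (push K hs f x) = push K hs f (TupleChain.boundary K s x) := by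
  refine TupleChain.hom_ext (f := boundary K X ∘ₗ push K hs f)
    (g := push K hs f ∘ₗ TupleChain.boundary K s) (fun n v => ?_) x
  rcases n with _ | n
  · simp
  · simp only [LinearMap.comp_apply, push_of, boundary_of_succ, TupleChain.boundary_of_succ,
      map_sum, map_smul, ContinuousMap.comp_assoc, affineSimplex_comp_stdFace]

/-- Every singular simplex is the image of the tuple of standard vertices, so identities for
singular chains reduce to identities for tuples. -/
lemma push_vertices {n : ℕ} (σ : C(stdSimplex ℝ (Fin n), X)) :
    push K (convex_stdSimplex ℝ (Fin n)) σ (TupleChain.of K (stdVertex n)) = of K σ := by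
  rw [push_of, affineSimplex_vertices, ContinuousMap.comp_id]

lemma push_map (hs : Convex ℝ s) (ht : Convex ℝ t) (f : C(t, X)) (g : C(s, t))
    (hg : IsAffineBetween hs ht g) (x : TupleChain K s) :
    push K ht f (TupleChain.map K g x) = push K hs (f.comp g) x := by
  refine TupleChain.hom_ext (f := push K ht f ∘ₗ TupleChain.map K g)
    (g := push K hs (f.comp g)) (fun n v => ?_) x
  simp only [LinearMap.comp_apply, TupleChain.map_of, push_of, ContinuousMap.comp_assoc]
  congr 4
  ext1 u
  exact (hg n v u).symm

lemma map_push (hs : Convex ℝ s) (f : C(s, X)) (g : C(X, Y)) (x : TupleChain K s) :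
    map K g (push K hs f x) = push K hs (g.comp f) x := by
  refine TupleChain.hom_ext (f := map K g ∘ₗ push K hs f)
    (g := push K hs (g.comp f)) (fun n v => ?_) x
  simp [ContinuousMap.comp_assoc]

end Push

lemma boundary_of (K : Type*) [Field K] {n : ℕ} (σ : C(stdSimplex ℝ (Fin n), X)) :
    boundary K X (of K σ) = push K (convex_stdSimplex ℝ (Fin n)) σ
      (TupleChain.boundary K _ (TupleChain.of K (stdVertex n))) := by
  rw [← boundary_push, push_vertices]

lemma boundary_boundary (x : SingularChain K X) : boundary K X (boundary K X x) = 0 := by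
  refine hom_ext (f := boundary K X ∘ₗ boundary K X) (g := 0) (fun n σ => ?_) x
  simp only [LinearMap.comp_apply, LinearMap.zero_apply]
  rw [boundary_of, boundary_push, TupleChain.boundary_boundary, map_zero]

/-! ### Chains with support in a subset -/

/-- The chains all of whose simplices have image in `A`. -/
def chainsIn (K : Type*) [Field K] {X : Type*} [TopologicalSpace X] (A : Set X) :
    Submodule K (SingularChain K X) :=
  Finsupp.supported K K {σ | Set.range σ.2 ⊆ A}

lemma of_mem_chainsIn {A : Set X} {n : ℕ} {σ : C(stdSimplex ℝ (Fin n), X)}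
    (h : ∀ t, σ t ∈ A) : of K σ ∈ chainsIn K A :=
  Finsupp.single_mem_supported K 1 (by rintro _ ⟨t, rfl⟩; exact h t)

/-- Supported functions are spanned by basis vectors. With `N = ⊥` and a difference of two maps this
also proves that the maps agree on a supported submodule. -/
lemma _root_.Finsupp.forall_mem_of_supported {ι M : Type*} [AddCommGroup M] [Module K M]
    {s : Set ι} (f : (ι →₀ K) →ₗ[K] M) {N : Submodule K M}
    (h : ∀ i ∈ s, f (Finsupp.single i 1) ∈ N) {x : ι →₀ K} (hx : x ∈ Finsupp.supported K K s) :
    f x ∈ N := by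
  rw [Finsupp.supported_eq_span_single] at hx
  have : Submodule.span K ((fun i => Finsupp.single i (1 : K)) '' s) ≤ N.comap f := by
    rw [Submodule.span_le]
    rintro _ ⟨i, hi, rfl⟩
    exact h i hi
  exact this hx

lemma forall_mem_of_chainsIn {M : Type*} [AddCommGroup M] [Module K M] {A : Set X}
    (f : SingularChain K X →ₗ[K] M) {N : Submodule K M}
    (h : ∀ n (σ : C(stdSimplex ℝ (Fin n), X)), (∀ t, σ t ∈ A) → f (of K σ) ∈ N)
    {x : SingularChain K X} (hx : x ∈ chainsIn K A) : f x ∈ N :=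
  Finsupp.forall_mem_of_supported f
    (s := {σ : SingularSimplex X | Set.range σ.2 ⊆ A}) (fun σ hσ => h σ.1 σ.2 fun t => hσ ⟨t, rfl⟩)
    hx

lemma chainsIn_mono {A B : Set X} (h : A ⊆ B) : chainsIn K A ≤ chainsIn K B :=
  Finsupp.supported_mono fun _ hσ => subset_trans hσ h

lemma boundary_mem_chainsIn {A : Set X} {x : SingularChain K X} (hx : x ∈ chainsIn K A) :
    boundary K X x ∈ chainsIn K A := by
  refine forall_mem_of_chainsIn _ (fun n σ hσ => ?_) hx
  rcases n with _ | n
  · simp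
  · rw [boundary_of_succ]
    exact Submodule.sum_mem _ fun i _ => Submodule.smul_mem _ _ (of_mem_chainsIn fun t => hσ _)

lemma chainsIn_inf (A B : Set X) : chainsIn K A ⊓ chainsIn K B = chainsIn K (A ∩ B) := by
  rw [chainsIn, chainsIn, chainsIn, ← Finsupp.supported_inter]
  congr 1
  ext σ
  simp

/-- Submodules do not form a distributive lattice in general, but those spanned by subsets of one
fixed basis do. -/
lemma chainsIn_sup_inf (A B C : Set X) :
    (chainsIn K A ⊔ chainsIn K B) ⊓ chainsIn K C = chainsIn K (A ∩ C) ⊔ chainsIn K (B ∩ C) := by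
  rw [← chainsIn_inf, ← chainsIn_inf, chainsIn, chainsIn, chainsIn, ← Finsupp.supported_union,
    ← Finsupp.supported_inter, ← Finsupp.supported_inter, ← Finsupp.supported_inter,
    ← Finsupp.supported_union, Set.union_inter_distrib_right]

lemma map_mem_chainsIn (f : C(X, Y)) {A : Set X} {B : Set Y} (h : Set.MapsTo f A B)
    {x : SingularChain K X} (hx : x ∈ chainsIn K A) : map K f x ∈ chainsIn K B := by
  refine forall_mem_of_chainsIn _ (fun n σ hσ => ?_) hx
  rw [map_of]
  exact of_mem_chainsIn fun t => h (hσ t)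

lemma map_injective {f : C(X, Y)} (hf : Function.Injective f) :
    Function.Injective (map K f) := by
  refine Finsupp.mapDomain_injective ?_
  rintro ⟨n, σ⟩ ⟨m, τ⟩ h
  obtain rfl : n = m := congrArg Sigma.fst h
  simp only [Sigma.mk.injEq, heq_eq_eq, true_and] at h ⊢
  ext1 t
  exact hf (DFunLike.congr_fun h t)

/-- The inclusion of a subset, as a continuous map. -/
abbrev inclusion (A : Set X) : C(A, X) := ⟨Subtype.val, continuous_subtype_val⟩

lemma exists_map_inclusion {A : Set X} {x : SingularChain K X} (hx : x ∈ chainsIn K A) :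
    ∃ y, map K (inclusion A) y = x := by
  refine forall_mem_of_chainsIn (N := LinearMap.range (map K (inclusion A))) LinearMap.id
    (fun n σ hσ => ⟨of K ⟨fun t => ⟨σ t, hσ t⟩, by fun_prop⟩, ?_⟩) hx
  rw [map_of]
  rfl

/-- An injective map sends distinct simplices to distinct simplices, so no cancellation can hide
part of the support. -/
lemma mem_chainsIn_of_map {f : C(X, Y)} (hf : Function.Injective f) {A : Set Y}
    {x : SingularChain K X} (hx : map K f x ∈ chainsIn K A) : x ∈ chainsIn K (f ⁻¹' A) := by
  classical
  have hinj : Function.Injective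
      (fun σ : SingularSimplex X => (⟨σ.1, f.comp σ.2⟩ : SingularSimplex Y)) := by
    rintro ⟨n, σ⟩ ⟨m, τ⟩ h
    obtain rfl : n = m := congrArg Sigma.fst h
    simp only [Sigma.mk.injEq, heq_eq_eq, true_and] at h ⊢
    ext1 t
    exact hf (DFunLike.congr_fun h t)
  rw [chainsIn, Finsupp.mem_supported] at hx ⊢
  rw [map, Finsupp.lmapDomain_apply, Finsupp.mapDomain_support_of_injective hinj,
    Finset.coe_image] at hx
  rintro σ hσ _ ⟨t, rfl⟩
  exact hx ⟨σ, hσ, rfl⟩ ⟨t, rfl⟩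

lemma push_mem_chainsIn {V : Type*} [NormedAddCommGroup V] [NormedSpace ℝ V] {s : Set V}
    (hs : Convex ℝ s) {f : C(s, X)} {A : Set X} (h : ∀ t, f t ∈ A) (x : TupleChain K s) :
    push K hs f x ∈ chainsIn K A := by
  refine Finsupp.forall_mem_of_supported (s := Set.univ) _ (fun v _ => ?_)
    (by simp [Finsupp.supported_univ])
  rw [show (Finsupp.single v (1 : K)) = TupleChain.of K v.2 from rfl, push_of]
  exact of_mem_chainsIn fun t => h _

/-! ### Homotopy invariance -/

section Prism

/-- The cylinder over a convex set. -/
abbrev cylinder {V : Type*} (s : Set V) : Set (V × ℝ) := s ×ˢ Set.Icc (0 : ℝ) 1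

set_option linter.unusedSectionVars false

variable {V W : Type*} [NormedAddCommGroup V] [NormedSpace ℝ V]
  [NormedAddCommGroup W] [NormedSpace ℝ W] {s : Set V} {t : Set W}

lemma convex_cylinder (hs : Convex ℝ s) : Convex ℝ (cylinder s) := hs.prod (convex_Icc 0 1)

/-- The embedding of a set in its cylinder at height `c`. -/
def cylinderEmb (s : Set V) (c : Set.Icc (0 : ℝ) 1) : C(s, cylinder s) where
  toFun x := ⟨(x, c), x.2, c.2⟩
  continuous_toFun := by fun_prop

/-- The map of cylinders induced by a map. -/
def cylinderMap (g : C(s, t)) : C(cylinder s, cylinder t) where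
  toFun x := ⟨(g ⟨x.1.1, x.2.1⟩, x.1.2), (g ⟨x.1.1, x.2.1⟩).2, x.2.2⟩
  continuous_toFun := by fun_prop

lemma isAffineBetween_cylinderEmb (hs : Convex ℝ s) (c : Set.Icc (0 : ℝ) 1) :
    IsAffineBetween hs (convex_cylinder hs) (cylinderEmb s c) := by
  intro n v u
  ext
  · simp [cylinderEmb, coe_affineSimplex, Prod.fst_sum]
  · simp [cylinderEmb, coe_affineSimplex, Prod.snd_sum, ← Finset.sum_mul, u.2.2]

lemma isAffineBetween_cylinderMap (hs : Convex ℝ s) (ht : Convex ℝ t) {g : C(s, t)}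
    (hg : IsAffineBetween hs ht g) :
    IsAffineBetween (convex_cylinder hs) (convex_cylinder ht) (cylinderMap g) := by
  intro n v u
  ext
  · have h : (⟨(affineSimplex (convex_cylinder hs) v u).1.1,
        (affineSimplex (convex_cylinder hs) v u).2.1⟩ : s) =
        affineSimplex hs (fun i => ⟨(v i).1.1, (v i).2.1⟩) u := by
      ext
      simp [coe_affineSimplex, Prod.fst_sum]
    simp only [cylinderMap, ContinuousMap.coe_mk, h, hg n _ u]
    simp [coe_affineSimplex, Prod.fst_sum]
  · simp [cylinderMap, coe_affineSimplex, Prod.snd_sum]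

/-- The prism operator on chains of tuples. -/
def tuplePrism (K : Type*) [Field K] (s : Set V) : TupleChain K s →ₗ[K] TupleChain K (cylinder s) :=
  TupleChain.homotopy (TupleChain.map K (cylinderEmb s 1)) (TupleChain.map K (cylinderEmb s 0))
    (fun _ v => cylinderEmb s 0 (v 0))

lemma boundary_tuplePrism (x : TupleChain K s) :
    TupleChain.boundary K _ (tuplePrism K s x) + tuplePrism K s (TupleChain.boundary K s x) =
      TupleChain.map K (cylinderEmb s 1) x - TupleChain.map K (cylinderEmb s 0) x := by
  refine TupleChain.boundary_homotopy (TupleChain.map_boundary _) (TupleChain.map_boundary _)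
    (fun v => ?_) x
  simp only [TupleChain.map_of]
  rw [Subsingleton.elim (cylinderEmb s 1 ∘ v) (cylinderEmb s 0 ∘ v)]

lemma map_map_cylinder (g : C(s, t)) (c : Set.Icc (0 : ℝ) 1) (x : TupleChain K s) :
    TupleChain.map K (cylinderMap g) (TupleChain.map K (cylinderEmb s c) x) =
      TupleChain.map K (cylinderEmb t c) (TupleChain.map K g x) := by
  refine TupleChain.hom_ext
    (f := TupleChain.map K (cylinderMap g) ∘ₗ TupleChain.map K (cylinderEmb s c))
    (g := TupleChain.map K (cylinderEmb t c) ∘ₗ TupleChain.map K g) (fun n v => ?_) x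
  simp only [LinearMap.comp_apply, TupleChain.map_of]
  rfl

lemma map_tuplePrism (g : C(s, t)) (x : TupleChain K s) :
    TupleChain.map K (cylinderMap g) (tuplePrism K s x) =
      tuplePrism K t (TupleChain.map K g x) :=
  TupleChain.map_homotopy g (cylinderMap g) (map_map_cylinder g 1) (map_map_cylinder g 0)
    (fun _ _ => rfl) x

/-- The map from the cylinder over a simplex given by a singular simplex and a homotopy. -/
def prismMap (F : C(X × Set.Icc (0 : ℝ) 1, Y)) (σ : C(s, X)) : C(cylinder s, Y) where
  toFun x := F (σ ⟨x.1.1, x.2.1⟩, ⟨x.1.2, x.2.2⟩)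
  continuous_toFun := by fun_prop

/-- The prism operator of a homotopy. -/
def prism (K : Type*) [Field K] (F : C(X × Set.Icc (0 : ℝ) 1, Y)) :
    SingularChain K X →ₗ[K] SingularChain K Y :=
  Finsupp.linearCombination K fun σ =>
    push K (convex_cylinder (convex_stdSimplex ℝ (Fin σ.1))) (prismMap F σ.2)
      (tuplePrism K _ (TupleChain.of K (stdVertex σ.1)))

lemma prism_of (F : C(X × Set.Icc (0 : ℝ) 1, Y)) {n : ℕ} (σ : C(stdSimplex ℝ (Fin n), X)) :
    prism K F (of K σ) = push K (convex_cylinder (convex_stdSimplex ℝ (Fin n))) (prismMap F σ)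
      (tuplePrism K _ (TupleChain.of K (stdVertex n))) := by
  simp [prism]

lemma prism_push (F : C(X × Set.Icc (0 : ℝ) 1, Y)) (hs : Convex ℝ s) (f : C(s, X))
    (x : TupleChain K s) :
    prism K F (push K hs f x) = push K (convex_cylinder hs) (prismMap F f) (tuplePrism K s x) := by
  refine TupleChain.hom_ext (f := prism K F ∘ₗ push K hs f)
    (g := push K (convex_cylinder hs) (prismMap F f) ∘ₗ tuplePrism K s) (fun n v => ?_) x
  simp only [LinearMap.comp_apply, push_of, prism_of]
  -- The tuple is the affine image of the standard vertices, and the prism on tuples commutes with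
  -- the induced map of cylinders.
  have hv : TupleChain.of K v =
      TupleChain.map K (affineSimplex hs v) (TupleChain.of K (stdVertex n)) := by
    rw [TupleChain.map_of]
    congr 3
    funext i
    simp
  rw [hv, ← map_tuplePrism, push_map (convex_cylinder (convex_stdSimplex ℝ (Fin n))) _ _ _
    (isAffineBetween_cylinderMap _ _ (isAffineBetween_affineSimplex hs v))]
  rfl

lemma boundary_prism (F : C(X × Set.Icc (0 : ℝ) 1, Y)) (x : SingularChain K X) :
    boundary K Y (prism K F x) + prism K F (boundary K X x) =
      map K (F.comp ((ContinuousMap.id X).prodMk (ContinuousMap.const X 1))) x -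
      map K (F.comp ((ContinuousMap.id X).prodMk (ContinuousMap.const X 0))) x := by
  refine hom_ext (f := boundary K Y ∘ₗ prism K F + prism K F ∘ₗ boundary K X)
    (g := map K (F.comp ((ContinuousMap.id X).prodMk (ContinuousMap.const X 1))) -
      map K (F.comp ((ContinuousMap.id X).prodMk (ContinuousMap.const X 0)))) (fun n σ => ?_) x
  simp only [LinearMap.add_apply, LinearMap.comp_apply, LinearMap.sub_apply]
  rw [boundary_of, prism_of, prism_push, boundary_push, ← map_add, boundary_tuplePrism, map_sub,
    push_map (convex_stdSimplex ℝ (Fin n)) _ _ _ (isAffineBetween_cylinderEmb _ _),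
    push_map (convex_stdSimplex ℝ (Fin n)) _ _ _ (isAffineBetween_cylinderEmb _ _)]
  congr 1
  · rw [← push_vertices σ, map_push]
    rfl
  · rw [← push_vertices σ, map_push]
    rfl

lemma prism_mem_chainsIn (F : C(X × Set.Icc (0 : ℝ) 1, Y)) {A : Set X} {B : Set Y}
    (h : ∀ x ∈ A, ∀ c, F (x, c) ∈ B) {x : SingularChain K X} (hx : x ∈ chainsIn K A) :
    prism K F x ∈ chainsIn K B := by
  refine forall_mem_of_chainsIn _ (fun n σ hσ => ?_) hx
  rw [prism_of]
  exact push_mem_chainsIn _ (fun t => h _ (hσ _) _) _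

end Prism

variable {E : Type*} [NormedAddCommGroup E] [NormedSpace ℝ E]

/-- A subset onto which a larger set can be deformed along segments, keeping the subset inside
itself, carries the same homology. -/
theorem relAcyclic_of_deformation {A B : Set E} (r : E → E) (hr : ContinuousOn r B)
    (hBA : Set.MapsTo r B A)
    (hB : ∀ x ∈ B, ∀ c ∈ Set.Icc (0 : ℝ) 1, x + c • (r x - x) ∈ B)
    (hA : ∀ x ∈ A, ∀ c ∈ Set.Icc (0 : ℝ) 1, x + c • (r x - x) ∈ A) :
    RelAcyclic (boundary K E) (chainsIn K A) (chainsIn K B) := by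
  intro z hz hdz
  obtain ⟨w, rfl⟩ := exists_map_inclusion hz
  have hr' : Continuous fun x : B => r x := hr.comp_continuous continuous_subtype_val (fun x => x.2)
  let F : C(B × Set.Icc (0 : ℝ) 1, E) :=
    ⟨fun x => x.1 + (x.2 : ℝ) • (r x.1 - x.1), by
      have : Continuous fun x : B × Set.Icc (0 : ℝ) 1 => r x.1 := hr'.comp continuous_fst
      have h₁ : Continuous fun x : B × Set.Icc (0 : ℝ) 1 => (x.1 : E) :=
        continuous_subtype_val.comp continuous_fst
      have h₂ : Continuous fun x : B × Set.Icc (0 : ℝ) 1 => (x.2 : ℝ) :=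
        continuous_subtype_val.comp continuous_snd
      exact h₁.add (h₂.smul (this.sub h₁))⟩
  have key := boundary_prism (K := K) F w
  have hF₀ : F.comp ((ContinuousMap.id B).prodMk (ContinuousMap.const B 0)) = inclusion B := by
    ext x; simp [F]
  rw [hF₀] at key
  have hw : boundary K B w ∈ chainsIn K (inclusion B ⁻¹' A) := by
    apply mem_chainsIn_of_map Subtype.val_injective
    rwa [← boundary_map]
  have hw' : w ∈ chainsIn K (Set.univ : Set B) := by simp [chainsIn]
  -- The homotopy runs from the identity at time `0` to `r` at time `1`. Hence adding `∂ P w` to `w`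
  -- leaves `r w - P ∂w`; the first term lies in `A` because `r` maps into `A`, the second because
  -- the homotopy preserves `A`.
  refine ⟨-prism K F w, Submodule.neg_mem _ (prism_mem_chainsIn F
    (fun x _ c => hB x x.2 c c.2) hw'), ?_⟩
  have h₁ : map K (F.comp ((ContinuousMap.id B).prodMk (ContinuousMap.const B 1))) w ∈
      chainsIn K A :=
    map_mem_chainsIn _ (fun x _ => by simpa [F] using hBA x.2) hw'
  have h₂ : prism K F (boundary K B w) ∈ chainsIn K A :=
    prism_mem_chainsIn F (fun x hx c => hA x hx c c.2) hw
  have := Submodule.sub_mem _ h₁ h₂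
  rw [map_neg, sub_neg_eq_add]
  convert this using 1
  rw [eq_sub_iff_add_eq, add_assoc, key]
  abel

/-! ### Acyclicity of convex sets -/

lemma relAcyclic_singleton (a : X) : RelAcyclic (boundary K X) ⊥ (chainsIn K {a}) := by
  -- There is one constant simplex with `n` vertices for each `n`. The alternating sum of faces
  -- sends the one with `n + 1` vertices to the one with `n` if `n` is even, and to zero otherwise.
  -- The contraction therefore raises exactly the even ones.
  let h : SingularChain K X →ₗ[K] SingularChain K X :=
    Finsupp.linearCombination K fun σ =>
      if Even σ.1 then of K (ContinuousMap.const (stdSimplex ℝ (Fin (σ.1 + 1))) a) else 0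
  have hh : ∀ n, h (of K (ContinuousMap.const (stdSimplex ℝ (Fin n)) a)) =
      if Even n then of K (ContinuousMap.const (stdSimplex ℝ (Fin (n + 1))) a) else 0 := by
    intro n; simp [h]
  have hb : ∀ n, boundary K X (of K (ContinuousMap.const (stdSimplex ℝ (Fin (n + 1))) a)) =
      if Even n then of K (ContinuousMap.const (stdSimplex ℝ (Fin n)) a) else 0 := by
    intro n
    rw [boundary_of_succ]
    simp only [ContinuousMap.const_comp, ← Finset.sum_smul]
    rw [Fin.sum_univ_eq_sum_range (fun i => (-1 : K) ^ i), neg_one_geom_sum]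
    by_cases hn : Even n <;> simp [hn, Nat.even_add_one]
  have key : ∀ x ∈ chainsIn K {a}, boundary K X (h x) + h (boundary K X x) = x := by
    intro x hx
    have := forall_mem_of_chainsIn (N := ⊥)
      (boundary K X ∘ₗ h + h ∘ₗ boundary K X - LinearMap.id) (fun n σ hσ => ?_) hx
    · simpa [sub_eq_zero] using this
    · obtain rfl : σ = ContinuousMap.const _ a := by ext1 t; exact hσ t
      simp only [LinearMap.sub_apply, LinearMap.add_apply, LinearMap.comp_apply,
        LinearMap.id_apply, hh, Submodule.mem_bot, sub_eq_zero]
      rcases n with _ | n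
      · simp [hb]
      · rw [hb]
        by_cases hn : Even n
        · simp [hn, Nat.even_add_one, hh]
        · simp [hn, Nat.even_add_one, hb]
  intro z hz hdz
  refine ⟨h z, ?_, ?_⟩
  · refine forall_mem_of_chainsIn _ (fun n σ hσ => ?_) hz
    obtain rfl : σ = ContinuousMap.const _ a := by ext1 t; exact hσ t
    rw [hh]
    split_ifs
    · exact of_mem_chainsIn fun t => by simp
    · exact Submodule.zero_mem _
  · have := key z hz
    rw [(Submodule.mem_bot K).1 hdz, map_zero, add_zero] at this
    simp [this]

theorem relAcyclic_of_convex {A : Set E} (hA : Convex ℝ A) (hne : A.Nonempty) :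
    RelAcyclic (boundary K E) ⊥ (chainsIn K A) := by
  obtain ⟨a, ha⟩ := hne
  refine RelAcyclic.trans boundary_boundary bot_le (chainsIn_mono (by simpa using ha))
    (relAcyclic_singleton a) ?_
  refine relAcyclic_of_deformation (fun _ => a) continuousOn_const (fun x _ => by simp)
    (fun x hx c hc => ?_) (fun x hx c hc => ?_)
  · exact hA.add_smul_sub_mem hx ha hc
  · obtain rfl : x = a := hx
    simp

end SingularChain

end

noncomputable section

/-! ### Barycentric subdivision and small simplices -/

namespace TupleChain

variable {K : Type*} [Field K] {V : Type*} [NormedAddCommGroup V] [NormedSpace ℝ V]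

/-- The difference is the average of the `v j - v i`, in which the term `i = j` vanishes: only `n`
of the `n + 1` terms count. -/
lemma dist_barycenter_le {s : Set V} (hs : Convex ℝ s) {n : ℕ} (v : Fin (n + 1) → s) {δ : ℝ}
    (hv : ∀ i j, dist (v i) (v j) ≤ δ) (j : Fin (n + 1)) :
    dist (v j : V) (barycenter hs n v : V) ≤ (n : ℝ) / (n + 1) * δ := by
  have hsum : (v j : V) - (barycenter hs n v : V) =
      ∑ i ∈ Finset.univ.erase j, ((n : ℝ) + 1)⁻¹ • ((v j : V) - (v i : V)) := by
    rw [Finset.sum_erase _ (by simp)]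
    simp only [barycenter, coe_affineSimplex, stdBarycenter, ← Finset.smul_sum,
      Finset.sum_sub_distrib, Finset.sum_const, Finset.card_univ, Fintype.card_fin]
    rw [smul_sub, ← Nat.cast_smul_eq_nsmul ℝ, smul_smul]
    push_cast
    rw [inv_mul_cancel₀ (by positivity), one_smul]
  rw [dist_eq_norm, hsum]
  refine (norm_sum_le_of_le (n := fun _ => ((n : ℝ) + 1)⁻¹ * δ) _ fun i _ => ?_).trans ?_
  · rw [norm_smul, Real.norm_of_nonneg (by positivity), ← dist_eq_norm]
    gcongr
    exact hv j i
  · rw [Finset.sum_const, Finset.card_erase_of_mem (Finset.mem_univ _), Finset.card_univ,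
      Fintype.card_fin, nsmul_eq_mul, Nat.add_sub_cancel]
    exact le_of_eq (by ring)

/-- Tuples with at most `N + 1` points, in the convex hull of `A`, at mutual distance at most
`δ`. -/
def smallTuples (s : Set V) (N : ℕ) (A : Set V) (δ : ℝ) : Set (Σ n : ℕ, Fin n → s) :=
  {w | w.1 ≤ N + 1 ∧ (∀ i, (w.2 i : V) ∈ convexHull ℝ A) ∧ ∀ i j, dist (w.2 i) (w.2 j) ≤ δ}

/-- A new tuple is the barycentre followed by a tuple from a subdivided face. Distances inside the
face are bounded by induction. Distances to the barycentre are bounded at the old vertices, hence on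
their convex hull because balls are convex. The factor uses the bound `N` instead of `n`, so it can
be iterated on chains with tuples of various lengths. -/
lemma subdivTuple_mem_supported {s : Set V} (hs : Convex ℝ s) (N : ℕ) {δ : ℝ} (hδ : 0 ≤ δ) :
    ∀ (n : ℕ) (_ : n ≤ N + 1) (v : Fin n → s), (∀ i j, dist (v i) (v j) ≤ δ) →
      subdivTuple K (barycenter hs) n v ∈ Finsupp.supported K K
        (smallTuples s N (Set.range fun i => (v i : V)) ((N : ℝ) / (N + 1) * δ)) := by
  intro n
  induction n with
  | zero =>
    intro _ v _
    exact Finsupp.single_mem_supported K 1 ⟨by simp, fun i => i.elim0, fun i => i.elim0⟩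
  | succ n ih =>
    intro hn v hv
    set ρ : ℝ := (N : ℝ) / (N + 1) * δ with hρ
    set A : Set V := Set.range fun i => (v i : V) with hA
    have hbd : ∀ y ∈ convexHull ℝ A, dist y (barycenter hs n v : V) ≤ ρ := by
      have : convexHull ℝ A ⊆ Metric.closedBall (barycenter hs n v : V) ρ := by
        refine convexHull_min ?_ (convex_closedBall _ _)
        rintro _ ⟨j, rfl⟩
        refine (dist_barycenter_le hs v hv j).trans ?_
        refine mul_le_mul_of_nonneg_right ?_ hδ
        rw [div_le_div_iff₀ (by positivity) (by positivity)]
        have : (n : ℝ) ≤ N := by exact_mod_cast Nat.le_of_succ_le_succ hn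
        nlinarith
      exact fun y hy => this hy
    have hρ0 : 0 ≤ ρ := by positivity
    have hmem : (barycenter hs n v : V) ∈ convexHull ℝ A := by
      rw [barycenter, coe_affineSimplex]
      exact (convex_convexHull ℝ A).sum_mem (fun i _ => (stdBarycenter n).2.1 i)
        (stdBarycenter n).2.2 (fun i _ => subset_convexHull ℝ A ⟨i, rfl⟩)
    have hsum : (∑ i : Fin (n + 1), (-1 : K) ^ (i : ℕ) •
        subdivTuple K (barycenter hs) n (v ∘ i.succAbove)) ∈
        Finsupp.supported K K (smallTuples s N A ρ ∩ {w | w.1 ≤ n}) := by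
      refine Submodule.sum_mem _ fun i _ => Submodule.smul_mem _ _ ?_
      rw [Finsupp.supported_inter]
      refine ⟨Finsupp.supported_mono ?_ (ih (by omega) (v ∘ i.succAbove) fun _ _ => hv _ _), ?_⟩
      · rintro w ⟨h₁, h₂, h₃⟩
        refine ⟨h₁, fun j => convexHull_mono ?_ (h₂ j), h₃⟩
        rintro _ ⟨k, rfl⟩
        exact ⟨_, rfl⟩
      -- Coning adds a point, so the subdivided faces must be known to have at most `n` points;
      -- `smallTuples` gives only `N + 1`.
      · have : ∀ m (u : Fin m → s), subdivTuple K (barycenter hs) m u ∈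
            Finsupp.supported K K {w : Σ n : ℕ, Fin n → s | w.1 ≤ m} := by
          intro m
          induction m with
          | zero => exact fun u => Finsupp.single_mem_supported K 1 (le_refl 0)
          | succ m ihm =>
            intro u
            rw [subdivTuple]
            refine Finsupp.forall_mem_of_supported (s := {w : Σ n : ℕ, Fin n → s | w.1 ≤ m}) _
              (fun w hw => ?_)
              (Submodule.sum_mem _ fun i _ => Submodule.smul_mem _ _ (ihm (u ∘ i.succAbove)))
            rw [show (Finsupp.single w (1 : K)) = of K w.2 from rfl, cone_of]
            exact Finsupp.single_mem_supported K 1 (Nat.succ_le_succ hw)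
        exact this n _
    rw [subdivTuple]
    refine Finsupp.forall_mem_of_supported _ (fun w hw => ?_) hsum
    rw [show (Finsupp.single w (1 : K)) = of K w.2 from rfl, cone_of]
    obtain ⟨⟨-, h₂, h₃⟩, h₁⟩ := hw
    refine Finsupp.single_mem_supported K 1 ⟨(Nat.succ_le_succ h₁).trans hn, ?_, ?_⟩
    · intro i
      refine Fin.cases ?_ (fun i => ?_) i
      · exact hmem
      · exact h₂ i
    · intro i j
      refine Fin.cases ?_ (fun i => ?_) i <;> refine Fin.cases ?_ (fun j => ?_) j
      · simpa using hρ0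
      · simp only [Fin.cons_zero, Fin.cons_succ]
        rw [dist_comm]
        exact hbd _ (h₂ j)
      · simp only [Fin.cons_zero, Fin.cons_succ]
        exact hbd _ (h₂ i)
      · simpa using h₃ i j

lemma subdiv_pow_mem_supported {s : Set V} (hs : Convex ℝ s) (N : ℕ) {δ : ℝ} (hδ : 0 ≤ δ)
    {x : TupleChain K s} (hx : x ∈ Finsupp.supported K K (smallTuples s N s δ)) (m : ℕ) :
    (subdiv K (barycenter hs) ^ m) x ∈
      Finsupp.supported K K (smallTuples s N s (((N : ℝ) / (N + 1)) ^ m * δ)) := by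
  induction m with
  | zero => simpa using hx
  | succ m ih =>
    rw [pow_succ' (subdiv K (barycenter hs)), Module.End.mul_apply]
    refine Finsupp.forall_mem_of_supported _ (fun w hw => ?_) ih
    rw [show (Finsupp.single w (1 : K)) = of K w.2 from rfl, subdiv_of]
    refine Finsupp.supported_mono ?_ (subdivTuple_mem_supported hs N (by positivity) w.1 hw.1 w.2
      hw.2.2)
    rintro u ⟨h₁, h₂, h₃⟩
    refine ⟨h₁, fun i => ?_, fun i j => (h₃ i j).trans (le_of_eq (by ring))⟩
    exact convexHull_mono (by rintro _ ⟨k, rfl⟩; exact (w.2 k).2) (h₂ i)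

end TupleChain

namespace SingularChain

variable {K : Type*} [Field K] {X : Type*} [TopologicalSpace X]
  {V : Type*} [NormedAddCommGroup V] [NormedSpace ℝ V] {s : Set V}

/-- Barycentric subdivision of singular chains. -/
def subdiv (K : Type*) [Field K] (X : Type*) [TopologicalSpace X] :
    SingularChain K X →ₗ[K] SingularChain K X :=
  Finsupp.linearCombination K fun σ => push K (convex_stdSimplex ℝ (Fin σ.1)) σ.2
    (TupleChain.subdiv K (barycenter (convex_stdSimplex ℝ (Fin σ.1)))
      (TupleChain.of K (stdVertex σ.1)))

/-- The homotopy between the identity and the barycentric subdivision on chains of tuples. -/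
def tupleSubdivHomotopy (K : Type*) [Field K] (hs : Convex ℝ s) :
    TupleChain K s →ₗ[K] TupleChain K s :=
  TupleChain.homotopy LinearMap.id (TupleChain.subdiv K (barycenter hs)) (barycenter hs)

/-- The homotopy between the identity and the barycentric subdivision. -/
def subdivHomotopy (K : Type*) [Field K] (X : Type*) [TopologicalSpace X] :
    SingularChain K X →ₗ[K] SingularChain K X :=
  Finsupp.linearCombination K fun σ => push K (convex_stdSimplex ℝ (Fin σ.1)) σ.2
    (tupleSubdivHomotopy K (convex_stdSimplex ℝ (Fin σ.1)) (TupleChain.of K (stdVertex σ.1)))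

lemma map_affineSimplex_vertices (hs : Convex ℝ s) {n : ℕ} (v : Fin n → s) :
    TupleChain.map K (affineSimplex hs v) (TupleChain.of K (stdVertex n)) =
      TupleChain.of K v := by
  have : affineSimplex hs v ∘ stdVertex n = v := by
    funext i
    simp
  rw [TupleChain.map_of, this]

/-- Affine maps preserve barycentres, so subdividing before or after the affine map makes no
difference. -/
lemma subdiv_push (hs : Convex ℝ s) (f : C(s, X)) (x : TupleChain K s) :
    subdiv K X (push K hs f x) = push K hs f (TupleChain.subdiv K (barycenter hs) x) := by
  refine TupleChain.hom_ext (f := subdiv K X ∘ₗ push K hs f)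
    (g := push K hs f ∘ₗ TupleChain.subdiv K (barycenter hs)) (fun n v => ?_) x
  have hv := isAffineBetween_affineSimplex hs v
  simp only [LinearMap.comp_apply, push_of]
  rw [← map_affineSimplex_vertices hs v,
    ← TupleChain.map_subdiv (b := barycenter (convex_stdSimplex ℝ (Fin n))) _
      (fun k w => hv _ w _), push_map (convex_stdSimplex ℝ (Fin n)) hs f _ hv]
  simp [subdiv]

lemma subdivHomotopy_push (hs : Convex ℝ s) (f : C(s, X)) (x : TupleChain K s) :
    subdivHomotopy K X (push K hs f x) = push K hs f (tupleSubdivHomotopy K hs x) := by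
  refine TupleChain.hom_ext (f := subdivHomotopy K X ∘ₗ push K hs f)
    (g := push K hs f ∘ₗ tupleSubdivHomotopy K hs) (fun n v => ?_) x
  have hv := isAffineBetween_affineSimplex hs v
  simp only [LinearMap.comp_apply, push_of]
  rw [← map_affineSimplex_vertices hs v, tupleSubdivHomotopy,
    ← TupleChain.map_homotopy (α := LinearMap.id)
      (β := TupleChain.subdiv K (barycenter (convex_stdSimplex ℝ (Fin n))))
      (c := barycenter (convex_stdSimplex ℝ (Fin n)))
      (affineSimplex hs v) (affineSimplex hs v) (fun _ => rfl)
      (TupleChain.map_subdiv _ (fun k w => hv _ w _)) (fun k w => hv _ w _),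
    push_map (convex_stdSimplex ℝ (Fin n)) hs f _ hv]
  simp [subdivHomotopy, tupleSubdivHomotopy]

lemma boundary_subdiv (x : SingularChain K X) :
    boundary K X (subdiv K X x) = subdiv K X (boundary K X x) := by
  refine hom_ext (f := boundary K X ∘ₗ subdiv K X) (g := subdiv K X ∘ₗ boundary K X)
    (fun n σ => ?_) x
  simp only [LinearMap.comp_apply]
  rw [← push_vertices σ, subdiv_push, boundary_push, boundary_push, subdiv_push,
    TupleChain.boundary_subdiv]

lemma boundary_subdivHomotopy (x : SingularChain K X) :
    boundary K X (subdivHomotopy K X x) + subdivHomotopy K X (boundary K X x) =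
      x - subdiv K X x := by
  refine hom_ext (f := boundary K X ∘ₗ subdivHomotopy K X + subdivHomotopy K X ∘ₗ boundary K X)
    (g := LinearMap.id - subdiv K X) (fun n σ => ?_) x
  simp only [LinearMap.comp_apply, LinearMap.add_apply, LinearMap.sub_apply, LinearMap.id_apply]
  rw [← push_vertices σ, subdivHomotopy_push, boundary_push, boundary_push, subdiv_push,
    subdivHomotopy_push, ← map_add, ← map_sub, tupleSubdivHomotopy,
    TupleChain.boundary_homotopy (α := LinearMap.id) (fun _ => rfl) TupleChain.boundary_subdiv
      (fun v => (TupleChain.subdiv_of_zero v).symm)]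
  rfl

lemma subdiv_mem_chainsIn {A : Set X} {x : SingularChain K X} (hx : x ∈ chainsIn K A) :
    subdiv K X x ∈ chainsIn K A := by
  refine forall_mem_of_chainsIn _ (fun n σ hσ => ?_) hx
  rw [← push_vertices σ, subdiv_push]
  exact push_mem_chainsIn _ hσ _

lemma subdivHomotopy_mem_chainsIn {A : Set X} {x : SingularChain K X} (hx : x ∈ chainsIn K A) :
    subdivHomotopy K X x ∈ chainsIn K A := by
  refine forall_mem_of_chainsIn _ (fun n σ hσ => ?_) hx
  rw [← push_vertices σ, subdivHomotopy_push]
  exact push_mem_chainsIn _ hσ _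

lemma subdiv_pow_push (hs : Convex ℝ s) (f : C(s, X)) (m : ℕ) (x : TupleChain K s) :
    (subdiv K X ^ m) (push K hs f x) =
      push K hs f ((TupleChain.subdiv K (barycenter hs) ^ m) x) := by
  induction m with
  | zero => simp
  | succ m ih => rw [pow_succ', Module.End.mul_apply, ih, subdiv_push, pow_succ',
      Module.End.mul_apply]

lemma affineSimplex_mem_ball (hs : Convex ℝ s) {n : ℕ} (v : Fin n → s) {δ ε : ℝ} (hδε : δ < ε)
    (hv : ∀ i j, dist (v i) (v j) ≤ δ) (i : Fin n) (t : stdSimplex ℝ (Fin n)) :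
    affineSimplex hs v t ∈ Metric.ball (v i) ε := by
  have : (affineSimplex hs v t : V) ∈ Metric.closedBall (v i : V) δ := by
    rw [coe_affineSimplex]
    exact (convex_closedBall _ _).sum_mem (fun i _ => t.2.1 i) t.2.2 (fun j _ => hv j i)
  exact lt_of_le_of_lt this hδε

/-- Sufficiently fine subdivisions of a simplex consist of simplices that are small with respect to
an open cover. -/
lemma exists_subdiv_pow_mem {B U V : Set X} (hU : IsOpen U) (hV : IsOpen V) (hB : B ⊆ U ∪ V)
    {n : ℕ} (σ : C(stdSimplex ℝ (Fin n), X)) (hσ : ∀ t, σ t ∈ B) :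
    ∃ m, (subdiv K X ^ m) (of K σ) ∈ chainsIn K (B ∩ U) ⊔ chainsIn K (B ∩ V) := by
  -- The standard simplex without vertices is empty, so the empty simplex is already small.
  rcases n with _ | N
  · refine ⟨0, Submodule.mem_sup_left ?_⟩
    rw [pow_zero]
    refine of_mem_chainsIn fun t => ?_
    have := t.2.2
    simp at this
  have hcov : (Set.univ : Set (stdSimplex ℝ (Fin (N + 1)))) ⊆
      ⋃ b : Bool, σ ⁻¹' (bif b then U else V) := by
    intro t _
    rcases hB (hσ t) with h | h
    · exact Set.mem_iUnion.2 ⟨true, h⟩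
    · exact Set.mem_iUnion.2 ⟨false, h⟩
  -- Below a Lebesgue number of the pulled-back cover each affine simplex maps into `U` or into `V`;
  -- the mesh tends to zero geometrically.
  obtain ⟨ε, hε, hball⟩ := lebesgue_number_lemma_of_metric isCompact_univ
    (fun b : Bool => (show IsOpen (bif b then U else V) by cases b <;> assumption).preimage
      σ.continuous) hcov
  obtain ⟨δ, hδ⟩ : ∃ δ, ∀ i j, dist (stdVertex (N + 1) i) (stdVertex (N + 1) j) ≤ δ := by
    obtain ⟨δ, hδ⟩ := Metric.isBounded_iff.1 (bounded_stdSimplex (Fin (N + 1)))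
    exact ⟨δ, fun i j => hδ (stdVertex _ i).2 (stdVertex _ j).2⟩
  have hδ0 : 0 ≤ δ := dist_nonneg.trans (hδ 0 0)
  obtain ⟨m, hm⟩ : ∃ m : ℕ, ((N : ℝ) / (N + 1)) ^ m * δ < ε := by
    have h : Filter.Tendsto (fun m : ℕ => ((N : ℝ) / (N + 1)) ^ m * δ) Filter.atTop
        (nhds (0 * δ)) :=
      (tendsto_pow_atTop_nhds_zero_of_lt_one (by positivity)
        ((div_lt_one (by positivity)).2 (by linarith))).mul_const δ
    rw [zero_mul] at h
    exact ((h.eventually (gt_mem_nhds hε))).exists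
  refine ⟨m, ?_⟩
  rw [← push_vertices σ, subdiv_pow_push]
  refine Finsupp.forall_mem_of_supported _ (fun w hw => ?_)
    (TupleChain.subdiv_pow_mem_supported (convex_stdSimplex ℝ (Fin (N + 1))) N hδ0
      (Finsupp.single_mem_supported K 1 ⟨le_refl _, fun i => subset_convexHull ℝ _
        (stdVertex (N + 1) i).2, hδ⟩) m)
  rw [show (Finsupp.single w (1 : K)) = TupleChain.of K w.2 from rfl, push_of]
  obtain ⟨k, w⟩ := w
  rcases k with _ | k
  · refine Submodule.mem_sup_left (of_mem_chainsIn fun t => ?_)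
    have := t.2.2
    simp at this
  obtain ⟨b, hb⟩ := hball (w 0) (Set.mem_univ _)
  have hmem := fun t => hb (affineSimplex_mem_ball (convex_stdSimplex ℝ (Fin (N + 1))) w hm hw.2.2
    0 t)
  cases b
  · exact Submodule.mem_sup_right (of_mem_chainsIn fun t => ⟨hσ _, hmem t⟩)
  · exact Submodule.mem_sup_left (of_mem_chainsIn fun t => ⟨hσ _, hmem t⟩)

/-- Chains that are small with respect to a relatively open cover compute singular homology. -/
theorem relAcyclic_small {B U V : Set X} (hU : IsOpen U) (hV : IsOpen V) (hB : B ⊆ U ∪ V) :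
    RelAcyclic (boundary K X) (chainsIn K (B ∩ U) ⊔ chainsIn K (B ∩ V)) (chainsIn K B) := by
  set N := chainsIn K (B ∩ U) ⊔ chainsIn K (B ∩ V) with hN
  have hsd : ∀ x ∈ N, subdiv K X x ∈ N := by
    intro x hx
    obtain ⟨a, ha, b, hb, rfl⟩ := Submodule.mem_sup.1 hx
    rw [map_add]
    exact Submodule.add_mem_sup (subdiv_mem_chainsIn ha) (subdiv_mem_chainsIn hb)
  have hT : ∀ x ∈ N, subdivHomotopy K X x ∈ N := by
    intro x hx
    obtain ⟨a, ha, b, hb, rfl⟩ := Submodule.mem_sup.1 hx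
    rw [map_add]
    exact Submodule.add_mem_sup (subdivHomotopy_mem_chainsIn ha) (subdivHomotopy_mem_chainsIn hb)
  have hpow : ∀ (k : ℕ) x, x ∈ N → (subdiv K X ^ k) x ∈ N := by
    intro k
    induction k with
    | zero => exact fun x hx => by simpa using hx
    | succ k ih =>
      intro x hx
      rw [pow_succ', Module.End.mul_apply]
      exact hsd _ (ih x hx)
  have hsmall : ∀ z ∈ chainsIn K B, ∃ m, (subdiv K X ^ m) z ∈ N := by
    let S : Submodule K (SingularChain K X) :=
      { carrier := {z | ∃ m, (subdiv K X ^ m) z ∈ N}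
        add_mem' := by
          rintro a b ⟨m, hm⟩ ⟨k, hk⟩
          refine ⟨m + k, ?_⟩
          rw [map_add]
          refine N.add_mem ?_ ?_
          · rw [add_comm, pow_add, Module.End.mul_apply]
            exact hpow _ _ hm
          · rw [pow_add, Module.End.mul_apply]
            exact hpow _ _ hk
        zero_mem' := ⟨0, by simp⟩
        smul_mem' := by
          rintro c a ⟨m, hm⟩
          exact ⟨m, by rw [map_smul]; exact N.smul_mem _ hm⟩ }
    intro z hz
    exact forall_mem_of_chainsIn (N := S) LinearMap.id
      (fun n σ hσ => exists_subdiv_pow_mem hU hV hB σ hσ) hz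
  intro z hz hdz
  -- Telescoping: each subdivision changes the chain by a boundary plus the homotopy applied to `∂
  -- (sd^m z)`. The latter is small because `∂z` is, and subdivision and homotopy preserve
  -- smallness.
  have hchain : ∀ m, (subdiv K X ^ m) z ∈ chainsIn K B ∧
      boundary K X ((subdiv K X ^ m) z) ∈ N ∧
      ∃ y ∈ chainsIn K B, z - (subdiv K X ^ m) z - boundary K X y ∈ N := by
    intro m
    induction m with
    | zero => exact ⟨by simpa using hz, by simpa using hdz, 0, by simp, by simp⟩
    | succ m ih =>
      obtain ⟨h₁, h₂, y, hy, h₃⟩ := ih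
      rw [pow_succ', Module.End.mul_apply]
      refine ⟨subdiv_mem_chainsIn h₁, by rw [boundary_subdiv]; exact hsd _ h₂,
        y + subdivHomotopy K X ((subdiv K X ^ m) z),
        Submodule.add_mem _ hy (subdivHomotopy_mem_chainsIn h₁), ?_⟩
      have := N.add_mem h₃ (hT _ h₂)
      rw [eq_sub_iff_add_eq'.2 (boundary_subdivHomotopy ((subdiv K X ^ m) z))] at this
      convert this using 1
      rw [map_add]
      abel_nf
  obtain ⟨m, hm⟩ := hsmall z hz
  obtain ⟨-, -, y, hy, h⟩ := hchain m
  refine ⟨y, hy, ?_⟩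
  have := N.add_mem h hm
  convert this using 1
  abel

end SingularChain

end

noncomputable section

/-! ### Finitely generated cones -/

namespace PointedCone

variable {E : Type*} [NormedAddCommGroup E] [NormedSpace ℝ E]

/-- The linear span of a cone. -/
abbrev linSpan (C : PointedCone ℝ E) : Submodule ℝ E := Submodule.span ℝ (C : Set E)

lemma mem_linSpan_iff {C : PointedCone ℝ E} {x : E} :
    x ∈ C.linSpan ↔ ∃ a ∈ C, ∃ b ∈ C, x = a - b := by
  constructor
  · intro hx
    induction hx using Submodule.span_induction with
    | mem x hx => exact ⟨x, hx, 0, C.zero_mem, by simp⟩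
    | zero => exact ⟨0, C.zero_mem, 0, C.zero_mem, by simp⟩
    | add x y _ _ ihx ihy =>
      obtain ⟨a, ha, b, hb, rfl⟩ := ihx
      obtain ⟨a', ha', b', hb', rfl⟩ := ihy
      exact ⟨a + a', C.add_mem ha ha', b + b', C.add_mem hb hb', by abel⟩
    | smul c x _ ih =>
      obtain ⟨a, ha, b, hb, rfl⟩ := ih
      rcases le_total 0 c with hc | hc
      · exact ⟨c • a, C.smul_mem hc ha, c • b, C.smul_mem hc hb, smul_sub _ _ _⟩
      · refine ⟨(-c) • b, C.smul_mem (by linarith) hb, (-c) • a, C.smul_mem (by linarith) ha, ?_⟩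
        simp only [neg_smul, smul_sub]
        abel
  · rintro ⟨a, ha, b, hb, rfl⟩
    exact Submodule.sub_mem _ (Submodule.subset_span ha) (Submodule.subset_span hb)

/-- The cone cut out of `C` by the vanishing of a linear functional. -/
def vanishing (C : PointedCone ℝ E) (l : E →ₗ[ℝ] ℝ) : PointedCone ℝ E where
  carrier := {x | x ∈ C ∧ l x = 0}
  add_mem' := by
    rintro x y ⟨hx, hx'⟩ ⟨hy, hy'⟩
    exact ⟨C.add_mem hx hy, by simp [hx', hy']⟩
  zero_mem' := ⟨C.zero_mem, by simp⟩
  smul_mem' := by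
    rintro c x ⟨hx, hx'⟩
    refine ⟨Submodule.smul_mem C c hx, ?_⟩
    change l ((c : ℝ) • x) = 0
    simp [hx']

lemma isFaceOf_vanishing {C : PointedCone ℝ E} {l : E →ₗ[ℝ] ℝ} (hl : ∀ x ∈ C, 0 ≤ l x) :
    (C.vanishing l).IsFaceOf C := by
  refine ⟨fun x hx => hx.1, fun {x y a} hx hy ha h => ⟨hx, ?_⟩⟩
  have h₁ := h.2
  rw [map_add, map_smul, smul_eq_mul] at h₁
  have h₂ := hl x hx
  have h₃ := hl y hy
  have h₄ : 0 ≤ a * l x := by positivity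
  have h₅ : a * l x = 0 := by linarith
  exact (mul_eq_zero.1 h₅).resolve_left ha.ne'

lemma IsFaceOf.mem_of_mem_linSpan {F C : PointedCone ℝ E} (hF : F.IsFaceOf C) {x : E}
    (hx : x ∈ C) (hxF : x ∈ F.linSpan) : x ∈ F := by
  obtain ⟨a, ha, b, hb, rfl⟩ := mem_linSpan_iff.1 hxF
  exact hF.mem_of_add_mem_left hx (hF.le hb) (by simpa using ha)

lemma linSpan_mono {F C : PointedCone ℝ E} (h : F ≤ C) : F.linSpan ≤ C.linSpan :=
  Submodule.span_mono h

/-- A finitely generated cone is an intersection of finitely many half-spaces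
(Fourier–Motzkin elimination). -/
theorem _root_.Submodule.FG.exists_halfspaces [FiniteDimensional ℝ E] {C : PointedCone ℝ E}
    (hC : C.FG) :
    ∃ A : Finset (E →ₗ[ℝ] ℝ), ∀ x, x ∈ C ↔ ∀ a ∈ A, 0 ≤ a x := by
  classical
  obtain ⟨G, rfl⟩ := hC
  induction G using Finset.induction_on with
  | empty =>
    let b := Module.finBasis ℝ E
    refine ⟨Finset.univ.image (fun i => b.coord i) ∪ Finset.univ.image (fun i => -b.coord i),
      fun x => ?_⟩
    simp only [Finset.coe_empty, Submodule.span_empty, Submodule.mem_bot]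
    constructor
    · rintro rfl a -
      simp
    · intro h
      refine b.ext_elem fun i => ?_
      have h₁ := h (b.coord i) (by simp)
      have h₂ := h (-b.coord i) (by simp)
      simp only [LinearMap.neg_apply, Module.Basis.coord_apply] at h₁ h₂
      simp only [map_zero, Finsupp.coe_zero, Pi.zero_apply]
      linarith
  | insert g G _ ih =>
    obtain ⟨A, hA⟩ := ih
    -- A point lies in the enlarged cone when `x - t g` lies in the old one for some `t ≥ 0`. To
    -- eliminate `t`, keep the constraints nonnegative at `g` and pair each positive one with each
    -- negative one so that `g` cancels.
    refine ⟨A.filter (fun a => 0 ≤ a g) ∪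
      Finset.image₂ (fun a a' => (-a' g) • a + (a g) • a')
        (A.filter fun a => 0 < a g) (A.filter fun a => a g < 0), fun x => ?_⟩
    have hmem : x ∈ Submodule.span {c : ℝ // 0 ≤ c} ((insert g G : Finset E) : Set E) ↔
        ∃ t : ℝ, 0 ≤ t ∧ ∀ a ∈ A, 0 ≤ a x - t * a g := by
      rw [Finset.coe_insert, Submodule.mem_span_insert]
      constructor
      · rintro ⟨c, z, hz, rfl⟩
        refine ⟨c, c.2, fun a ha => ?_⟩
        have := (hA z).1 hz a ha
        change 0 ≤ a ((c : ℝ) • g + z) - c * a g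
        rw [map_add, map_smul, smul_eq_mul]
        linarith
      · rintro ⟨t, ht, h⟩
        refine ⟨⟨t, ht⟩, x - t • g, (hA _).2 fun a ha => ?_, ?_⟩
        · simpa using h a ha
        · change x = t • g + (x - t • g)
          abel
    rw [hmem]
    constructor
    · rintro ⟨t, ht, h⟩ a ha
      rcases Finset.mem_union.1 ha with ha | ha
      · obtain ⟨ha, hag⟩ := Finset.mem_filter.1 ha
        have := h a ha
        nlinarith [mul_nonneg ht hag]
      · obtain ⟨a₁, h₁, a₂, h₂, rfl⟩ := Finset.mem_image₂.1 ha
        obtain ⟨h₁, h₁'⟩ := Finset.mem_filter.1 h₁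
        obtain ⟨h₂, h₂'⟩ := Finset.mem_filter.1 h₂
        have e₁ := mul_nonneg (neg_nonneg.2 h₂'.le) (h a₁ h₁)
        have e₂ := mul_nonneg h₁'.le (h a₂ h₂)
        simp only [LinearMap.add_apply, LinearMap.smul_apply, smul_eq_mul]
        nlinarith
    · intro h
      have hpos : ∀ a ∈ A, 0 ≤ a g → 0 ≤ a x := fun a ha hag =>
        h a (Finset.mem_union_left _ (Finset.mem_filter.2 ⟨ha, hag⟩))
      have hmix : ∀ a ∈ A, ∀ a' ∈ A, 0 < a g → a' g < 0 → 0 ≤ -a' g * a x + a g * a' x := by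
        intro a ha a' ha' hag hag'
        have := h _ (Finset.mem_union_right _ (Finset.mem_image₂_of_mem
          (Finset.mem_filter.2 ⟨ha, hag⟩) (Finset.mem_filter.2 ⟨ha', hag'⟩)))
        simpa using this
      -- Constraints negative at `g` are lower bounds for `t`; the smallest admissible `t` is the
      -- largest of these bounds and `0`.
      let T : Finset ℝ := insert 0 ((A.filter fun a => a g < 0).image fun a => a x / a g)
      have hT : T.Nonempty := ⟨0, Finset.mem_insert_self _ _⟩
      refine ⟨T.max' hT, T.le_max' 0 (Finset.mem_insert_self _ _), fun a ha => ?_⟩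
      have hmax : T.max' hT = 0 ∨ ∃ a' ∈ A, a' g < 0 ∧ a' x / a' g = T.max' hT := by
        have := T.max'_mem hT
        rcases Finset.mem_insert.1 this with h₀ | h₀
        · exact Or.inl h₀
        · obtain ⟨a', ha', he⟩ := Finset.mem_image.1 h₀
          obtain ⟨ha', hag'⟩ := Finset.mem_filter.1 ha'
          exact Or.inr ⟨a', ha', hag', he⟩
      rcases lt_trichotomy (a g) 0 with hag | hag | hag
      · have : a x / a g ≤ T.max' hT := T.le_max' _ (Finset.mem_insert_of_mem
          (Finset.mem_image.2 ⟨a, Finset.mem_filter.2 ⟨ha, hag⟩, rfl⟩))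
        rw [div_le_iff_of_neg hag] at this
        linarith
      · rw [hag, mul_zero, sub_zero]
        exact hpos a ha hag.ge
      · rcases hmax with h₀ | ⟨a', ha', hag', he⟩
        · rw [h₀, zero_mul, sub_zero]
          exact hpos a ha hag.le
        · have h₁ := hmix a ha a' ha' hag hag'
          have h₂ : a' x = T.max' hT * a' g := by rw [← he, div_mul_cancel₀ _ hag'.ne]
          rw [h₂] at h₁
          have h₃ : 0 ≤ (-a' g) * (a x - T.max' hT * a g) := by linarith
          exact nonneg_of_mul_nonneg_right h₃ (by linarith)

lemma _root_.Submodule.FG.isClosed [FiniteDimensional ℝ E] {C : PointedCone ℝ E} (hC : C.FG) :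
    IsClosed (C : Set E) := by
  obtain ⟨A, hA⟩ := hC.exists_halfspaces
  have : (C : Set E) = ⋂ a ∈ A, {x | 0 ≤ a x} := by
    ext x
    simp [hA]
  rw [this]
  exact isClosed_biInter fun a _ =>
    isClosed_le continuous_const (LinearMap.continuous_of_finiteDimensional a)

/-- Every face of a finitely generated cone is exposed. -/
lemma _root_.Submodule.FG.exists_exposing [FiniteDimensional ℝ E] {C F : PointedCone ℝ E}
    (hC : C.FG)
    (hF : F.IsFaceOf C) :
    ∃ l : E →ₗ[ℝ] ℝ, (∀ x ∈ C, 0 ≤ l x) ∧ ∀ x ∈ C, l x = 0 ↔ x ∈ F := by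
  classical
  obtain ⟨A, hA⟩ := hC.exists_halfspaces
  let A₀ := A.filter fun a => ∀ x ∈ F, a x = 0
  -- The exposing functional is the sum of the defining constraints that vanish on `F`. On `C` it
  -- vanishes only where each of them does.
  refine ⟨∑ a ∈ A₀, a, fun x hx => ?_, fun x hx => ⟨fun h => ?_, fun h => ?_⟩⟩
  · rw [LinearMap.sum_apply]
    exact Finset.sum_nonneg fun a ha => (hA x).1 hx a (Finset.mem_filter.1 ha).1
  · rw [LinearMap.sum_apply, Finset.sum_eq_zero_iff_of_nonneg
      fun a ha => (hA x).1 hx a (Finset.mem_filter.1 ha).1] at h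
    have hw : ∀ a : E →ₗ[ℝ] ℝ, ∃ f ∈ F, a ∈ A → a ∉ A₀ → a f ≠ 0 := by
      intro a
      by_cases ha : a ∈ A ∧ a ∉ A₀
      · have : ¬ ∀ x ∈ F, a x = 0 := fun h' => ha.2 (Finset.mem_filter.2 ⟨ha.1, h'⟩)
        push Not at this
        obtain ⟨f, hf, hne⟩ := this
        exact ⟨f, hf, fun _ _ => hne⟩
      · exact ⟨0, F.zero_mem, fun h₁ h₂ => absurd ⟨h₁, h₂⟩ ha⟩
    choose w hwF hw using hw
    -- A single point of `F` at which every constraint not identically zero on `F` is strictly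
    -- positive.
    let f : E := ∑ a ∈ A, w a
    have hfF : f ∈ F := Submodule.sum_mem _ fun a _ => hwF a
    have hfpos : ∀ a ∈ A, a ∉ A₀ → 0 < a f := by
      intro a ha ha₀
      have h₁ : 0 < a (w a) :=
        lt_of_le_of_ne ((hA _).1 (hF.le (hwF a)) a ha) (Ne.symm (hw a ha ha₀))
      have h₂ : a (w a) ≤ a f := by
        rw [map_sum]
        exact Finset.single_le_sum (f := fun i => a (w i))
          (fun i _ => (hA _).1 (hF.le (hwF i)) a ha) ha
      linarith
    -- For small `ε` the point `f - ε x` stays in `C`, so `f ∈ F` is a sum of it and `ε x`, and the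
    -- face property puts `x` in `F`. The `+ 1` in the denominators below avoids division by zero.
    obtain ⟨ε, hε, hεa⟩ : ∃ ε > 0, ∀ a ∈ A, a ∉ A₀ → ε * a x ≤ a f := by
      let T : Finset ℝ := insert 1 ((A \ A₀).image fun a => a f / (a x + 1))
      have hT : T.Nonempty := ⟨1, Finset.mem_insert_self _ _⟩
      have hx0 : ∀ a ∈ A, 0 ≤ a x := (hA x).1 hx
      refine ⟨T.min' hT, ?_, fun a ha ha₀ => ?_⟩
      · rw [gt_iff_lt, Finset.lt_min'_iff]
        intro y hy
        rcases Finset.mem_insert.1 hy with rfl | hy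
        · exact one_pos
        · obtain ⟨a, ha, rfl⟩ := Finset.mem_image.1 hy
          obtain ⟨ha, ha₀⟩ := Finset.mem_sdiff.1 ha
          exact div_pos (hfpos a ha ha₀) (by linarith [hx0 a ha])
      · have h₁ : T.min' hT ≤ a f / (a x + 1) := T.min'_le _ (Finset.mem_insert_of_mem
          (Finset.mem_image.2 ⟨a, Finset.mem_sdiff.2 ⟨ha, ha₀⟩, rfl⟩))
        have h₂ := hx0 a ha
        calc T.min' hT * a x ≤ a f / (a x + 1) * a x := by gcongr
          _ = a f * (a x / (a x + 1)) := by ring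
          _ ≤ a f * 1 := by
            have := (hfpos a ha ha₀).le
            gcongr
            rw [div_le_one (by linarith)]
            linarith
          _ = a f := mul_one _
    have hmem : f - ε • x ∈ C := by
      refine (hA _).2 fun a ha => ?_
      rw [map_sub, map_smul, smul_eq_mul]
      by_cases ha₀ : a ∈ A₀
      · rw [h a ha₀, mul_zero, sub_zero]
        exact (hA f).1 (hF.le hfF) a ha
      · linarith [hεa a ha ha₀]
    exact hF.2 hx hmem hε (by simpa using hfF)
  · rw [LinearMap.sum_apply]
    exact Finset.sum_eq_zero fun a ha => (Finset.mem_filter.1 ha).2 x h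

/-! ### The relative interior -/

/-- The points of a cone that lie in no proper face. -/
def core (C : PointedCone ℝ E) : Set E :=
  {x | x ∈ C ∧ ∀ F : PointedCone ℝ E, F.IsFaceOf C → x ∈ F → F = C}

lemma add_mem_core {C : PointedCone ℝ E} {x y : E} (hx : x ∈ C) (hy : y ∈ C.core) :
    x + y ∈ C.core :=
  ⟨C.add_mem hx hy.1, fun F hF h => hy.2 F hF (hF.mem_of_add_mem_right hx hy.1 h)⟩

lemma smul_mem_core {C : PointedCone ℝ E} {c : ℝ} (hc : 0 < c) {x : E} (hx : x ∈ C.core) :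
    c • x ∈ C.core :=
  ⟨C.smul_mem hc.le hx.1, fun F hF h =>
    hx.2 F hF (hF.2 hx.1 C.zero_mem hc (by simpa using h))⟩

lemma convex_core (C : PointedCone ℝ E) : Convex ℝ C.core := by
  intro x hx y hy a b ha hb hab
  rcases hb.eq_or_lt with rfl | hb
  · obtain rfl : a = 1 := by linarith
    simpa using hx
  · exact add_mem_core (C.smul_mem ha hx.1) (smul_mem_core hb hy)

lemma _root_.Submodule.FG.core_nonempty {C : PointedCone ℝ E} (hC : C.FG) : C.core.Nonempty := by
  obtain ⟨G, rfl⟩ := hC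
  refine ⟨∑ g ∈ G, g, Submodule.sum_mem _ fun g hg => Submodule.subset_span hg,
    fun F hF h => le_antisymm hF.le (Submodule.span_le.2 fun g hg => ?_)⟩
  classical
  rw [← Finset.add_sum_erase _ _ hg] at h
  exact hF.mem_of_add_mem_left (Submodule.subset_span hg)
    (Submodule.sum_mem _ fun g' hg' => Submodule.subset_span (Finset.mem_of_mem_erase hg')) h

lemma zero_notMem_core {C : PointedCone ℝ E} (hC : ∀ x ∈ C, -x ∈ C → x = 0) (h0 : C ≠ ⊥) :
    (0 : E) ∉ C.core := by
  intro h
  refine h0 (h.2 ⊥ ⟨bot_le, fun {x y a} hx hy ha hxy => ?_⟩ (Submodule.zero_mem _)).symm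
  rw [Submodule.mem_bot] at hxy ⊢
  have h₁ : y = -(a • x) := eq_neg_of_add_eq_zero_right hxy
  have h₂ := hC (a • x) (C.smul_mem ha.le hx) (h₁ ▸ hy)
  exact (smul_eq_zero.1 h₂).resolve_left (ne_of_gt ha)

/-- Every point of a cone is in the core of a unique smallest face. -/
lemma exists_mem_core {C : PointedCone ℝ E} {x : E} (hx : x ∈ C) :
    ∃ F : PointedCone ℝ E, F.IsFaceOf C ∧ x ∈ F.core := by
  let S : Set (PointedCone ℝ E) := {F | F.IsFaceOf C ∧ x ∈ F}
  have hS : (sInf S ⊓ C).IsFaceOf C := by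
    refine ⟨inf_le_right, fun {y z a} hy hz ha h => ⟨?_, hy⟩⟩
    refine Submodule.mem_sInf.2 fun F hF => ?_
    exact hF.1.2 hy hz ha (Submodule.mem_sInf.1 h.1 F hF)
  refine ⟨_, hS, ⟨Submodule.mem_sInf.2 fun F hF => hF.2, hx⟩, fun F hF hxF => ?_⟩
  exact le_antisymm hF.le (inf_le_left.trans (sInf_le ⟨hF.trans hS, hxF⟩))

lemma affineSpan_le_linSpan (C : PointedCone ℝ E) {x : E} (hx : x ∈ affineSpan ℝ (C : Set E)) :
    x ∈ C.linSpan := by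
  have := affineSpan_le.2 (show (C : Set E) ⊆ C.linSpan.toAffineSubspace from
    fun y hy => Submodule.subset_span hy) hx
  exact this

/-- From a relative interior point one can move a little in direction `-y` for any `y` in `C`, so a
face containing the point contains `y`. Conversely, a point in no proper face satisfies strictly
every constraint not vanishing on `C`, and the other constraints vanish on the whole span. -/
theorem _root_.Submodule.FG.intrinsicInterior_eq_core [FiniteDimensional ℝ E]
    {C : PointedCone ℝ E} (hC : C.FG) :
    intrinsicInterior ℝ (C : Set E) = C.core := by
  obtain ⟨A, hA⟩ := hC.exists_halfspaces
  ext x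
  constructor
  · rintro ⟨x', hx', rfl⟩
    have hxC : (x' : E) ∈ C := interior_subset (s := Subtype.val ⁻¹' (C : Set E)) hx'
    refine ⟨hxC, fun F hF hxF => le_antisymm hF.le fun y hy => ?_⟩
    have h0 : (0 : E) ∈ affineSpan ℝ (C : Set E) := subset_affineSpan _ _ C.zero_mem
    let γ : ℝ → affineSpan ℝ (C : Set E) := fun t =>
      ⟨t • ((0 : E) -ᵥ y) +ᵥ (x' : E), AffineSubspace.smul_vsub_vadd_mem _ t h0
        (subset_affineSpan _ _ hy) x'.2⟩
    have hγ : Continuous γ := by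
      refine Continuous.subtype_mk ?_ _
      simp only [vsub_eq_sub, vadd_eq_add]
      fun_prop
    have hγ0 : γ 0 = x' := by
      apply Subtype.ext
      simp [γ]
    have hev : ∀ᶠ t in nhds (0 : ℝ), (γ t : E) ∈ C := by
      have := hγ.continuousAt.preimage_mem_nhds
        (show _ ∈ nhds (γ 0) from hγ0 ▸ isOpen_interior.mem_nhds hx')
      filter_upwards [this] with t ht
      exact interior_subset (s := (Subtype.val ⁻¹' (C : Set E))) ht
    obtain ⟨ε, hε, hball⟩ := Metric.eventually_nhds_iff.1 hev
    have hC' := hball (y := ε / 2) (by rw [dist_zero_right, Real.norm_of_nonneg (by linarith)]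
                                       linarith)
    have he : (ε / 2) • y + (γ (ε / 2) : E) = x' := by
      simp only [γ, vsub_eq_sub, vadd_eq_add, zero_sub, smul_neg]
      abel
    exact hF.2 hy hC' (half_pos hε) (he ▸ hxF)
  · intro hx
    have hx' : x ∈ affineSpan ℝ (C : Set E) := subset_affineSpan _ _ hx.1
    have hpos : ∀ a ∈ A, (∃ y ∈ C, a y ≠ 0) → 0 < a x := by
      rintro a ha ⟨y, hy, hne⟩
      refine lt_of_le_of_ne ((hA x).1 hx.1 a ha) fun h => hne ?_
      have := hx.2 _ (isFaceOf_vanishing (C := C) (l := a) fun z hz => (hA z).1 hz a ha)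
        ⟨hx.1, h.symm⟩
      exact (this.ge hy).2
    refine ⟨⟨x, hx'⟩, mem_interior.2 ⟨Subtype.val ⁻¹'
      (⋂ a ∈ {a : E →ₗ[ℝ] ℝ | a ∈ A ∧ ∃ y ∈ C, a y ≠ 0}, {z : E | 0 < a z}),
      fun z hz => (hA _).2 fun a ha => ?_,
      IsOpen.preimage continuous_subtype_val ?_, ?_⟩, rfl⟩
    · by_cases h : ∃ y ∈ C, a y ≠ 0
      · have := Set.mem_iInter₂.1 hz a ⟨ha, h⟩
        exact le_of_lt this
      · push Not at h
        obtain ⟨u, hu, v, hv, he⟩ := mem_linSpan_iff.1 (affineSpan_le_linSpan C z.2)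
        rw [he, map_sub, h u hu, h v hv, sub_zero]
    · refine Set.Finite.isOpen_biInter (A.finite_toSet.subset fun a ha => ha.1) fun a _ => ?_
      exact isOpen_lt continuous_const (LinearMap.continuous_of_finiteDimensional a)
    · exact Set.mem_iInter₂.2 fun a ha => hpos a ha.1 ha.2

/-! ### Dimensions of faces -/

section Dim

set_option linter.unusedSectionVars false

variable [FiniteDimensional ℝ E]

lemma finrank_linSpan_mono {F C : PointedCone ℝ E} (h : F ≤ C) :
    Module.finrank ℝ F.linSpan ≤ Module.finrank ℝ C.linSpan :=
  Submodule.finrank_mono (linSpan_mono h)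

lemma IsFaceOf.eq_of_finrank_le {F C : PointedCone ℝ E} (hF : F.IsFaceOf C)
    (h : Module.finrank ℝ C.linSpan ≤ Module.finrank ℝ F.linSpan) : F = C := by
  have := Submodule.eq_of_le_of_finrank_le (linSpan_mono hF.le) h
  refine le_antisymm hF.le fun x hx => hF.mem_of_mem_linSpan hx ?_
  rw [this]
  exact Submodule.subset_span hx

lemma IsFaceOf.finrank_lt {F C : PointedCone ℝ E} (hF : F.IsFaceOf C) (hne : F ≠ C) :
    Module.finrank ℝ F.linSpan < Module.finrank ℝ C.linSpan := by
  by_contra h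
  exact hne (hF.eq_of_finrank_le (not_lt.1 h))

/-- Rotate the hyperplane `l = 0` around `F` until it first touches a generator outside `F`. That
generator minimises the slope `m / l`, and the rotated hyperplane still supports `C`. -/
lemma _root_.Submodule.FG.exists_min_slope {F C : PointedCone ℝ E} (hC : C.FG)
    (hF : F.IsFaceOf C) (hne : F ≠ C)
    {l m : E →ₗ[ℝ] ℝ} (hl : ∀ x ∈ C, 0 ≤ l x) (hlF : ∀ x ∈ C, l x = 0 ↔ x ∈ F)
    (hm : ∀ x ∈ F, m x = 0) :
    ∃ g ∈ C, g ∉ F ∧ ∀ x ∈ C, 0 ≤ (l g • m - m g • l) x := by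
  classical
  obtain ⟨G, rfl⟩ := hC
  have hG : ∀ g ∈ G, g ∈ Submodule.span {c : ℝ // 0 ≤ c} (G : Set E) :=
    fun g hg => Submodule.subset_span hg
  have hGne : (G.filter fun g => g ∉ F).Nonempty := by
    by_contra h
    rw [Finset.not_nonempty_iff_eq_empty, Finset.filter_eq_empty_iff] at h
    refine hne (le_antisymm hF.le (Submodule.span_le.2 fun g hg => ?_))
    exact not_not.1 (h hg)
  obtain ⟨g, hg, hmin⟩ := Finset.exists_min_image _ (fun g => m g / l g) hGne
  obtain ⟨hgG, hgF⟩ := Finset.mem_filter.1 hg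
  have hlpos : ∀ g ∈ G, g ∉ F → 0 < l g := fun g hg hgF =>
    lt_of_le_of_ne (hl g (hG g hg)) fun h => hgF ((hlF g (hG g hg)).1 h.symm)
  refine ⟨g, hG g hgG, hgF, fun x hx => ?_⟩
  -- The half-space is written as a dual cone so that the inequality passes from the generators to
  -- their span.
  have hsub : (G : Set E) ⊆ dual (R := ℝ) (M := E →ₗ[ℝ] ℝ) LinearMap.id
      ({l g • m - m g • l} : Set (E →ₗ[ℝ] ℝ)) := by
    intro y hy
    simp only [SetLike.mem_coe, mem_dual, Set.mem_singleton_iff, forall_eq, LinearMap.id_apply,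
      LinearMap.sub_apply, LinearMap.smul_apply, smul_eq_mul]
    by_cases hyF : y ∈ F
    · rw [hm y hyF, (hlF y (hG y hy)).2 hyF]
      simp
    · have := hmin y (Finset.mem_filter.2 ⟨hy, hyF⟩)
      rw [div_le_div_iff₀ (hlpos g hgG hgF) (hlpos y hy hyF)] at this
      linarith
  have := Submodule.span_le.2 hsub hx
  simpa using this

lemma exists_functional {W : Submodule ℝ E} {y : E} (hy : y ∉ W) :
    ∃ m : E →ₗ[ℝ] ℝ, (∀ x ∈ W, m x = 0) ∧ m y ≠ 0 := by
  obtain ⟨f, hf, hW⟩ := Submodule.exists_le_ker_of_notMem hy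
  exact ⟨f, fun x hx => hW hx, hf⟩

/-- In codimension at least two there is a functional vanishing on a face that is independent of a
functional exposing the face. -/
lemma IsFaceOf.exists_independent {F C : PointedCone ℝ E} (hF : F.IsFaceOf C)
    (hdim : Module.finrank ℝ F.linSpan + 2 ≤ Module.finrank ℝ C.linSpan)
    {l : E →ₗ[ℝ] ℝ} (hlF : ∀ x ∈ C, l x = 0 ↔ x ∈ F) :
    ∃ m : E →ₗ[ℝ] ℝ, (∀ x ∈ F, m x = 0) ∧
      ∀ a b : ℝ, (∀ x ∈ C, (a • m - b • l) x = 0) → a = 0 := by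
  obtain ⟨g, hgC, hgF⟩ : ∃ g ∈ C, g ∉ F := by
    by_contra! h
    have : F = C := le_antisymm hF.le h
    rw [this] at hdim
    omega
  -- One vector outside `F` raises the dimension by at most one, so codimension two leaves a point
  -- of `C` outside `W`. A functional zero on `W` but not at that point cannot be proportional to
  -- `l` on `C`.
  let W : Submodule ℝ E := F.linSpan ⊔ Submodule.span ℝ {g}
  obtain ⟨y, hyC, hyW⟩ : ∃ y ∈ C, y ∉ W := by
    by_contra! h
    have h₁ : C.linSpan ≤ W := Submodule.span_le.2 h
    have h₂ := Submodule.finrank_mono h₁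
    simp only [W] at h₂
    have h₃ := Submodule.finrank_add_le_finrank_add_finrank F.linSpan (Submodule.span ℝ {g})
    have h₄ := finrank_span_le_card (R := ℝ) ({g} : Set E)
    simp only [Set.toFinset_singleton, Finset.card_singleton] at h₄
    omega
  obtain ⟨m, hmW, hmy⟩ := exists_functional hyW
  refine ⟨m, fun x hx => hmW x (Submodule.mem_sup_left (Submodule.subset_span hx)),
    fun a b h => ?_⟩
  have hg := h g hgC
  have hy := h y hyC
  have hmg : m g = 0 := hmW g (Submodule.mem_sup_right (Submodule.mem_span_singleton_self g))
  simp only [LinearMap.sub_apply, LinearMap.smul_apply, smul_eq_mul, hmg, mul_zero, zero_sub,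
    neg_eq_zero] at hg hy
  have hb : b = 0 := (mul_eq_zero.1 hg).resolve_right fun h' => hgF ((hlF g hgC).1 h')
  rw [hb, zero_mul, sub_zero] at hy
  exact (mul_eq_zero.1 hy).resolve_right hmy

/-- A face of codimension at least two is properly contained in a proper face. -/
lemma _root_.Submodule.FG.exists_larger_face {F C : PointedCone ℝ E} (hC : C.FG) (hF : F.IsFaceOf C)
    (hdim : Module.finrank ℝ F.linSpan + 2 ≤ Module.finrank ℝ C.linSpan) :
    ∃ F' : PointedCone ℝ E, F'.IsFaceOf C ∧ F' ≠ C ∧ F < F' := by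
  obtain ⟨l, hl, hlF⟩ := hC.exists_exposing hF
  obtain ⟨m, hm, hind⟩ := hF.exists_independent hdim hlF
  have hne : F ≠ C := by
    rintro rfl
    omega
  obtain ⟨g, hgC, hgF, hg⟩ := hC.exists_min_slope hF hne hl hlF hm
  refine ⟨_, isFaceOf_vanishing hg, fun h => ?_, ?_⟩
  · have := hind (l g) (m g) fun x hx => (h.ge hx).2
    exact hgF ((hlF g hgC).1 this)
  · refine lt_of_le_of_ne (fun x hx => ⟨hF.le hx, ?_⟩) fun h => hgF ?_
    · simp [hm x hx, (hlF x (hF.le hx)).2 hx]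
    · rw [h]
      refine ⟨hgC, ?_⟩
      simp only [LinearMap.sub_apply, LinearMap.smul_apply, smul_eq_mul]
      ring

/-- Every proper face is contained in a face of codimension one. -/
lemma _root_.Submodule.FG.exists_facet {F C : PointedCone ℝ E} (hC : C.FG)
    (hF : F.IsFaceOf C) (hne : F ≠ C) :
    ∃ F' : PointedCone ℝ E, F'.IsFaceOf C ∧ F ≤ F' ∧
      Module.finrank ℝ C.linSpan = Module.finrank ℝ F'.linSpan + 1 := by
  induction hk : Module.finrank ℝ C.linSpan - Module.finrank ℝ F.linSpan
    using Nat.strong_induction_on generalizing F with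
  | _ k ih =>
    have hlt := hF.finrank_lt hne
    by_cases h : Module.finrank ℝ F.linSpan + 2 ≤ Module.finrank ℝ C.linSpan
    · obtain ⟨F', hF', hne', hlt'⟩ := hC.exists_larger_face hF h
      have hFF' : F.IsFaceOf F' := (IsFaceOf.isFaceOf_iff_le hF hF').2 hlt'.le
      have h₁ := hFF'.finrank_lt hlt'.ne
      have h₂ := hF'.finrank_lt hne'
      obtain ⟨F'', h₃, h₄, h₅⟩ := ih _ (by omega) hF' hne' rfl
      exact ⟨F'', h₃, hlt'.le.trans h₄, h₅⟩
    · exact ⟨F, hF, le_rfl, by omega⟩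

/-- Between a cone and a face of codimension two there are exactly two faces. -/
lemma _root_.Submodule.FG.diamond {F C : PointedCone ℝ E} (hC : C.FG) (hF : F.IsFaceOf C)
    (hdim : Module.finrank ℝ C.linSpan = Module.finrank ℝ F.linSpan + 2) :
    ∃ E₁ E₂ : PointedCone ℝ E, E₁ ≠ E₂ ∧ E₁.IsFaceOf C ∧ E₂.IsFaceOf C ∧ F.IsFaceOf E₁ ∧
      F.IsFaceOf E₂ ∧ Module.finrank ℝ E₁.linSpan = Module.finrank ℝ F.linSpan + 1 ∧
      Module.finrank ℝ E₂.linSpan = Module.finrank ℝ F.linSpan + 1 ∧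
      ∀ D : PointedCone ℝ E, D.IsFaceOf C → F ≤ D →
        Module.finrank ℝ D.linSpan = Module.finrank ℝ F.linSpan + 1 → D = E₁ ∨ D = E₂ := by
  obtain ⟨l, hl, hlF⟩ := hC.exists_exposing hF
  obtain ⟨m, hm, hind⟩ := hF.exists_independent hdim.ge hlF
  have hne : F ≠ C := by
    rintro rfl
    omega
  -- Modulo `F` the cone is two-dimensional and is described by the slope `m / l`. Its two edges are
  -- the smallest slope, and the largest one obtained from `-m`.
  obtain ⟨g₁, hg₁C, hg₁F, hg₁⟩ := hC.exists_min_slope hF hne hl hlF hm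
  obtain ⟨g₂, hg₂C, hg₂F, hg₂⟩ := hC.exists_min_slope (m := -m) hF hne hl hlF
    (fun x hx => by simp [hm x hx])
  have hpos : ∀ g ∈ C, g ∉ F → 0 < l g := fun g hg hgF =>
    lt_of_le_of_ne (hl g hg) fun h => hgF ((hlF g hg).1 h.symm)
  have hp₁ := hpos g₁ hg₁C hg₁F
  have hp₂ := hpos g₂ hg₂C hg₂F
  have hface : ∀ (g : E) (m' : E →ₗ[ℝ] ℝ) (c : ℝ), m' = c • m → g ∈ C → g ∉ F →
      (∀ x ∈ C, 0 ≤ (l g • m' - m' g • l) x) → c ≠ 0 →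
      (C.vanishing (l g • m' - m' g • l)).IsFaceOf C ∧
      F.IsFaceOf (C.vanishing (l g • m' - m' g • l)) ∧
      C.vanishing (l g • m' - m' g • l) ≠ C ∧
      Module.finrank ℝ (C.vanishing (l g • m' - m' g • l)).linSpan =
        Module.finrank ℝ F.linSpan + 1 := by
    intro g m' c hm' hgC hgF hg hc
    have h₁ := isFaceOf_vanishing hg
    have h₂ : F ≤ C.vanishing (l g • m' - m' g • l) := fun x hx =>
      ⟨hF.le hx, by simp [hm', hm x hx, (hlF x (hF.le hx)).2 hx]⟩
    have h₃ : F.IsFaceOf (C.vanishing (l g • m' - m' g • l)) :=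
      (IsFaceOf.isFaceOf_iff_le hF h₁).2 h₂
    have h₄ : C.vanishing (l g • m' - m' g • l) ≠ C := by
      intro h
      have := hind (l g * c) (m' g) fun x hx => by
        have := (h.ge hx).2
        rw [hm'] at this ⊢
        simpa [mul_assoc] using this
      exact (mul_ne_zero (hpos g hgC hgF).ne' hc) this
    have h₅ : F ≠ C.vanishing (l g • m' - m' g • l) := by
      intro h
      apply hgF
      rw [h]
      refine ⟨hgC, ?_⟩
      simp only [LinearMap.sub_apply, LinearMap.smul_apply, smul_eq_mul]
      ring
    have h₆ := h₁.finrank_lt h₄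
    have h₇ := h₃.finrank_lt h₅
    exact ⟨h₁, h₃, h₄, by omega⟩
  obtain ⟨a₁, a₂, a₃, a₄⟩ := hface g₁ m 1 (one_smul _ _).symm hg₁C hg₁F hg₁ one_ne_zero
  obtain ⟨b₁, b₂, b₃, b₄⟩ := hface g₂ (-m) (-1) (neg_one_smul ℝ m).symm hg₂C hg₂F hg₂ (by norm_num)
  have hself₁ : g₁ ∈ C.vanishing (l g₁ • m - m g₁ • l) := ⟨hg₁C, by simp [mul_comm]⟩
  have hself₂ : g₂ ∈ C.vanishing (l g₂ • (-m) - (-m) g₂ • l) := ⟨hg₂C, by simp [mul_comm]⟩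
  simp only [LinearMap.sub_apply, LinearMap.smul_apply, smul_eq_mul, LinearMap.neg_apply]
    at hg₁ hg₂
  refine ⟨_, _, ?_, a₁, b₁, a₂, b₂, a₄, b₄, ?_⟩
  -- If the two faces agreed, the smallest and the largest slope would be equal, and the face would
  -- be all of `C`.
  · intro h
    refine a₃ (le_antisymm a₁.le fun x hx => ⟨hx, ?_⟩)
    have h₁ := (h.ge hself₂).2
    have h₂ := hg₁ x hx
    have h₃ := hg₂ x hx
    simp only [LinearMap.sub_apply, LinearMap.smul_apply, smul_eq_mul] at h₁ ⊢
    have h₄ : (l g₁ * m x - m g₁ * l x) * l g₂ ≤ 0 := by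
      have : (l g₁ * m x - m g₁ * l x) * l g₂ = -(l g₁ * (l g₂ * -m x - -m g₂ * l x)) := by
        linear_combination l x * h₁
      rw [this]
      nlinarith
    have h₅ : l g₁ * m x - m g₁ * l x ≤ 0 := nonpos_of_mul_nonpos_left h₄ hp₂
    linarith
  · intro D hD hFD hDdim
    -- A face of dimension one more than `F` is determined by `F` and any one point outside `F`: two
    -- such faces sharing that point both equal their intersection.
    have hmeet : ∀ E₁ : PointedCone ℝ E, E₁.IsFaceOf C → F ≤ E₁ →
        Module.finrank ℝ E₁.linSpan = Module.finrank ℝ F.linSpan + 1 →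
        (∃ g ∈ D, g ∈ E₁ ∧ g ∉ F) → D = E₁ := by
      rintro E₁ hE₁ hFE₁ hE₁dim ⟨g, hgD, hgE, hgF⟩
      have h₁ := hD.inf_left hE₁
      have h₂ : F.IsFaceOf (D ⊓ E₁) := (IsFaceOf.isFaceOf_iff_le hF h₁).2 (le_inf hFD hFE₁)
      have h₃ := h₂.finrank_lt fun h => hgF (h ▸ ⟨hgD, hgE⟩)
      have h₄ : (D ⊓ E₁).IsFaceOf D := (IsFaceOf.isFaceOf_iff_le h₁ hD).2 inf_le_left
      have h₅ : (D ⊓ E₁).IsFaceOf E₁ := (IsFaceOf.isFaceOf_iff_le h₁ hE₁).2 inf_le_right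
      rw [← h₄.eq_of_finrank_le (by omega), h₅.eq_of_finrank_le (by omega)]
    obtain ⟨g, hgD, hgF⟩ : ∃ g ∈ D, g ∉ F := by
      by_contra! h
      have : D = F := le_antisymm h hFD
      rw [this] at hDdim
      omega
    have hgC := hD.le hgD
    by_cases h₁ : l g₁ * m g - m g₁ * l g = 0
    · exact Or.inl (hmeet _ a₁ a₂.le a₄ ⟨g, hgD, ⟨hgC, by simpa using h₁⟩, hgF⟩)
    by_cases h₂ : l g₂ * -m g - -m g₂ * l g = 0
    · exact Or.inr (hmeet _ b₁ b₂.le b₄ ⟨g, hgD, ⟨hgC, by simpa using h₂⟩, hgF⟩)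
    exfalso
    have hn₁ := lt_of_le_of_ne (hg₁ g hgC) (Ne.symm h₁)
    have hn₂ := lt_of_le_of_ne (hg₂ g hgC) (Ne.symm h₂)
    -- Now `g` has a slope strictly between the extremes. The span of `D` is, by dimension, the
    -- hyperplane of this slope inside the span of `C`.
    let n : E →ₗ[ℝ] ℝ := l g • m - m g • l
    have hnD : D.linSpan ≤ LinearMap.ker n := by
      have hsub : F.linSpan ⊔ Submodule.span ℝ {g} ≤ D.linSpan :=
        sup_le (linSpan_mono hFD) (Submodule.span_le.2 (by
          rintro _ rfl
          exact Submodule.subset_span hgD))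
      have hlt : F.linSpan < F.linSpan ⊔ Submodule.span ℝ {g} := by
        refine lt_of_le_of_ne le_sup_left fun h => hgF (hF.mem_of_mem_linSpan hgC ?_)
        rw [h]
        exact Submodule.mem_sup_right (Submodule.mem_span_singleton_self g)
      have := Submodule.finrank_lt_finrank_of_lt hlt
      rw [← Submodule.eq_of_le_of_finrank_le hsub (by omega)]
      refine sup_le (Submodule.span_le.2 fun x hx => ?_) (Submodule.span_le.2 ?_)
      · simp [n, hm x hx, (hlF x (hF.le hx)).2 hx]
      · rintro _ rfl
        simp [n, mul_comm]
    have hng₁ : n g₁ ≠ 0 := by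
      simp only [n, LinearMap.sub_apply, LinearMap.smul_apply, smul_eq_mul]
      intro h
      apply h₁
      linarith
    have hle : D.linSpan ≤ LinearMap.ker n ⊓ C.linSpan := le_inf hnD (linSpan_mono hD.le)
    have hlt : LinearMap.ker n ⊓ C.linSpan < C.linSpan := by
      refine lt_of_le_of_ne inf_le_right fun h => hng₁ ?_
      have : g₁ ∈ LinearMap.ker n ⊓ C.linSpan := by
        rw [h]
        exact Submodule.subset_span hg₁C
      exact this.1
    have hfr := Submodule.finrank_lt_finrank_of_lt hlt
    have heq := Submodule.eq_of_le_of_finrank_le hle (by omega)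
    -- A positive combination of `g₁` and `g₂` has the slope of `g`, so it lies in `D`. The face
    -- property then forces `g₁` into `D`, although its slope is different.
    have hh : (l g₂ * -m g - -m g₂ * l g) • g₁ + (l g₁ * m g - m g₁ * l g) • g₂ ∈ D := by
      refine hD.mem_of_mem_linSpan
        (C.add_mem (C.smul_mem hn₂.le hg₁C) (C.smul_mem hn₁.le hg₂C)) ?_
      rw [heq]
      refine ⟨?_, Submodule.add_mem _ (Submodule.smul_mem _ _ (Submodule.subset_span hg₁C))
        (Submodule.smul_mem _ _ (Submodule.subset_span hg₂C))⟩
      simp only [SetLike.mem_coe, LinearMap.mem_ker, n, map_add, map_smul, LinearMap.sub_apply,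
        LinearMap.smul_apply, smul_eq_mul]
      ring
    have hg₁D : g₁ ∈ D := hD.2 hg₁C (C.smul_mem hn₁.le hg₂C) hn₂ hh
    exact hng₁ (hnD (Submodule.subset_span hg₁D))

end Dim

end PointedCone

end

noncomputable section

/-! ### Leaving a cone along a ray -/

/-- The closed ray spanned by a vector. -/
def closedRay {E : Type*} [AddCommGroup E] [Module ℝ E] (p : E) : Set E :=
  {x | ∃ t : ℝ, 0 ≤ t ∧ x = t • p}

lemma zero_mem_closedRay {E : Type*} [AddCommGroup E] [Module ℝ E] (p : E) :
    (0 : E) ∈ closedRay p := ⟨0, le_rfl, by simp⟩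

lemma isClosed_closedRay {E : Type*} [NormedAddCommGroup E] [NormedSpace ℝ E]
    [FiniteDimensional ℝ E] (p : E) : IsClosed (closedRay p) := by
  have hfg : (Submodule.span {c : ℝ // 0 ≤ c} ({p} : Set E)).FG :=
    Submodule.fg_span (Set.finite_singleton p)
  convert hfg.isClosed using 1
  ext x
  simp only [closedRay, Set.mem_ofPred_eq, SetLike.mem_coe, Submodule.mem_span_singleton]
  constructor
  · rintro ⟨t, ht, rfl⟩
    exact ⟨⟨t, ht⟩, rfl⟩
  · rintro ⟨t, rfl⟩
    exact ⟨t, t.2, rfl⟩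

namespace PointedCone

variable {E : Type*} [NormedAddCommGroup E] [NormedSpace ℝ E]

/-- The largest multiple of `p` that can be subtracted from a point of a finitely generated cone
depends continuously on the point, and after the subtraction the point lies in a face not
containing `p`. -/
lemma _root_.Submodule.FG.exists_exit [FiniteDimensional ℝ E] {D : PointedCone ℝ E} (hD : D.FG)
    (hpt : ∀ x ∈ D, -x ∈ D → x = 0) {p : E} (hp : p ∈ D) (hp0 : p ≠ 0) :
    ∃ s : E → ℝ, Continuous s ∧ (∀ x ∈ D, ∀ t, x - t • p ∈ D ↔ t ≤ s x) ∧
      ∀ x ∈ D, ∃ F : PointedCone ℝ E, F.IsFaceOf D ∧ p ∉ F ∧ x - s x • p ∈ F := by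
  classical
  obtain ⟨A, hA⟩ := hD.exists_halfspaces
  -- Only constraints positive at `p` limit the motion in direction `-p`. There is at least one, as
  -- otherwise `-p` would lie in the pointed cone.
  let A' := A.filter fun a => 0 < a p
  have hA' : A'.Nonempty := by
    by_contra h
    rw [Finset.not_nonempty_iff_eq_empty, Finset.filter_eq_empty_iff] at h
    refine hp0 (hpt p hp ((hA _).2 fun a ha => ?_))
    rw [map_neg]
    linarith [not_lt.1 (h ha)]
  have hiff : ∀ x ∈ D, ∀ t, x - t • p ∈ D ↔ t ≤ A'.inf' hA' fun a => a x / a p := by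
    intro x hx t
    rw [hA, Finset.le_inf'_iff]
    constructor
    · intro h a ha
      obtain ⟨ha, hap⟩ := Finset.mem_filter.1 ha
      have := h a ha
      rw [map_sub, map_smul, smul_eq_mul] at this
      rw [le_div_iff₀ hap]
      linarith
    · intro h a ha
      rw [map_sub, map_smul, smul_eq_mul]
      rcases ((hA p).1 hp a ha).eq_or_lt with hap | hap
      · rw [← hap, mul_zero, sub_zero]
        exact (hA x).1 hx a ha
      · have := h a (Finset.mem_filter.2 ⟨ha, hap⟩)
        rw [le_div_iff₀ hap] at this
        linarith
  refine ⟨fun x => A'.inf' hA' fun a => a x / a p, ?_, hiff, fun x hx => ?_⟩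
  · exact Continuous.finset_inf'_apply hA' fun a _ =>
      (LinearMap.continuous_of_finiteDimensional a).div_const _
  -- The constraint attaining the minimum becomes zero at the exit point but is positive at `p`, so
  -- its face avoids `p`.
  · obtain ⟨a, ha, he⟩ := Finset.exists_mem_eq_inf' hA' fun a => a x / a p
    have hmem := (hiff x hx _).2 le_rfl
    obtain ⟨ha, hap⟩ := Finset.mem_filter.1 ha
    refine ⟨D.vanishing a, isFaceOf_vanishing fun y hy => (hA y).1 hy a ha,
      fun h => hap.ne' h.2, hmem, ?_⟩
    simp only [he, map_sub, map_smul, smul_eq_mul, div_mul_cancel₀ _ hap.ne',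
      sub_self]

end PointedCone

/-! ### Retractions and excision for punctured supports of subfans -/

namespace RationalPointedFan

open PointedCone SingularChain

variable {d : ℕ} {Φ : RationalPointedFan d}

local notation "E" => EuclideanSpace ℝ (Fin d)

lemma fg (Φ : RationalPointedFan d) {C : RealCone d} (hC : C ∈ Φ.cones) : C.FG := by
  obtain ⟨G, hG⟩ := Φ.rational C hC
  rw [hG]
  exact Submodule.fg_span (G.finite_toSet.image _)

lemma face_mem (Φ : RationalPointedFan d) {C F : RealCone d} (hC : C ∈ Φ.cones)
    (hF : F.IsFaceOf C) : F ∈ Φ.cones :=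
  (Φ.isFaceOf_iff_mem C hC F hF.le).1 hF

lemma isFaceOf_of_le (Φ : RationalPointedFan d) {C F : RealCone d} (hC : C ∈ Φ.cones)
    (hF : F ∈ Φ.cones) (h : F ≤ C) : F.IsFaceOf C :=
  (Φ.isFaceOf_iff_mem C hC F h).2 hF

lemma bot_isFaceOf (Φ : RationalPointedFan d) {C : RealCone d} (hC : C ∈ Φ.cones) :
    (⊥ : RealCone d).IsFaceOf C := by
  refine ⟨bot_le, fun {x y a} hx hy ha hxy => ?_⟩
  rw [Submodule.mem_bot] at hxy ⊢
  have h₁ : y = -(a • x) := eq_neg_of_add_eq_zero_right hxy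
  have h₂ := Φ.pointed C hC (a • x) (C.smul_mem ha.le hx) (h₁ ▸ hy)
  exact (smul_eq_zero.1 h₂).resolve_left ha.ne'

/-- The intersection of the two cones is a face of `C` meeting its core, hence all of `C`. So `D`
contains `C` as soon as it contains one point of the relative interior. -/
lemma le_of_mem_core (Φ : RationalPointedFan d) {C D : RealCone d} (hC : C ∈ Φ.cones)
    (hD : D ∈ Φ.cones) {x : E} (hx : x ∈ C.core) (hxD : x ∈ D) : C ≤ D := by
  have := hx.2 _ (Φ.inter_isFaceOf C hC D hD).1 ⟨hx.1, hxD⟩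
  exact inf_eq_left.1 this

/-- A collection of cones of the fan closed under taking faces. -/
structure IsSubfan (Φ : RationalPointedFan d) (S : Set (RealCone d)) : Prop where
  subset : ∀ D ∈ S, D ∈ Φ.cones
  face_mem : ∀ D ∈ S, ∀ F : RealCone d, F.IsFaceOf D → F ∈ S

lemma isSubfan_cones (Φ : RationalPointedFan d) : Φ.IsSubfan Φ.cones :=
  ⟨fun _ h => h, fun _ hD _ hF => Φ.face_mem hD hF⟩

lemma IsSubfan.away {S : Set (RealCone d)} (hS : Φ.IsSubfan S) (C : RealCone d) :
    Φ.IsSubfan {D ∈ S | ¬ C ≤ D} :=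
  ⟨fun D hD => hS.subset D hD.1,
    fun D hD F hF => ⟨hS.face_mem D hD.1 F hF, fun h => hD.2 (h.trans hF.le)⟩⟩

lemma IsSubfan.below {S : Set (RealCone d)} (hS : Φ.IsSubfan S) (C : RealCone d) :
    Φ.IsSubfan {D ∈ S | D ≤ C} :=
  ⟨fun D hD => hS.subset D hD.1, fun D hD F hF => ⟨hS.face_mem D hD.1 F hF, hF.le.trans hD.2⟩⟩

/-- The union of the cones of a collection, without the origin. -/
def puncturedSupport (S : Set (RealCone d)) : Set E := {x | x ≠ 0 ∧ ∃ D ∈ S, x ∈ D}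

lemma puncturedSupport_mono {S T : Set (RealCone d)} (h : S ⊆ T) :
    puncturedSupport S ⊆ puncturedSupport T :=
  fun _ ⟨hx, D, hD, hxD⟩ => ⟨hx, D, h hD, hxD⟩

/-- A subfan without the star of a cone `C` is a deformation retract of the punctured support of
the subfan without a ray in the relative interior of `C`. -/
theorem IsSubfan.relAcyclic_away {K : Type*} [Field K] {S : Set (RealCone d)} (hS : Φ.IsSubfan S)
    {C : RealCone d} (hC : C ∈ S) (hC0 : C ≠ ⊥) {p : E} (hp : p ∈ C.core) :
    RelAcyclic (boundary K E) (chainsIn K (puncturedSupport {D ∈ S | ¬ C ≤ D}))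
      (chainsIn K (puncturedSupport S \ closedRay p)) := by
  classical
  have hCΦ := hS.subset C hC
  have hp0 : p ≠ 0 := fun h => zero_notMem_core (Φ.pointed C hCΦ) hC0 (h ▸ hp)
  have hexit : ∀ D : {D : RealCone d // D ∈ S ∧ C ≤ D}, ∃ s : E → ℝ, Continuous s ∧
      (∀ x ∈ D.1, ∀ t, x - t • p ∈ D.1 ↔ t ≤ s x) ∧
      ∀ x ∈ D.1, ∃ F : RealCone d, F.IsFaceOf D.1 ∧ p ∉ F ∧ x - s x • p ∈ F := fun D =>
    (Φ.fg (hS.subset _ D.2.1)).exists_exit (Φ.pointed _ (hS.subset _ D.2.1)) (D.2.2 hp.1) hp0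
  choose e he_cont he_iff he_face using hexit
  have he_nonneg : ∀ D, ∀ x ∈ D.1, 0 ≤ e D x := fun D x hx =>
    (he_iff D x hx 0).1 (by simpa using hx)
  -- Exit times agree on overlaps: `x` is the sum of its exit point and a multiple of `p`, and since
  -- `x` lies in the common face, so does the exit point.
  have he_le : ∀ D D', ∀ x ∈ D.1, x ∈ D'.1 → e D x ≤ e D' x := by
    intro D D' x hx hx'
    rw [← he_iff D' x hx']
    have h₁ := (he_iff D x hx _).2 le_rfl
    have hface := (Φ.inter_isFaceOf D.1 (hS.subset _ D.2.1) D'.1 (hS.subset _ D'.2.1)).1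
    exact (hface.mem_of_add_mem_left h₁ (D.1.smul_mem (he_nonneg D x hx) (D.2.2 hp.1))
      (by simpa using ⟨hx, hx'⟩)).2
  let s : E → ℝ := fun x =>
    if h : ∃ D : {D : RealCone d // D ∈ S ∧ C ≤ D}, x ∈ D.1 then e h.choose x else 0
  have hs_star : ∀ D : {D : RealCone d // D ∈ S ∧ C ≤ D}, ∀ x ∈ D.1, s x = e D x := by
    intro D x hx
    have h : ∃ D : {D : RealCone d // D ∈ S ∧ C ≤ D}, x ∈ D.1 := ⟨D, hx⟩
    simp only [s, dif_pos h]
    exact le_antisymm (he_le _ _ x h.choose_spec hx) (he_le _ _ x hx h.choose_spec)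
  -- A positive exit time at a point of `D` would write that point as a sum involving `p`; the
  -- common face would contain `p`, and then `D` would contain `C`.
  have hs_away : ∀ D ∈ S, ¬ C ≤ D → ∀ x ∈ D, s x = 0 := by
    intro D hD hCD x hx
    by_cases h : ∃ D : {D : RealCone d // D ∈ S ∧ C ≤ D}, x ∈ D.1
    · obtain ⟨D', hx'⟩ := h
      rw [hs_star D' x hx']
      by_contra hne
      have hpos := lt_of_le_of_ne (he_nonneg D' x hx') (Ne.symm hne)
      have h₁ := (he_iff D' x hx' _).2 le_rfl
      have hface := (Φ.inter_isFaceOf D'.1 (hS.subset _ D'.2.1) D (hS.subset _ hD)).1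
      have hpD : p ∈ D := (hface.2 (D'.2.2 hp.1) h₁ hpos (by simpa using ⟨hx', hx⟩)).2
      exact hCD (Φ.le_of_mem_core hCΦ (hS.subset _ hD) hp hpD)
    · simp only [s, dif_neg h]
  -- The cones form a finite closed cover on whose members `s` is continuous.
  have hs_cont : ContinuousOn s (⋃ D : S, (D.1 : Set E)) := by
    have : Finite S := (Φ.cones.finite_toSet.subset hS.subset).to_subtype
    refine (locallyFinite_of_finite _).continuousOn_iUnion
      (fun D => (Φ.fg (hS.subset _ D.2)).isClosed) fun D => ?_
    by_cases hCD : C ≤ D.1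
    · exact (he_cont ⟨D.1, D.2, hCD⟩).continuousOn.congr fun x hx => hs_star ⟨D.1, D.2, hCD⟩ x hx
    · exact continuousOn_const.congr fun x hx => hs_away D.1 D.2 hCD x hx
  have hstay : ∀ D ∈ S, ∀ x ∈ D, ∀ c ∈ Set.Icc (0 : ℝ) 1, x - (c * s x) • p ∈ D := by
    intro D hD x hx c hc
    by_cases hCD : C ≤ D
    · rw [he_iff ⟨D, hD, hCD⟩ x hx, hs_star ⟨D, hD, hCD⟩ x hx]
      exact mul_le_of_le_one_left (he_nonneg ⟨D, hD, hCD⟩ x hx) hc.2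
    · rw [hs_away D hD hCD x hx]
      simpa using hx
  have hs_nonneg : ∀ D ∈ S, ∀ x ∈ D, 0 ≤ s x := by
    intro D hD x hx
    by_cases hCD : C ≤ D
    · rw [hs_star ⟨D, hD, hCD⟩ x hx]
      exact he_nonneg _ x hx
    · rw [hs_away D hD hCD x hx]
  have hray : ∀ x, x ∉ closedRay p → ∀ t : ℝ, 0 ≤ t → x - t • p ∉ closedRay p := by
    rintro x hxr t ht ⟨u, hu, he⟩
    exact hxr ⟨u + t, by positivity, by rw [add_smul, ← he]; abel⟩
  have hseg : ∀ x (c : ℝ), x + c • (x - s x • p - x) = x - (c * s x) • p := by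
    intro x c
    rw [mul_smul, sub_sub_cancel_left, smul_neg, sub_eq_add_neg]
  refine relAcyclic_of_deformation (fun x => x - s x • p) ?_ ?_ ?_ ?_
  · have hsub : puncturedSupport S \ closedRay p ⊆ ⋃ D : S, (D.1 : Set E) := by
      rintro x ⟨⟨-, D, hD, hx⟩, -⟩
      exact Set.mem_iUnion.2 ⟨⟨D, hD⟩, hx⟩
    exact continuousOn_id.sub ((hs_cont.mono hsub).smul continuousOn_const)
  · rintro x ⟨⟨hx0, D, hD, hx⟩, hxr⟩
    refine ⟨fun h => hray x hxr (s x) (hs_nonneg D hD x hx) ?_, ?_⟩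
    · simp only at h
      rw [h]
      exact zero_mem_closedRay p
    · by_cases hCD : C ≤ D
      · obtain ⟨F, hF, hpF, hxF⟩ := he_face ⟨D, hD, hCD⟩ x hx
        refine ⟨F, ⟨hS.face_mem D hD F hF, fun h => hpF (h hp.1)⟩, ?_⟩
        simpa only [hs_star ⟨D, hD, hCD⟩ x hx] using hxF
      · refine ⟨D, ⟨hD, hCD⟩, ?_⟩
        simpa [hs_away D hD hCD x hx] using hx
  · rintro x ⟨⟨hx0, D, hD, hx⟩, hxr⟩ c hc
    rw [hseg]
    have h₁ := hray x hxr (c * s x) (mul_nonneg hc.1 (hs_nonneg D hD x hx))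
    exact ⟨⟨fun h => h₁ (h ▸ zero_mem_closedRay p), D, hD, hstay D hD x hx c hc⟩, h₁⟩
  · rintro x ⟨hx0, D, ⟨hD, hCD⟩, hx⟩ c hc
    rw [hseg, hs_away D hD hCD x hx]
    simpa using ⟨hx0, D, ⟨hD, hCD⟩, hx⟩

/-- Translation by a point of the core moves all of `D` into the core, and the straight path of
translations preserves both sets. -/
lemma _root_.SingularChain.relAcyclic_inter_core {K : Type*} [Field K] {D : RealCone d} {p : E}
    (hp : p ∈ D.core) {B : Set E} (hBD : ∀ x ∈ B, x ∈ D)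
    (hB : ∀ x ∈ B, ∀ c : ℝ, 0 ≤ c → x + c • p ∈ B) :
    RelAcyclic (boundary K E) (chainsIn K (B ∩ D.core)) (chainsIn K B) := by
  refine relAcyclic_of_deformation (fun x => x + p) (by fun_prop) ?_ ?_ ?_
  · intro x hx
    exact ⟨by simpa using hB x hx 1 zero_le_one, add_mem_core (hBD x hx) hp⟩
  · intro x hx c hc
    simpa using hB x hx c hc.1
  · rintro x ⟨hx, hx'⟩ c hc
    rw [add_sub_cancel_left]
    refine ⟨hB x hx c hc.1, ?_⟩
    rw [add_comm]
    exact add_mem_core (D.smul_mem hc.1 hp.1) hx'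

/-- Radial projection: the segment from `x` to `x / ‖x‖` consists of positive multiples of `x`. -/
lemma _root_.SingularChain.relAcyclic_inter_sphere {K : Type*} [Field K] {B : Set E}
    (hB0 : (0 : E) ∉ B) (hB : ∀ x ∈ B, ∀ c : ℝ, 0 < c → c • x ∈ B) :
    RelAcyclic (boundary K E) (chainsIn K (B ∩ Metric.sphere 0 1)) (chainsIn K B) := by
  have hne : ∀ x ∈ B, x ≠ 0 := fun x hx h => hB0 (h ▸ hx)
  refine relAcyclic_of_deformation (fun x => ‖x‖⁻¹ • x) ?_ ?_ ?_ ?_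
  · exact (continuousOn_id.norm.inv₀ fun x hx => norm_ne_zero_iff.2 (hne x hx)).smul
      continuousOn_id
  · intro x hx
    have := norm_pos_iff.2 (hne x hx)
    refine ⟨hB x hx _ (by positivity), ?_⟩
    rw [mem_sphere_zero_iff_norm, norm_smul, norm_inv, norm_norm, inv_mul_cancel₀ this.ne']
  · intro x hx c hc
    have hpos := norm_pos_iff.2 (hne x hx)
    have : x + c • (‖x‖⁻¹ • x - x) = ((1 - c) + c * ‖x‖⁻¹) • x := by
      module
    rw [this]
    refine hB x hx _ ?_
    rcases hc.1.eq_or_lt with h | h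
    · rw [← h]; norm_num
    · have := hc.2
      have : 0 < c * ‖x‖⁻¹ := by positivity
      linarith
  · rintro x ⟨hx, hx'⟩ c hc
    have := mem_sphere_zero_iff_norm.1 hx'
    simp only [this, inv_one, one_smul, sub_self, smul_zero, add_zero]
    exact ⟨hx, hx'⟩

/-- A segment between nonzero points could pass through `0` only if the cone contained a line. -/
lemma convex_nonzero (Φ : RationalPointedFan d) {D : RealCone d} (hD : D ∈ Φ.cones) :
    Convex ℝ {x : E | x ≠ 0 ∧ x ∈ D} := by
  rintro x ⟨hx0, hx⟩ y ⟨hy0, hy⟩ a b ha hb hab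
  refine ⟨fun h => ?_, D.add_mem (D.smul_mem ha hx) (D.smul_mem hb hy)⟩
  have h₁ : a • x = -(b • y) := eq_neg_of_add_eq_zero_left h
  have h₂ : b • y = 0 := Φ.pointed D hD _ (D.smul_mem hb hy) (h₁ ▸ D.smul_mem ha hx)
  have h₃ : b = 0 := (smul_eq_zero.1 h₂).resolve_right hy0
  have h₄ : a = 0 := by
    rw [h₂, neg_zero] at h₁
    exact (smul_eq_zero.1 h₁).resolve_right hx0
  rw [h₃, h₄] at hab
  norm_num at hab

/-- The cone without its apex. -/
abbrev nonzeroPart (D : RealCone d) : Set E := {x : E | x ≠ 0 ∧ x ∈ D}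

lemma relAcyclic_nonzeroPart {K : Type*} [Field K] (Φ : RationalPointedFan d) {D : RealCone d}
    (hD : D ∈ Φ.cones) (hD0 : D ≠ ⊥) :
    RelAcyclic (boundary K E) ⊥ (chainsIn K (nonzeroPart D)) := by
  refine relAcyclic_of_convex (Φ.convex_nonzero hD) ?_
  obtain ⟨x, hx, hx0⟩ := Submodule.exists_mem_ne_zero_of_ne_bot hD0
  exact ⟨x, hx0, hx⟩

lemma relAcyclic_cell {K : Type*} [Field K] (Φ : RationalPointedFan d) {D : RealCone d}
    (hD : D ∈ Φ.cones) (hD0 : D ≠ ⊥) :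
    RelAcyclic (boundary K E) ⊥ (chainsIn K (nonzeroPart D ∩ Metric.sphere 0 1)) := by
  refine RelAcyclic.cancel_right boundary_boundary bot_le (chainsIn_mono Set.inter_subset_left)
    (relAcyclic_inter_sphere (fun h => h.1 rfl) fun x hx c hc => ?_)
    (Φ.relAcyclic_nonzeroPart hD hD0)
  exact ⟨smul_ne_zero hc.ne' hx.1, D.smul_mem hc.le hx.2⟩

/-- Excision for the closed cell of a maximal cone of a subfan. -/
theorem IsSubfan.relAcyclic_excision {K : Type*} [Field K] {S : Set (RealCone d)}
    (hS : Φ.IsSubfan S) {D : RealCone d} (hD : D ∈ S) (hD0 : D ≠ ⊥)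
    (hmax : ∀ D' ∈ S, D ≤ D' → D' = D) :
    RelAcyclic (boundary K E)
      (chainsIn K (nonzeroPart D) ⊔ chainsIn K (puncturedSupport (S \ {D})))
      (chainsIn K (puncturedSupport S)) := by
  have hDΦ := hS.subset D hD
  obtain ⟨p, hp⟩ := (Φ.fg hDΦ).core_nonempty
  have h0core := zero_notMem_core (Φ.pointed D hDΦ) hD0
  have haway : {D' ∈ S | ¬ D ≤ D'} = S \ {D} := by
    ext D'
    simp only [Set.mem_ofPred_eq, Set.mem_sdiff, Set.mem_singleton_iff]
    exact and_congr_right fun hD' => not_congr ⟨hmax D' hD', fun h => h.ge⟩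
  have hbelow : puncturedSupport {D' ∈ S | D' ≤ D} = nonzeroPart D := by
    ext x
    exact ⟨fun ⟨hx0, D', hD', hx⟩ => ⟨hx0, hD'.2 hx⟩, fun ⟨hx0, hx⟩ => ⟨hx0, D, ⟨hD, le_rfl⟩, hx⟩⟩
  -- The closed set `A` of the other cells is thickened to `U`, relatively open in the support; `R`
  -- is the part of `U` inside `D`.
  set A := puncturedSupport (S \ {D}) with hA
  set U := puncturedSupport S \ closedRay p with hU
  set R := nonzeroPart D \ closedRay p with hR
  have hr₁ : RelAcyclic (boundary K E) (chainsIn K A) (chainsIn K U) := by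
    have := hS.relAcyclic_away (K := K) hD hD0 hp
    rwa [haway] at this
  have hbd : puncturedSupport {D' ∈ {D' ∈ S | D' ≤ D} | ¬ D ≤ D'} = R ∩ A := by
    ext x
    constructor
    · rintro ⟨hx0, D', ⟨⟨hD', hle⟩, hnle⟩, hx⟩
      refine ⟨⟨⟨hx0, hle hx⟩, ?_⟩, hx0, D', ⟨hD', fun h => hnle (h ▸ le_rfl)⟩, hx⟩
      rintro ⟨t, ht, rfl⟩
      have ht' : 0 < t := lt_of_le_of_ne ht fun h => hx0 (by simp [← h])
      exact hnle (Φ.le_of_mem_core hDΦ (hS.subset _ hD') (smul_mem_core ht' hp) hx)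
    · rintro ⟨⟨⟨hx0, hxD⟩, -⟩, -, D', ⟨hD', hne⟩, hx⟩
      refine ⟨hx0, D ⊓ D', ⟨⟨hS.face_mem D hD _
        (Φ.inter_isFaceOf D hDΦ D' (hS.subset _ hD')).1, inf_le_left⟩, fun h => hne ?_⟩, hxD, hx⟩
      exact hmax D' hD' (h.trans inf_le_right)
  have hr₂ : RelAcyclic (boundary K E) (chainsIn K (R ∩ A)) (chainsIn K R) := by
    have := (hS.below D).relAcyclic_away (K := K) (C := D) ⟨hD, le_rfl⟩ hD0 hp
    rwa [hbelow, hbd] at this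
  have hAS : A ⊆ puncturedSupport S := puncturedSupport_mono Set.sdiff_subset
  have hDS : nonzeroPart D ⊆ puncturedSupport S := fun x hx => ⟨hx.1, D, hD, hx.2⟩
  have hAU : A ⊆ U := by
    refine fun x hx => ⟨hAS hx, ?_⟩
    obtain ⟨hx0, D', ⟨hD', hne⟩, hx⟩ := hx
    rintro ⟨t, ht, rfl⟩
    have ht' : 0 < t := lt_of_le_of_ne ht fun h => hx0 (by simp [← h])
    exact hne (hmax D' hD' (Φ.le_of_mem_core hDΦ (hS.subset _ hD') (smul_mem_core ht' hp) hx))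
  have hDU : nonzeroPart D ∩ U = R := by
    ext x
    exact ⟨fun h => ⟨h.1, h.2.2⟩, fun h => ⟨h.1, hDS h.1, h.2⟩⟩
  have hstab : ∀ B : Set E, ∀ x ∈ chainsIn K B, boundary K E x ∈ chainsIn K B :=
    fun B x hx => boundary_mem_chainsIn hx
  have hstab₂ : ∀ B B' : Set E, ∀ x ∈ chainsIn K B ⊔ chainsIn K B',
      boundary K E x ∈ chainsIn K B ⊔ chainsIn K B' := by
    intro B B' x hx
    obtain ⟨a, ha, b, hb, rfl⟩ := Submodule.mem_sup.1 hx
    rw [map_add]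
    exact Submodule.add_mem_sup (hstab _ a ha) (hstab _ b hb)
  -- `A` may be replaced by `U` because `U` and `R` retract onto `A` and `R ∩ A`, by pushing away
  -- from `p` in `S` and in the faces of `D`.
  have step₁ : RelAcyclic (boundary K E) (chainsIn K (nonzeroPart D) ⊔ chainsIn K A)
      (chainsIn K U ⊔ chainsIn K (nonzeroPart D)) := by
    have h₁ : RelAcyclic (boundary K E) (chainsIn K A) (chainsIn K R ⊔ chainsIn K A) :=
      RelAcyclic.sup_of_inf (hstab _) (hstab _) (by rwa [chainsIn_inf])
    have h₂ : RelAcyclic (boundary K E) (chainsIn K R ⊔ chainsIn K A) (chainsIn K U) :=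
      RelAcyclic.cancel_left boundary_boundary le_sup_right
        (sup_le (chainsIn_mono (hDU ▸ Set.inter_subset_right)) (chainsIn_mono hAU)) h₁ hr₁
    have h₃ : RelAcyclic (boundary K E) (chainsIn K (nonzeroPart D) ⊔ chainsIn K A)
        (chainsIn K U ⊔ (chainsIn K (nonzeroPart D) ⊔ chainsIn K A)) := by
      refine RelAcyclic.sup_of_inf (hstab _) (hstab₂ _ _) ?_
      rwa [inf_comm, chainsIn_sup_inf, hDU, Set.inter_eq_left.2 hAU]
    have he : chainsIn K U ⊔ (chainsIn K (nonzeroPart D) ⊔ chainsIn K A) =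
        chainsIn K U ⊔ chainsIn K (nonzeroPart D) := by
      have hle : chainsIn K A ≤ chainsIn K U := chainsIn_mono hAU
      rw [sup_comm (chainsIn K (nonzeroPart D)), ← sup_assoc, sup_eq_left.2 hle]
    rwa [he] at h₃
  -- The core of a maximal cone is relatively open: it is what remains after removing the finitely
  -- many other closed cones.
  have hcore : puncturedSupport S ∩ (⋃ D' : (S \ {D} : Set _), (D'.1 : Set E))ᶜ = D.core := by
    ext x
    constructor
    · rintro ⟨⟨hx0, D', hD', hx⟩, hx'⟩
      simp only [Set.mem_compl_iff, Set.mem_iUnion, not_exists] at hx'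
      obtain rfl : D' = D := by
        by_contra hne
        exact hx' ⟨D', hD', hne⟩ hx
      refine ⟨hx, fun F hF hxF => ?_⟩
      by_contra hne
      exact hx' ⟨F, hS.face_mem _ hD' F hF, hne⟩ hxF
    · intro hx
      refine ⟨⟨fun h => h0core (h ▸ hx), D, hD, hx.1⟩, ?_⟩
      simp only [Set.mem_compl_iff, Set.mem_iUnion, not_exists]
      rintro ⟨D', hD', hne⟩ hx'
      exact hne (hmax D' hD' (Φ.le_of_mem_core hDΦ (hS.subset _ hD') hx hx'))
  have hcoreD : nonzeroPart D ∩ D.core = D.core :=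
    Set.inter_eq_right.2 fun x hx => ⟨fun h => h0core (h ▸ hx), hx.1⟩
  -- Small simplices apply to the open cover by `U` and the core of `D`. The core is then enlarged
  -- to `nonzeroPart D`, which changes nothing since translation by `p` retracts `nonzeroPart D` and
  -- `R` into the core.
  have step₂ : RelAcyclic (boundary K E) (chainsIn K U ⊔ chainsIn K (nonzeroPart D))
      (chainsIn K (puncturedSupport S)) := by
    have hsmall : RelAcyclic (boundary K E) (chainsIn K U ⊔ chainsIn K D.core)
        (chainsIn K (puncturedSupport S)) := by
      have hfin : Finite (S \ {D} : Set _) :=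
        (Φ.cones.finite_toSet.subset fun x hx => hS.subset x hx.1).to_subtype
      have := relAcyclic_small (K := K) (B := puncturedSupport S)
        (isClosed_closedRay p).isOpen_compl
        (isClosed_iUnion_of_finite fun D' : (S \ {D} : Set _) =>
          (Φ.fg (hS.subset _ D'.2.1)).isClosed).isOpen_compl ?_
      · rwa [hcore] at this
      · intro x hx
        by_cases hxr : x ∈ closedRay p
        · refine Or.inr ?_
          obtain ⟨t, ht, rfl⟩ := hxr
          have ht' : 0 < t := lt_of_le_of_ne ht fun h => hx.1 (by simp [← h])
          exact (hcore.ge (smul_mem_core ht' hp)).2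
        · exact Or.inl hxr
    have hp₁ : RelAcyclic (boundary K E) (chainsIn K D.core) (chainsIn K (nonzeroPart D)) := by
      have := relAcyclic_inter_core (K := K) hp (B := nonzeroPart D) (fun x hx => hx.2)
        fun x hx c hc => ⟨fun h => hx.1 (Φ.pointed D hDΦ x hx.2 ?_),
          D.add_mem hx.2 (D.smul_mem hc hp.1)⟩
      · rwa [hcoreD] at this
      · rw [neg_eq_of_add_eq_zero_right h]
        exact D.smul_mem hc hp.1
    have hp₂ : RelAcyclic (boundary K E) (chainsIn K (R ∩ D.core)) (chainsIn K R) := by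
      refine relAcyclic_inter_core hp (fun x hx => hx.1.2) fun x hx c hc => ?_
      have hnr : x + c • p ∉ closedRay p := by
        rintro ⟨t, ht, he⟩
        have hx' : x = (t - c) • p := by rw [sub_smul, ← he]; abel
        rcases le_or_gt 0 (t - c) with h | h
        · exact hx.2 ⟨_, h, hx'⟩
        · refine hx.1.1 (Φ.pointed D hDΦ x hx.1.2 ?_)
          rw [hx', ← neg_smul]
          exact D.smul_mem (by linarith) hp.1
      exact ⟨⟨fun h => hnr (h ▸ zero_mem_closedRay p),
        D.add_mem hx.1.2 (D.smul_mem hc hp.1)⟩, hnr⟩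
    have hVD : chainsIn K D.core ≤ chainsIn K (nonzeroPart D) :=
      chainsIn_mono (hcoreD ▸ Set.inter_subset_left)
    have h₁ : RelAcyclic (boundary K E) (chainsIn K D.core) (chainsIn K R ⊔ chainsIn K D.core) :=
      RelAcyclic.sup_of_inf (hstab _) (hstab _) (by rwa [chainsIn_inf])
    have h₂ : RelAcyclic (boundary K E) (chainsIn K R ⊔ chainsIn K D.core)
        (chainsIn K (nonzeroPart D)) :=
      RelAcyclic.cancel_left boundary_boundary le_sup_right
        (sup_le (chainsIn_mono Set.sdiff_subset) hVD) h₁ hp₁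
    have h₃ : RelAcyclic (boundary K E) (chainsIn K U ⊔ chainsIn K D.core)
        (chainsIn K (nonzeroPart D) ⊔ (chainsIn K U ⊔ chainsIn K D.core)) := by
      refine RelAcyclic.sup_of_inf (hstab _) (hstab₂ _ _) ?_
      rwa [inf_comm, chainsIn_sup_inf, Set.inter_comm U, hDU, Set.inter_comm D.core, hcoreD]
    have he : chainsIn K (nonzeroPart D) ⊔ (chainsIn K U ⊔ chainsIn K D.core) =
        chainsIn K U ⊔ chainsIn K (nonzeroPart D) := by
      rw [sup_left_comm, sup_eq_left.2 hVD]
    rw [he] at h₃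
    exact RelAcyclic.cancel_left boundary_boundary (sup_le_sup_left hVD _)
      (sup_le (chainsIn_mono Set.sdiff_subset) (chainsIn_mono hDS)) h₃ hsmall
  refine RelAcyclic.trans boundary_boundary ?_ ?_ step₁ step₂
  · exact sup_le le_sup_right (le_sup_of_le_left (chainsIn_mono hAU))
  · exact sup_le (chainsIn_mono Set.sdiff_subset) (chainsIn_mono hDS)

/-- The cells of a cone other than the relative interiors of the cone and of one of its facets
form an acyclic space. -/
theorem IsSubfan.relAcyclic_boundary_away {K : Type*} [Field K] {S : Set (RealCone d)}
    (hS : Φ.IsSubfan S) {D F : RealCone d} (hD : D ∈ S) (hF : F.IsFaceOf D) (hne : F ≠ D)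
    (hF0 : F ≠ ⊥) :
    RelAcyclic (boundary K E) ⊥
      (chainsIn K (puncturedSupport {D' ∈ {D' ∈ S | D' ≤ D} | ¬ F ≤ D'})) := by
  have hDΦ := hS.subset D hD
  have hFS := hS.face_mem D hD F hF
  obtain ⟨p, hp⟩ := (Φ.fg hDΦ).core_nonempty
  obtain ⟨q, hq⟩ := (Φ.fg (hS.subset F hFS)).core_nonempty
  have hbelow : puncturedSupport {D' ∈ S | D' ≤ D} = nonzeroPart D := by
    ext x
    exact ⟨fun ⟨hx0, D', hD', hx⟩ => ⟨hx0, hD'.2 hx⟩, fun ⟨hx0, hx⟩ => ⟨hx0, D, ⟨hD, le_rfl⟩, hx⟩⟩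
  have h₁ := (hS.below D).relAcyclic_away (K := K) (C := F) ⟨hFS, hF.le⟩ hF0 hq
  rw [hbelow] at h₁
  have hcoreray : ∀ x ∈ D.core, x ∉ closedRay q := by
    rintro x hx ⟨t, ht, rfl⟩
    exact hne (hx.2 F hF (F.smul_mem ht hq.1))
  have hcoreD : (nonzeroPart D \ closedRay q) ∩ D.core = D.core :=
    Set.inter_eq_right.2 fun x hx =>
      ⟨⟨fun h => hcoreray x hx (h ▸ zero_mem_closedRay q), hx.1⟩, hcoreray x hx⟩
  -- Removing a ray in the proper face `F` leaves the core of `D` untouched, so translation into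
  -- this convex core shows that the rest of `D` is acyclic.
  have h₂ : RelAcyclic (boundary K E) (chainsIn K D.core)
      (chainsIn K (nonzeroPart D \ closedRay q)) := by
    have := relAcyclic_inter_core (K := K) hp (B := nonzeroPart D \ closedRay q)
      (fun x hx => hx.1.2) fun x hx c hc => ?_
    · rwa [hcoreD] at this
    · rcases hc.eq_or_lt with rfl | hc
      · simpa using hx
      · have := add_mem_core hx.1.2 (smul_mem_core hc hp)
        exact (hcoreD.ge this).1
  have h₃ : RelAcyclic (boundary K E) ⊥ (chainsIn K (nonzeroPart D \ closedRay q)) :=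
    RelAcyclic.trans boundary_boundary bot_le
      (chainsIn_mono (hcoreD ▸ Set.inter_subset_left)) (relAcyclic_of_convex D.convex_core ⟨p, hp⟩)
      h₂
  refine RelAcyclic.cancel_right boundary_boundary bot_le (chainsIn_mono ?_) h₁ h₃
  rintro x ⟨hx0, D', ⟨⟨hD', hle⟩, hnle⟩, hx⟩
  refine ⟨⟨hx0, hle hx⟩, ?_⟩
  rintro ⟨t, ht, rfl⟩
  have ht' : 0 < t := lt_of_le_of_ne ht fun h => hx0 (by simp [← h])
  exact hnle (Φ.le_of_mem_core (hS.subset F hFS) (hS.subset _ hD') (smul_mem_core ht' hq) hx)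

end RationalPointedFan

end

noncomputable section

/-! ### Mapping cones of maps of differential modules -/

section MappingCone

variable {K P Q : Type*} [Ring K] [AddCommGroup P] [Module K P] [AddCommGroup Q] [Module K Q]

/-- The differential of the mapping cone of a map `f` of differential modules. -/
def coneDifferential (p : P →ₗ[K] P) (q : Q →ₗ[K] Q) (f : P →ₗ[K] Q) : P × Q →ₗ[K] P × Q :=
  LinearMap.prod (-(p ∘ₗ LinearMap.fst K P Q)) (f ∘ₗ LinearMap.fst K P Q + q ∘ₗ LinearMap.snd K P Q)

variable {p : P →ₗ[K] P} {q : Q →ₗ[K] Q} {f : P →ₗ[K] Q}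

@[simp] lemma coneDifferential_apply (x : P × Q) :
    coneDifferential p q f x = (-p x.1, f x.1 + q x.2) := rfl

lemma coneDifferential_coneDifferential (hp : ∀ x, p (p x) = 0) (hq : ∀ x, q (q x) = 0)
    (hf : ∀ x, q (f x) = f (p x)) (x : P × Q) :
    coneDifferential p q f (coneDifferential p q f x) = 0 := by
  simp [hp, hq, hf]

/-- The quotient of the two mapping cones is just `B/A`: changing the target by a quasi-isomorphism
does not affect the mapping cone. -/
lemma RelAcyclic.coneDifferential_right {T : Submodule K P} {A B : Submodule K Q}
    (hf : ∀ x ∈ T, f x ∈ A) (h : RelAcyclic q A B) :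
    RelAcyclic (coneDifferential p q f) (T.prod A) (T.prod B) := by
  rintro ⟨b, w⟩ ⟨hb, hw⟩ ⟨-, hdw⟩
  obtain ⟨y, hy, hwy⟩ := h w hw (by simpa using A.sub_mem hdw (hf b hb))
  exact ⟨(0, y), ⟨T.zero_mem, hy⟩, by simpa using hb, by simpa using hwy⟩

lemma RelAcyclic.coneDifferential_of (hf' : ∀ x, q (f x) = f (p x)) {T : Submodule K P}
    {A : Submodule K Q} (hf : ∀ x ∈ T, f x ∈ A) (h₁ : RelAcyclic p ⊥ T) (h₂ : RelAcyclic q ⊥ A) :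
    RelAcyclic (coneDifferential p q f) ⊥ (T.prod A) := by
  rintro ⟨b, w⟩ ⟨hb, hw⟩ h
  simp only [coneDifferential_apply, Submodule.mem_bot, Prod.mk_eq_zero, neg_eq_zero] at h
  obtain ⟨b', hb', he⟩ := h₁ b hb (by simp [h.1])
  rw [Submodule.mem_bot, sub_eq_zero] at he
  obtain ⟨y, hy, he'⟩ := h₂ (w + f b') (A.add_mem hw (hf b' hb')) (by
    rw [map_add, hf', ← he, add_comm, h.2]
    exact Submodule.zero_mem _)
  rw [Submodule.mem_bot, sub_eq_zero] at he'
  refine ⟨(-b', y), ⟨T.neg_mem hb', hy⟩, ?_⟩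
  simp [← he, ← he']

/-- An acyclic mapping cone makes `f` a quasi-isomorphism, so acyclicity passes from target to
source. This is how topology proves exactness of the cellular complex. -/
lemma RelAcyclic.of_coneDifferential (hf' : ∀ x, q (f x) = f (p x))
    {T : Submodule K P} {A : Submodule K Q} (hf : ∀ x ∈ T, f x ∈ A)
    (h : RelAcyclic (coneDifferential p q f) ⊥ (T.prod A)) (h₂ : RelAcyclic q ⊥ A) :
    RelAcyclic p ⊥ T := by
  intro b hb hpb
  rw [Submodule.mem_bot] at hpb
  obtain ⟨w, hw, he⟩ := h₂ (f b) (hf b hb) (by simp [hf', hpb])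
  rw [Submodule.mem_bot, sub_eq_zero] at he
  obtain ⟨⟨b', y⟩, ⟨hb', -⟩, he'⟩ := h (b, -w) ⟨hb, A.neg_mem hw⟩ (by simp [hpb, he])
  refine ⟨-b', T.neg_mem hb', ?_⟩
  simp only [coneDifferential_apply, Submodule.mem_bot, Prod.ext_iff] at he'
  simpa using he'.1

end MappingCone

/-! ### The cellular chain complex of a fan -/

namespace RationalPointedFan

open PointedCone SingularChain

variable {d : ℕ} {Φ : RationalPointedFan d}

local notation "E" => EuclideanSpace ℝ (Fin d)

lemma dim_bot : (⊥ : RealCone d).dim = 0 := by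
  simp [RealCone.dim]

lemma eq_bot_of_dim {D : RealCone d} (h : D.dim = 0) : D = ⊥ := by
  rw [RealCone.dim, Submodule.finrank_eq_zero, Submodule.span_eq_bot] at h
  exact (Submodule.eq_bot_iff D).2 h

lemma dim_le (D : RealCone d) : D.dim ≤ d := by
  have := Submodule.finrank_le (Submodule.span ℝ (D : Set E))
  simpa [RealCone.dim] using this

lemma dim_mono {F D : RealCone d} (h : F ≤ D) : F.dim ≤ D.dim := finrank_linSpan_mono h

namespace IncidenceFunction

/-- Nonzero terms come only from cones between `G` and `D`. If `G` is a face of `D` there are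
exactly two such cones, cancelling by the incidence axiom; otherwise there are none. -/
lemma sum_mul_eq_zero (ε : Φ.IncidenceFunction) {D G : RealCone d} (hD : D ∈ Φ.cones)
    (hG : G ∈ Φ.cones) (hdim : D.dim = G.dim + 2) :
    ∑ F ∈ Φ.cones with F.dim = G.dim + 1, ε.toFun D F * ε.toFun F G = 0 := by
  classical
  have hface : ∀ F ∈ Φ.cones, F.dim = G.dim + 1 → ε.toFun D F * ε.toFun F G ≠ 0 →
      G.IsFaceOf F ∧ F.IsFaceOf D := by
    intro F hF hFd hne
    exact ⟨(ε.ne_zero_iff F hF G hG hFd).1 (right_ne_zero_of_mul hne),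
      (ε.ne_zero_iff D hD F hF (by omega)).1 (left_ne_zero_of_mul hne)⟩
  by_cases hGD : G.IsFaceOf D
  · obtain ⟨E₁, E₂, hne, h₁, h₂, h₃, h₄, h₅, h₆, h₇⟩ := (Φ.fg hD).diamond hGD hdim
    have m₁ := Φ.face_mem hD h₁
    have m₂ := Φ.face_mem hD h₂
    have hsub : ({E₁, E₂} : Finset (RealCone d)) ⊆ Φ.cones.filter fun F => F.dim = G.dim + 1 := by
      intro F hF
      rcases Finset.mem_insert.1 hF with rfl | hF
      · exact Finset.mem_filter.2 ⟨m₁, h₅⟩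
      · rw [Finset.mem_singleton.1 hF]
        exact Finset.mem_filter.2 ⟨m₂, h₆⟩
    rw [← Finset.sum_subset hsub, Finset.sum_pair hne]
    · exact ε.diamond D hD G hG hdim E₁ m₁ E₂ m₂ hne h₅ h₆ h₃ h₁ h₄ h₂
    · intro F hF hF'
      by_contra hne'
      obtain ⟨hF, hFd⟩ := Finset.mem_filter.1 hF
      obtain ⟨f₁, f₂⟩ := hface F hF hFd hne'
      rcases h₇ F f₂ f₁.le hFd with rfl | rfl <;> simp at hF'
  · refine Finset.sum_eq_zero fun F hF => ?_
    by_contra hne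
    obtain ⟨hF, hFd⟩ := Finset.mem_filter.1 hF
    obtain ⟨f₁, f₂⟩ := hface F hF hFd hne
    exact hGD (f₁.trans f₂)

end IncidenceFunction

variable (K : Type*) [Field K] (ε : Φ.IncidenceFunction)

/-- The boundary of a cone in the augmented cellular chain complex. -/
def cellBoundaryCone (D : RealCone d) : RealCone d →₀ K := by
  classical
  exact if D ∈ Φ.cones then
    ∑ F ∈ Φ.cones with D.dim = F.dim + 1, (ε.toFun D F : K) • Finsupp.single F 1 else 0

/-- The boundary operator of the augmented cellular chain complex. -/
def cellBoundary : (RealCone d →₀ K) →ₗ[K] (RealCone d →₀ K) :=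
  Finsupp.linearCombination K (cellBoundaryCone K ε)

variable {K}

lemma cellBoundary_single {D : RealCone d} (hD : D ∈ Φ.cones) :
    cellBoundary K ε (Finsupp.single D 1) =
      ∑ F ∈ Φ.cones with D.dim = F.dim + 1, (ε.toFun D F : K) • Finsupp.single F 1 := by
  simp [cellBoundary, cellBoundaryCone, hD]

lemma cellBoundary_single_of_notMem {D : RealCone d} (hD : D ∉ Φ.cones) :
    cellBoundary K ε (Finsupp.single D 1) = 0 := by
  simp [cellBoundary, cellBoundaryCone, hD]

lemma cellBoundary_single_apply {D G : RealCone d} (hD : D ∈ Φ.cones) (hG : G ∈ Φ.cones)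
    (h : D.dim = G.dim + 1) : cellBoundary K ε (Finsupp.single D 1) G = (ε.toFun D G : K) := by
  classical
  rw [cellBoundary_single ε hD, Finsupp.finsetSum_apply]
  rw [Finset.sum_eq_single G]
  · simp
  · intro F _ hF
    simp [hF]
  · intro h'
    exact absurd (Finset.mem_filter.2 ⟨hG, h⟩) h'

lemma cellBoundary_single_apply_eq_zero {D G : RealCone d} (h : ¬ D.dim = G.dim + 1) :
    cellBoundary K ε (Finsupp.single D 1) G = 0 := by
  classical
  by_cases hD : D ∈ Φ.cones
  · rw [cellBoundary_single ε hD, Finsupp.finsetSum_apply]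
    refine Finset.sum_eq_zero fun F hF => ?_
    have hne : F ≠ G := by
      rintro rfl
      exact h (Finset.mem_filter.1 hF).2
    simp [hne]
  · simp [cellBoundary_single_of_notMem ε hD]

lemma cell_hom_ext {M : Type*} [AddCommGroup M] [Module K M] {f g : (RealCone d →₀ K) →ₗ[K] M}
    (h : ∀ D, f (Finsupp.single D 1) = g (Finsupp.single D 1)) (x : RealCone d →₀ K) :
    f x = g x :=
  DFunLike.congr_fun (Finsupp.lhom_ext' fun v => LinearMap.ext_ring (h v)) x

lemma cellBoundary_cellBoundary (x : RealCone d →₀ K) :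
    cellBoundary K ε (cellBoundary K ε x) = 0 := by
  classical
  refine cell_hom_ext (f := cellBoundary K ε ∘ₗ cellBoundary K ε) (g := 0) (fun D => ?_) x
  simp only [LinearMap.comp_apply, LinearMap.zero_apply]
  by_cases hD : D ∈ Φ.cones
  swap
  · simp [cellBoundary_single_of_notMem ε hD]
  rw [cellBoundary_single ε hD, map_sum]
  simp only [map_smul]
  ext G
  rw [Finsupp.finsetSum_apply, Finsupp.coe_zero, Pi.zero_apply]
  by_cases hG : G ∈ Φ.cones ∧ D.dim = G.dim + 2
  · have := ε.sum_mul_eq_zero hD hG.1 hG.2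
    have hK := congrArg (Int.cast : ℤ → K) this
    push_cast at hK
    rw [← hK]
    refine Finset.sum_congr ?_ fun F hF => ?_
    · ext F
      simp only [Finset.mem_filter]
      refine and_congr_right fun _ => ?_
      omega
    · obtain ⟨hF, hFd⟩ := Finset.mem_filter.1 hF
      rw [Finsupp.smul_apply, smul_eq_mul, cellBoundary_single_apply ε hF hG.1 hFd]
  · refine Finset.sum_eq_zero fun F hF => ?_
    obtain ⟨hF, hFd⟩ := Finset.mem_filter.1 hF
    rw [Finsupp.smul_apply, smul_eq_mul]
    by_cases hFG : F.dim = G.dim + 1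
    · have hGm : G ∉ Φ.cones := fun h => hG ⟨h, by omega⟩
      rw [cellBoundary_single ε hF, Finsupp.finsetSum_apply]
      refine mul_eq_zero_of_right _ (Finset.sum_eq_zero fun H hH => ?_)
      have hne : H ≠ G := by
        rintro rfl
        exact hGm (Finset.mem_filter.1 hH).1
      simp [hne]
    · rw [cellBoundary_single_apply_eq_zero ε hFG, mul_zero]

/-- The cellular boundary of a cone is supported on its facets. -/
lemma cellBoundary_single_mem {D : RealCone d} (hD : D ∈ Φ.cones) :
    cellBoundary K ε (Finsupp.single D 1) ∈
      Finsupp.supported K K {F | F.IsFaceOf D ∧ D.dim = F.dim + 1} := by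
  rw [cellBoundary_single ε hD]
  refine Submodule.sum_mem _ fun F hF => ?_
  obtain ⟨hF, hFd⟩ := Finset.mem_filter.1 hF
  by_cases h : ε.toFun D F = 0
  · simp [h]
  · exact Submodule.smul_mem _ _ (Finsupp.single_mem_supported K 1
      ⟨(ε.ne_zero_iff D hD F hF hFd).1 h, hFd⟩)

lemma IsSubfan.cellBoundary_mem {S : Set (RealCone d)} (hS : Φ.IsSubfan S) {x : RealCone d →₀ K}
    (hx : x ∈ Finsupp.supported K K S) : cellBoundary K ε x ∈ Finsupp.supported K K S :=
  Finsupp.forall_mem_of_supported _ (fun D hD => Finsupp.supported_mono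
    (fun F hF => hS.face_mem D hD F hF.1) (cellBoundary_single_mem ε (hS.subset D hD))) hx

end RationalPointedFan

/-! ### Homogeneous components of singular chains -/

namespace SingularChain

variable {K : Type*} [Field K] {X : Type*} [TopologicalSpace X]

/-- The projection of chains to the span of the simplices with `n` vertices. -/
def degreeProj (K : Type*) [Field K] (X : Type*) [TopologicalSpace X] (n : ℕ) :
    SingularChain K X →ₗ[K] SingularChain K X :=
  Finsupp.linearCombination K fun σ => if σ.1 = n then Finsupp.single σ 1 else 0

/-- The chains on simplices with `n` vertices. -/
abbrev degreePart (K : Type*) [Field K] (X : Type*) [TopologicalSpace X] (n : ℕ) :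
    Submodule K (SingularChain K X) :=
  Finsupp.supported K K {σ : SingularSimplex X | σ.1 = n}

lemma degreeProj_of (n : ℕ) {m : ℕ} (σ : C(stdSimplex ℝ (Fin m), X)) :
    degreeProj K X n (of K σ) = if m = n then of K σ else 0 := by
  simp [degreeProj]

lemma degreeProj_boundary (n : ℕ) (x : SingularChain K X) :
    degreeProj K X n (boundary K X x) = boundary K X (degreeProj K X (n + 1) x) := by
  suffices h : degreeProj K X n ∘ₗ boundary K X = boundary K X ∘ₗ degreeProj K X (n + 1) from
    LinearMap.congr_fun h x
  refine LinearMap.ext (hom_ext fun m σ => ?_)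
  rw [LinearMap.comp_apply, LinearMap.comp_apply, degreeProj_of]
  rcases m with _ | m
  · simp
  · rw [boundary_of_succ, map_sum]
    by_cases h : m = n
    · rw [if_pos (by omega), boundary_of_succ]
      exact Finset.sum_congr rfl fun i _ => by rw [map_smul, degreeProj_of, if_pos h]
    · rw [if_neg (by omega), map_zero]
      exact Finset.sum_eq_zero fun i _ => by rw [map_smul, degreeProj_of, if_neg h, smul_zero]

lemma degreeProj_mem_degreePart (n : ℕ) (x : SingularChain K X) :
    degreeProj K X n x ∈ degreePart K X n := by
  refine Finsupp.forall_mem_of_supported (s := Set.univ) _ (fun σ _ => ?_) (by simp)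
  rw [show (Finsupp.single σ (1 : K)) = of K σ.2 from rfl, degreeProj_of]
  split_ifs with h
  · exact Finsupp.single_mem_supported K 1 h
  · exact Submodule.zero_mem _

lemma degreeProj_mem_supported (n : ℕ) {A : Set (SingularSimplex X)} {x : SingularChain K X}
    (hx : x ∈ Finsupp.supported K K A) : degreeProj K X n x ∈ Finsupp.supported K K A := by
  refine Finsupp.forall_mem_of_supported _ (fun σ hσ => ?_) hx
  rw [show (Finsupp.single σ (1 : K)) = of K σ.2 from rfl, degreeProj_of]
  split_ifs with h
  · exact Finsupp.single_mem_supported K 1 hσ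
  · exact Submodule.zero_mem _

lemma degreeProj_eq_self {n : ℕ} {x : SingularChain K X} (hx : x ∈ degreePart K X n) :
    degreeProj K X n x = x := by
  have := Finsupp.forall_mem_of_supported (N := ⊥) (degreeProj K X n - LinearMap.id)
    (fun σ hσ => ?_) hx
  · simpa [sub_eq_zero] using this
  · rw [show (Finsupp.single σ (1 : K)) = of K σ.2 from rfl, LinearMap.sub_apply, degreeProj_of,
      if_pos (show σ.1 = n from hσ)]
    simp

end SingularChain

/-! ### Singular representatives of the cells -/

namespace RationalPointedFan

open PointedCone SingularChain

variable {d : ℕ} {Φ : RationalPointedFan d}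

local notation "E" => EuclideanSpace ℝ (Fin d)

variable {K : Type*} [Field K] (ε : Φ.IncidenceFunction)

/-- The empty simplex as a chain. -/
def emptyChain (K : Type*) [Field K] (d : ℕ) : SingularChain K (EuclideanSpace ℝ (Fin d)) :=
  of K (ContinuousMap.const (stdSimplex ℝ (Fin 0)) 0)

lemma emptyChain_mem (A : Set E) : emptyChain K d ∈ chainsIn K A :=
  of_mem_chainsIn fun t => by
    have := t.2.2
    simp at this

/-- A choice, for each cone, of a singular chain in its closed cell, compatible with boundaries. -/
structure IsCellular (f : RealCone d → SingularChain K E) (D : RealCone d) : Prop where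
  mem : f D ∈ chainsIn K (nonzeroPart D ∩ Metric.sphere 0 1)
  degree : f D ∈ degreePart K E D.dim
  boundary : boundary K E (f D) =
    Finsupp.linearCombination K f (cellBoundary K ε (Finsupp.single D 1))

lemma nonzeroPart_mono {F D : RealCone d} (h : F ≤ D) : nonzeroPart F ⊆ nonzeroPart D :=
  fun _ hx => ⟨hx.1, h hx.2⟩

lemma linearCombination_congr_of_supported {ι M : Type*} [AddCommGroup M] [Module K M]
    {s : Set ι} {f g : ι → M} (h : ∀ i ∈ s, f i = g i) {x : ι →₀ K}
    (hx : x ∈ Finsupp.supported K K s) :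
    Finsupp.linearCombination K f x = Finsupp.linearCombination K g x := by
  have := Finsupp.forall_mem_of_supported (N := ⊥)
    (Finsupp.linearCombination K f - Finsupp.linearCombination K g) (fun i hi => ?_) hx
  · simpa [sub_eq_zero] using this
  · simp [h i hi]

/-- Acyclic carriers: by induction on dimension, the chain already assigned to the cellular boundary
of `D` is a cycle in the closed cell of `D`, and this cell is acyclic. A cone of dimension `n` gets
simplices with `n` vertices, so the zero cone gets the empty simplex. -/
theorem exists_isCellular :
    ∃ f : RealCone d → SingularChain K E, f ⊥ = emptyChain K d ∧
      ∀ D ∈ Φ.cones, IsCellular ε f D := by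
  classical
  suffices h : ∀ n : ℕ, ∃ f : RealCone d → SingularChain K E, f ⊥ = emptyChain K d ∧
      ∀ D ∈ Φ.cones, D.dim ≤ n → IsCellular ε f D by
    obtain ⟨f, hf₀, hf⟩ := h d
    exact ⟨f, hf₀, fun D hD => hf D hD (dim_le D)⟩
  intro n
  induction n with
  | zero =>
    refine ⟨fun _ => emptyChain K d, rfl, fun D hD h => ⟨emptyChain_mem _, ?_, ?_⟩⟩
    · exact Finsupp.single_mem_supported K 1 (Nat.le_zero.1 h).symm
    · rw [emptyChain, boundary_of_zero, cellBoundary_single ε hD, Finset.filter_false_of_mem]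
      · simp
      · intro F _
        omega
  | succ n ih =>
    obtain ⟨f, hf₀, hf⟩ := ih
    have hex : ∀ D : RealCone d, ∃ y : SingularChain K E, D ∈ Φ.cones → D.dim = n + 1 →
        y ∈ chainsIn K (nonzeroPart D ∩ Metric.sphere 0 1) ∧ y ∈ degreePart K E D.dim ∧
        boundary K E y =
          Finsupp.linearCombination K f (cellBoundary K ε (Finsupp.single D 1)) := by
      intro D
      by_cases hD : D ∈ Φ.cones ∧ D.dim = n + 1
      swap
      · exact ⟨0, fun h₁ h₂ => absurd ⟨h₁, h₂⟩ hD⟩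
      obtain ⟨hD, hdim⟩ := hD
      have hD0 : D ≠ ⊥ := by
        rintro rfl
        rw [dim_bot] at hdim
        omega
      set c := cellBoundary K ε (Finsupp.single D 1) with hc
      have hcm := cellBoundary_single_mem (K := K) ε hD
      rw [← hc] at hcm
      have hmem : Finsupp.linearCombination K f c ∈
          chainsIn K (nonzeroPart D ∩ Metric.sphere 0 1) := by
        refine Finsupp.forall_mem_of_supported _ (fun F hF => ?_) hcm
        rw [Finsupp.linearCombination_single, one_smul]
        exact chainsIn_mono (Set.inter_subset_inter_left _ (nonzeroPart_mono hF.1.le))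
          (hf F (Φ.face_mem hD hF.1) (by have := hF.2; omega)).mem
      have hdeg : Finsupp.linearCombination K f c ∈ degreePart K E n := by
        refine Finsupp.forall_mem_of_supported _ (fun F hF => ?_) hcm
        rw [Finsupp.linearCombination_single, one_smul]
        have hFn : F.dim = n := by have := hF.2; omega
        exact hFn ▸ (hf F (Φ.face_mem hD hF.1) hFn.le).degree
      have hcyc : boundary K E (Finsupp.linearCombination K f c) = 0 := by
        have := Finsupp.forall_mem_of_supported (N := ⊥)
          (boundary K E ∘ₗ Finsupp.linearCombination K f -
            Finsupp.linearCombination K f ∘ₗ cellBoundary K ε) (fun F hF => ?_) hcm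
        · simpa [hc, cellBoundary_cellBoundary, sub_eq_zero] using this
        · have := (hf F (Φ.face_mem hD hF.1) (by have := hF.2; omega)).boundary
          simp [this]
      obtain ⟨y, hy, he⟩ := Φ.relAcyclic_cell hD hD0 _ hmem (by simp [hcyc])
      rw [Submodule.mem_bot, sub_eq_zero] at he
      -- Acyclicity is ungraded, so only the component of `y` with `n + 1` vertices is kept; its
      -- boundary is still the homogeneous cycle.
      refine ⟨degreeProj K E (n + 1) y, fun _ _ => ⟨degreeProj_mem_supported _ hy,
        hdim ▸ degreeProj_mem_degreePart _ _, ?_⟩⟩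
      rw [← degreeProj_boundary, ← he, degreeProj_eq_self hdeg]
    choose g hg using hex
    -- Only dimension `n + 1` is redefined, so for cones of dimension at most `n + 1` the values on
    -- facets, and hence the earlier boundary formulas, are unaffected.
    refine ⟨fun D => if D.dim = n + 1 then g D else f D, ?_, fun D hD hdim => ?_⟩
    · change (if (⊥ : RealCone d).dim = n + 1 then g ⊥ else f ⊥) = _
      rw [dim_bot, if_neg (by omega), hf₀]
    have hcongr : Finsupp.linearCombination K (fun D => if D.dim = n + 1 then g D else f D)
        (cellBoundary K ε (Finsupp.single D 1)) =
        Finsupp.linearCombination K f (cellBoundary K ε (Finsupp.single D 1)) := by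
      refine linearCombination_congr_of_supported (fun F hF => ?_) (cellBoundary_single_mem ε hD)
      rw [if_neg]
      have := hF.2
      omega
    by_cases h : D.dim = n + 1
    · obtain ⟨h₁, h₂, h₃⟩ := hg D hD h
      exact ⟨by simpa [h] using h₁, by simpa [h] using h₂, by rw [hcongr, if_pos h, h₃]⟩
    · obtain ⟨h₁, h₂, h₃⟩ := hf D hD (by omega)
      exact ⟨by simpa [h] using h₁, by simpa [h] using h₂, by rw [hcongr, if_neg h, h₃]⟩

end RationalPointedFan

end

/-! ### Cellular chains compute the homology of a subfan -/

noncomputable section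

namespace RationalPointedFan

open PointedCone SingularChain

variable {d : ℕ} {Φ : RationalPointedFan d}

local notation "E" => EuclideanSpace ℝ (Fin d)

variable {K : Type*} [Field K] {ε : Φ.IncidenceFunction}

/-- A chain map from cellular to singular chains that sends each cone to a chain in its closed
cell. -/
structure IsCellMap (ε : Φ.IncidenceFunction)
    (φ : (RealCone d →₀ K) →ₗ[K] SingularChain K E) : Prop where
  comm : ∀ x, boundary K E (φ x) = φ (cellBoundary K ε x)
  mem : ∀ D ∈ Φ.cones, φ (Finsupp.single D 1) ∈ chainsIn K (nonzeroPart D ∩ Metric.sphere 0 1)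
  degree : ∀ D, φ (Finsupp.single D 1) ∈ degreePart K E D.dim
  map_bot : φ (Finsupp.single ⊥ 1) = emptyChain K d

lemma bot_mem (Φ : RationalPointedFan d) : ⊥ ∈ Φ.cones := by
  obtain ⟨D, hD⟩ := Φ.nonempty
  exact Φ.face_mem hD (Φ.bot_isFaceOf hD)

theorem exists_isCellMap (K : Type*) [Field K] (ε : Φ.IncidenceFunction) :
    ∃ φ : (RealCone d →₀ K) →ₗ[K] SingularChain K E, IsCellMap ε φ := by
  classical
  obtain ⟨f, hf₀, hf⟩ := exists_isCellular (K := K) ε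
  refine ⟨Finsupp.linearCombination K fun D => if D ∈ Φ.cones then f D else 0, ?_, ?_, ?_, ?_⟩
  · intro x
    refine cell_hom_ext (f := boundary K E ∘ₗ Finsupp.linearCombination K fun D =>
      if D ∈ Φ.cones then f D else 0) (g := (Finsupp.linearCombination K fun D =>
      if D ∈ Φ.cones then f D else 0) ∘ₗ cellBoundary K ε) (fun D => ?_) x
    rw [LinearMap.comp_apply, LinearMap.comp_apply, Finsupp.linearCombination_single, one_smul]
    by_cases hD : D ∈ Φ.cones
    · rw [if_pos hD, (hf D hD).boundary]
      refine linearCombination_congr_of_supported (fun F hF => ?_) (cellBoundary_single_mem ε hD)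
      rw [if_pos (Φ.face_mem hD hF.1)]
    · rw [if_neg hD, cellBoundary_single_of_notMem ε hD, map_zero, map_zero]
  · intro D hD
    rw [Finsupp.linearCombination_single, one_smul, if_pos hD]
    exact (hf D hD).mem
  · intro D
    rw [Finsupp.linearCombination_single, one_smul]
    split_ifs with hD
    · exact (hf D hD).degree
    · exact Submodule.zero_mem _
  · rw [Finsupp.linearCombination_single, one_smul, if_pos Φ.bot_mem, hf₀]

lemma IsCellMap.map_mem_inter_sphere {φ : (RealCone d →₀ K) →ₗ[K] SingularChain K E}
    (hφ : IsCellMap ε φ) {S : Set (RealCone d)} (hS : Φ.IsSubfan S) {x : RealCone d →₀ K}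
    (hx : x ∈ Finsupp.supported K K S) :
    φ x ∈ chainsIn K (puncturedSupport S ∩ Metric.sphere 0 1) :=
  Finsupp.forall_mem_of_supported φ (fun D hD => chainsIn_mono
    (A := nonzeroPart D ∩ Metric.sphere 0 1)
    (B := puncturedSupport S ∩ Metric.sphere 0 1)
    (fun _ hy => ⟨⟨hy.1.1, D, hD, hy.1.2⟩, hy.2⟩) (hφ.mem D (hS.subset D hD))) hx

lemma IsCellMap.map_mem {φ : (RealCone d →₀ K) →ₗ[K] SingularChain K E}
    (hφ : IsCellMap ε φ) {S : Set (RealCone d)} (hS : Φ.IsSubfan S) {x : RealCone d →₀ K}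
    (hx : x ∈ Finsupp.supported K K S) : φ x ∈ chainsIn K (puncturedSupport S) :=
  chainsIn_mono Set.inter_subset_left (hφ.map_mem_inter_sphere hS hx)

/-- The empty simplex lies in every subset, even the empty one; this is the reduced homology of the
empty space in degree `-1`. -/
lemma chainsIn_empty_le : chainsIn K (∅ : Set E) ≤ Submodule.span K {emptyChain K d} := by
  intro x hx
  refine forall_mem_of_chainsIn LinearMap.id (fun n σ hσ => ?_) hx
  rcases n with _ | n
  · refine Submodule.subset_span ?_
    rw [Set.mem_singleton_iff, LinearMap.id_apply, emptyChain]
    congr 1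
    ext1 t
    exact absurd (hσ t) (Set.notMem_empty _)
  · exact absurd (hσ (stdVertex (n + 1) 0)) (Set.notMem_empty _)

lemma boundary_emptyChain : boundary K E (emptyChain K d) = 0 := boundary_of_zero _

lemma emptyChain_ne_zero : emptyChain K d ≠ 0 :=
  Finsupp.single_ne_zero.2 one_ne_zero

/-- The complex of cells of a cone is obtained from the cells not containing a facet by adding the
facet and the cone. -/
lemma IsSubfan.relAcyclic_supported_away {S : Set (RealCone d)} (hS : Φ.IsSubfan S)
    {D F : RealCone d} (hD : D ∈ S) (hF : F.IsFaceOf D) (hdim : D.dim = F.dim + 1) :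
    RelAcyclic (cellBoundary K ε)
      (Finsupp.supported K K {D' ∈ {D' ∈ S | D' ≤ D} | ¬ F ≤ D'})
      (Finsupp.supported K K {D' ∈ S | D' ≤ D}) := by
  classical
  have hDΦ := hS.subset D hD
  have hFS := hS.face_mem D hD F hF
  have hFΦ := hS.subset F hFS
  have hFD : F ≠ D := by
    rintro rfl
    omega
  have hcases : ∀ D' ∈ S, D' ≤ D → F ≤ D' → D' = F ∨ D' = D := by
    intro D' hD' hle hle'
    have h₁ := Φ.isFaceOf_of_le hDΦ (hS.subset D' hD') hle
    have h₂ := Φ.isFaceOf_of_le (hS.subset D' hD') hFΦ hle'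
    have := dim_mono hle
    have := dim_mono hle'
    rcases (show D'.dim = F.dim ∨ D'.dim = D.dim by omega) with h | h
    · exact Or.inl (h₂.eq_of_finrank_le h.le).symm
    · exact Or.inr (h₁.eq_of_finrank_le h.ge)
  set c : K := (ε.toFun D F : K) with hc
  -- The incidence number of a facet is `1` or `-1`, so it is its own inverse in every
  -- characteristic.
  have hcc : c * c = 1 := by
    have hne := (ε.ne_zero_iff D hDΦ F hFΦ hdim).2 hF
    rcases ε.mem_values D hDΦ F hFΦ hdim with h | h | h
    · exact absurd h hne
    · simp [hc, h]
    · simp [hc, h]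
  have hmem : ∀ x : RealCone d →₀ K, x ∈ Finsupp.supported K K {D' ∈ S | D' ≤ D} →
      x F = 0 → x D = 0 →
      x ∈ Finsupp.supported K K {D' ∈ {D' ∈ S | D' ≤ D} | ¬ F ≤ D'} := by
    intro x hx hxF hxD
    rw [Finsupp.mem_supported'] at hx ⊢
    intro D' hD'
    by_cases h : D' ∈ {D' ∈ S | D' ≤ D}
    · by_cases h' : F ≤ D'
      · rcases hcases D' h.1 h.2 h' with rfl | rfl <;> assumption
      · exact absurd ⟨h, h'⟩ hD'
    · exact hx D' h
  have hbF : ∀ x : RealCone d →₀ K, x ∈ Finsupp.supported K K {D' ∈ S | D' ≤ D} →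
      cellBoundary K ε x F = c * x D := by
    intro x hx
    have := Finsupp.forall_mem_of_supported (N := (⊥ : Submodule K K))
      (Finsupp.lapply F ∘ₗ cellBoundary K ε - c • Finsupp.lapply D) (fun D' hD' => ?_) hx
    · exact sub_eq_zero.1 ((Submodule.mem_bot K).1 this)
    · rw [Submodule.mem_bot, LinearMap.sub_apply, LinearMap.smul_apply, LinearMap.comp_apply,
        Finsupp.lapply_apply, Finsupp.lapply_apply]
      by_cases h : D' = D
      · subst h
        rw [cellBoundary_single_apply ε hDΦ hFΦ hdim]
        simp [hc]
      · rw [Finsupp.single_eq_of_ne (Ne.symm h), smul_zero, sub_zero]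
        by_contra hne
        have hmem' := cellBoundary_single_mem (K := K) ε (hS.subset D' hD'.1)
        rw [Finsupp.mem_supported] at hmem'
        have hF' := hmem' (Finsupp.mem_support_iff.2 hne)
        rcases hcases D' hD'.1 hD'.2 hF'.1.le with rfl | h'
        · have := hF'.2
          omega
        · exact h h'
  intro z hz hdz
  have hDm : D ∈ {D' ∈ S | D' ≤ D} := ⟨hD, le_rfl⟩
  have hzD : z D = 0 := by
    have h₁ := hbF z hz
    rw [Finsupp.mem_supported'] at hdz
    rw [hdz F fun h => h.2 le_rfl] at h₁
    calc z D = c * c * z D := by rw [hcc, one_mul]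
      _ = c * (c * z D) := by ring
      _ = 0 := by rw [← h₁, mul_zero]
  -- Since `∂z` has no coefficient at `F`, `z` has none at `D`. The boundary of this multiple of `D`
  -- has coefficient `c * c * z F = z F` at `F` and clears it.
  refine ⟨Finsupp.single D (c * z F), Finsupp.single_mem_supported K _ hDm, hmem _ ?_ ?_ ?_⟩
  · exact Submodule.sub_mem _ hz ((hS.below D).cellBoundary_mem ε
      (Finsupp.single_mem_supported K _ hDm))
  · rw [Finsupp.sub_apply, hbF _ (Finsupp.single_mem_supported K _ hDm), Finsupp.single_eq_same,
      ← mul_assoc, hcc, one_mul, sub_self]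
  · rw [Finsupp.sub_apply, hzD, show Finsupp.single D (c * z F) = (c * z F) • Finsupp.single D 1 by
      simp, map_smul, Finsupp.smul_apply, cellBoundary_single_apply_eq_zero ε (by omega)]
    simp

/-- The cellular complex of a subfan computes the singular homology of its punctured support. -/
theorem IsCellMap.relAcyclic {φ : (RealCone d →₀ K) →ₗ[K] SingularChain K E}
    (hφ : IsCellMap ε φ) {S : Set (RealCone d)} (hS : Φ.IsSubfan S) (hbot : ⊥ ∈ S) :
    RelAcyclic (coneDifferential (cellBoundary K ε) (boundary K E) φ) ⊥
      ((Finsupp.supported K K S).prod (chainsIn K (puncturedSupport S))) := by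
  classical
  have hfin : ∀ S : Set (RealCone d), Φ.IsSubfan S → S.Finite := fun S hS =>
    Φ.cones.finite_toSet.subset fun D hD => hS.subset D hD
  have hdd := coneDifferential_coneDifferential (cellBoundary_cellBoundary (K := K) ε)
    (boundary_boundary (K := K) (X := E)) hφ.comm
  induction hn : S.ncard using Nat.strong_induction_on generalizing S with
  | _ n ih =>
  -- For the zero cone alone both complexes are one-dimensional, the punctured support is empty, and
  -- the cell map matches the generators.
  by_cases htriv : S = {⊥}
  · subst htriv
    have hemp : puncturedSupport ({⊥} : Set (RealCone d)) = ∅ := by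
      refine Set.eq_empty_of_forall_notMem ?_
      rintro x ⟨hx0, D, hD, hx⟩
      rw [Set.mem_singleton_iff.1 hD, Submodule.mem_bot] at hx
      exact hx0 hx
    rw [hemp]
    rintro ⟨b, w⟩ ⟨hb, hw⟩ h
    obtain ⟨c, rfl⟩ := Submodule.mem_span_singleton.1 (chainsIn_empty_le hw)
    obtain ⟨b', rfl⟩ : ∃ b' : K, b = b' • Finsupp.single ⊥ 1 := by
      refine ⟨b ⊥, ?_⟩
      ext D
      by_cases hD : D = ⊥
      · simp [hD]
      · rw [(Finsupp.mem_supported' K b).1 hb D hD]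
        simp [Ne.symm hD]
    have hcb : cellBoundary K ε (Finsupp.single ⊥ 1) = 0 := by
      rw [cellBoundary_single ε Φ.bot_mem, Finset.filter_false_of_mem, Finset.sum_empty]
      intro F _
      rw [dim_bot]
      omega
    have hb' : b' = 0 := by
      simpa [hφ.map_bot, boundary_emptyChain, emptyChain_ne_zero, -Finsupp.smul_single] using
        (Prod.ext_iff.1 ((Submodule.mem_bot K).1 h)).2
    refine ⟨(c • Finsupp.single ⊥ 1, 0),
      ⟨Submodule.smul_mem _ _ (Finsupp.single_mem_supported K 1 rfl), Submodule.zero_mem _⟩, ?_⟩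
    rw [Submodule.mem_bot, sub_eq_zero, coneDifferential_apply, hb']
    simp [hcb, hφ.map_bot, -Finsupp.smul_single]
  -- Largest dimension makes `D` maximal, so removing `D` leaves a subfan.
  obtain ⟨D, hD, hDmax⟩ := (hfin S hS).exists_maximalFor RealCone.dim S ⟨⊥, hbot⟩
  have hD0 : D ≠ ⊥ := by
    rintro rfl
    refine htriv (Set.eq_singleton_iff_unique_mem.2 ⟨hbot, fun D' hD' => eq_bot_of_dim ?_⟩)
    have := hDmax hD'
    simp only [dim_bot] at this
    omega
  have hDΦ := hS.subset D hD
  have hmax : ∀ D' ∈ S, D ≤ D' → D' = D := by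
    intro D' hD' hle
    have hf := Φ.isFaceOf_of_le (hS.subset D' hD') hDΦ hle
    exact (hf.eq_of_finrank_le (hDmax hD' (dim_mono hle))).symm
  have hbelow : puncturedSupport {D' ∈ S | D' ≤ D} = nonzeroPart D := by
    ext x
    exact ⟨fun ⟨hx0, D', hD', hx⟩ => ⟨hx0, hD'.2 hx⟩, fun ⟨hx0, hx⟩ => ⟨hx0, D, ⟨hD, le_rfl⟩, hx⟩⟩
  have hlt : ∀ T : Set (RealCone d), T ⊆ S → D ∉ T → T.ncard < n := by
    intro T hT hDT
    rw [← hn]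
    exact Set.ncard_lt_ncard ⟨hT, fun h => hDT (h hD)⟩ (hfin S hS)
  -- the closed cell of `D`
  have hcell : RelAcyclic (cellBoundary K ε) ⊥ (Finsupp.supported K K {D' ∈ S | D' ≤ D}) := by
    obtain ⟨F, hF, -, hdim⟩ := (Φ.fg hDΦ).exists_facet (Φ.bot_isFaceOf hDΦ) hD0.symm
    have hN := (hS.below D).away F
    refine RelAcyclic.trans (cellBoundary_cellBoundary ε) bot_le
      (Finsupp.supported_mono fun _ h => h.1) ?_ (hS.relAcyclic_supported_away hD hF hdim)
    -- If `D` is a ray its facet is the zero cone, which lies below everything, and nothing remains.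
    -- Otherwise the remaining faces form a smaller subfan containing the zero cone and with acyclic
    -- space, so the induction hypothesis makes their cellular complex acyclic.
    by_cases hF0 : F = ⊥
    · have : {D' ∈ {D' ∈ S | D' ≤ D} | ¬ F ≤ D'} = ∅ := by
        simp [hF0]
      rw [this, Finsupp.supported_empty]
      intro z hz _
      exact ⟨0, Submodule.zero_mem _, by simpa using hz⟩
    · have hne : F ≠ D := by
        rintro rfl
        omega
      refine RelAcyclic.of_coneDifferential hφ.comm (fun x hx => hφ.map_mem hN hx) ?_
        (hS.relAcyclic_boundary_away hD hF hne hF0)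
      exact ih _ (hlt _ (fun _ h => h.1.1) fun h => h.2 hF.le) hN
        ⟨⟨hbot, bot_le⟩, fun h => hF0 (le_bot_iff.1 h)⟩ rfl
  have hA : RelAcyclic (coneDifferential (cellBoundary K ε) (boundary K E) φ) ⊥
      ((Finsupp.supported K K {D' ∈ S | D' ≤ D}).prod (chainsIn K (nonzeroPart D))) :=
    RelAcyclic.coneDifferential_of hφ.comm (fun x hx => hbelow ▸ hφ.map_mem (hS.below D) hx) hcell
      (Φ.relAcyclic_nonzeroPart hDΦ hD0)
  have hS' : Φ.IsSubfan (S \ {D}) := by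
    refine ⟨fun D' h => hS.subset D' h.1, fun D' h F hF => ⟨hS.face_mem D' h.1 F hF, ?_⟩⟩
    rintro rfl
    exact h.2 (hmax D' h.1 hF.le)
  have hB := ih _ (hlt (S \ {D}) Set.sdiff_subset fun h => h.2 rfl) hS' ⟨hbot, hD0.symm⟩ rfl
  have hI := ih _ (hlt {D' ∈ S \ {D} | D' ≤ D} (fun _ h => h.1.1) fun h => h.1.2 rfl)
    (hS'.below D) ⟨⟨hbot, hD0.symm⟩, bot_le⟩ rfl
  have hinf : (Finsupp.supported K K {D' ∈ S | D' ≤ D}).prod (chainsIn K (nonzeroPart D)) ⊓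
      (Finsupp.supported K K (S \ {D})).prod (chainsIn K (puncturedSupport (S \ {D}))) =
      (Finsupp.supported K K {D' ∈ S \ {D} | D' ≤ D}).prod
        (chainsIn K (puncturedSupport {D' ∈ S \ {D} | D' ≤ D})) := by
    rw [Submodule.prod_inf_prod, ← Finsupp.supported_inter, chainsIn_inf]
    have h₁ : {D' ∈ S | D' ≤ D} ∩ (S \ {D}) = {D' ∈ S \ {D} | D' ≤ D} := by
      ext D'
      exact ⟨fun h => ⟨h.2, h.1.2⟩, fun h => ⟨⟨h.1.1, h.2⟩, h.1⟩⟩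
    have h₂ : nonzeroPart D ∩ puncturedSupport (S \ {D}) =
        puncturedSupport {D' ∈ S \ {D} | D' ≤ D} := by
      ext x
      constructor
      · rintro ⟨⟨hx0, hxD⟩, -, D', hD', hxD'⟩
        have hf := (Φ.inter_isFaceOf D hDΦ D' (hS'.subset D' hD')).2
        exact ⟨hx0, D ⊓ D', ⟨hS'.face_mem D' hD' _ hf, inf_le_left⟩, hxD, hxD'⟩
      · rintro ⟨hx0, D', hD', hx⟩
        exact ⟨⟨hx0, hD'.2 hx⟩, hx0, D', hD'.1, hx⟩
    rw [h₁, h₂]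
  have hsup : (Finsupp.supported K K {D' ∈ S | D' ≤ D}).prod (chainsIn K (nonzeroPart D)) ⊔
      (Finsupp.supported K K (S \ {D})).prod (chainsIn K (puncturedSupport (S \ {D}))) =
      (Finsupp.supported K K S).prod
        (chainsIn K (nonzeroPart D) ⊔ chainsIn K (puncturedSupport (S \ {D}))) := by
    rw [Submodule.prod_sup_prod, ← Finsupp.supported_union]
    congr 2
    ext D'
    simp only [Set.mem_union, Set.mem_ofPred_eq, Set.mem_sdiff, Set.mem_singleton_iff]
    constructor
    · rintro (h | h) <;> exact h.1
    · intro h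
      by_cases he : D' = D
      · exact Or.inl ⟨h, he.le⟩
      · exact Or.inr ⟨h, he⟩
  have hclosed : ∀ T : Set (RealCone d), Φ.IsSubfan T → ∀ x ∈ (Finsupp.supported K K T).prod
      (chainsIn K (puncturedSupport T)), coneDifferential (cellBoundary K ε) (boundary K E) φ x ∈
        (Finsupp.supported K K T).prod (chainsIn K (puncturedSupport T)) := by
    rintro T hT ⟨b, w⟩ ⟨hb, hw⟩
    exact ⟨Submodule.neg_mem _ (hT.cellBoundary_mem ε hb),
      Submodule.add_mem _ (hφ.map_mem hT hb) (boundary_mem_chainsIn hw)⟩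
  have hexc := RelAcyclic.coneDifferential_right (p := cellBoundary K ε) (f := φ)
    (T := Finsupp.supported K K S) (fun x hx => ?_) (hS.relAcyclic_excision (K := K) hD hD0 hmax)
  · have hABsup : RelAcyclic (coneDifferential (cellBoundary K ε) (boundary K E) φ)
        ((Finsupp.supported K K (S \ {D})).prod (chainsIn K (puncturedSupport (S \ {D}))))
        ((Finsupp.supported K K S).prod
          (chainsIn K (nonzeroPart D) ⊔ chainsIn K (puncturedSupport (S \ {D})))) := by
      -- Mayer–Vietoris: the mapping cones of the closed cell of `D` and of its intersection with
      -- the rest are acyclic, so joining `D` to the rest changes nothing. Excision then replaces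
      -- the sum of chain modules by the chains of the union.
      rw [← hsup]
      refine RelAcyclic.sup_of_inf (hbelow ▸ hclosed _ (hS.below D)) (hclosed _ hS') ?_
      rw [hinf]
      exact RelAcyclic.cancel_left hdd bot_le (hinf ▸ inf_le_left) hI hA
    have hle : (chainsIn K (nonzeroPart D) ⊔ chainsIn K (puncturedSupport (S \ {D}))) ≤
        chainsIn K (puncturedSupport S) :=
      sup_le (chainsIn_mono fun x hx => ⟨hx.1, D, hD, hx.2⟩)
        (chainsIn_mono (puncturedSupport_mono Set.sdiff_subset))
    exact RelAcyclic.trans hdd bot_le (Submodule.prod_mono le_rfl hle)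
      (RelAcyclic.trans hdd bot_le (hsup ▸ le_sup_right) hB hABsup) hexc
  · refine Finsupp.forall_mem_of_supported φ (fun D' hD' => ?_) hx
    have hm := hφ.mem D' (hS.subset D' hD')
    by_cases he : D' = D
    · subst he
      exact Submodule.mem_sup_left (chainsIn_mono Set.inter_subset_left hm)
    · exact Submodule.mem_sup_right (chainsIn_mono
        (A := nonzeroPart D' ∩ Metric.sphere 0 1)
        (B := puncturedSupport (S \ {D})) (fun y hy => ⟨hy.1.1, D', ⟨hD', he⟩, hy.1.2⟩) hm)

end RationalPointedFan

end

/-! ### From punctured supports to the cell space -/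

noncomputable section

namespace RationalPointedFan

open PointedCone SingularChain

variable {d : ℕ} {Φ : RationalPointedFan d}

local notation "E" => EuclideanSpace ℝ (Fin d)

lemma openCell_eq (Φ : RationalPointedFan d) {C : RealCone d} (hC : C ∈ Φ.cones) :
    C.openCell = C.core ∩ Metric.sphere 0 1 := by
  rw [RealCone.openCell, (Φ.fg hC).intrinsicInterior_eq_core]

lemma cellSpace_eq (Φ : RationalPointedFan d) :
    Φ.cellSpace = puncturedSupport Φ.cones ∩ Metric.sphere 0 1 := by
  ext x
  rw [cellSpace, Set.mem_iUnion₂]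
  constructor
  · rintro ⟨C, hC, hx⟩
    rw [Φ.openCell_eq hC] at hx
    refine ⟨⟨?_, C, hC, hx.1.1⟩, hx.2⟩
    rintro rfl
    simpa using hx.2
  · rintro ⟨⟨-, D, hD, hx⟩, hs⟩
    obtain ⟨F, hF, hxF⟩ := exists_mem_core hx
    have hFΦ := Φ.face_mem hD hF
    exact ⟨F, hFΦ, (Φ.openCell_eq hFΦ).ge ⟨hxF, hs⟩⟩

variable {K : Type*} [Field K] {ε : Φ.IncidenceFunction}

/-- The cellular complex computes the reduced homology of the cell space. -/
theorem IsCellMap.relAcyclic_cellSpace {φ : (RealCone d →₀ K) →ₗ[K] SingularChain K E}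
    (hφ : IsCellMap ε φ) :
    RelAcyclic (coneDifferential (cellBoundary K ε) (boundary K E) φ) ⊥
      ((Finsupp.supported K K Φ.cones).prod (chainsIn K Φ.cellSpace)) := by
  have hdd := coneDifferential_coneDifferential (cellBoundary_cellBoundary (K := K) ε)
    (boundary_boundary (K := K) (X := E)) hφ.comm
  rw [Φ.cellSpace_eq]
  refine RelAcyclic.cancel_right hdd bot_le
    (Submodule.prod_mono le_rfl (chainsIn_mono Set.inter_subset_left))
    (RelAcyclic.coneDifferential_right (fun x hx => hφ.map_mem_inter_sphere Φ.isSubfan_cones hx)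
      (relAcyclic_inter_sphere (fun h => h.1 rfl) ?_))
    (hφ.relAcyclic Φ.isSubfan_cones Φ.bot_mem)
  rintro x ⟨hx0, D, hD, hx⟩ c hc
  exact ⟨smul_ne_zero hc.ne' hx0, D, hD, D.smul_mem hc.le hx⟩

/-- The cellular complex of the star of a cone computes the local homology of the cell space at a
point of the cell of that cone. -/
theorem IsCellMap.relAcyclic_cellSpace_sdiff {φ : (RealCone d →₀ K) →ₗ[K] SingularChain K E}
    (hφ : IsCellMap ε φ) {C : RealCone d}
    (hC : C ∈ Φ.cones) (hC0 : C ≠ ⊥) {p : E} (hp : p ∈ C.openCell) :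
    RelAcyclic (coneDifferential (cellBoundary K ε) (boundary K E) φ)
      ((Finsupp.supported K K {D ∈ (Φ.cones : Set (RealCone d)) | ¬ C ≤ D}).prod
        (chainsIn K (Φ.cellSpace \ {p})))
      ((Finsupp.supported K K Φ.cones).prod (chainsIn K Φ.cellSpace)) := by
  have hdd := coneDifferential_coneDifferential (cellBoundary_cellBoundary (K := K) ε)
    (boundary_boundary (K := K) (X := E)) hφ.comm
  rw [Φ.openCell_eq hC] at hp
  have hS := Φ.isSubfan_cones.away C
  have hbot : ⊥ ∈ {D ∈ (Φ.cones : Set (RealCone d)) | ¬ C ≤ D} :=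
    ⟨Φ.bot_mem, fun h => hC0 (le_bot_iff.1 h)⟩
  have hsub : puncturedSupport {D ∈ (Φ.cones : Set (RealCone d)) | ¬ C ≤ D} ⊆
      puncturedSupport Φ.cones \ closedRay p := by
    rintro x ⟨hx0, D, ⟨hD, hnle⟩, hx⟩
    refine ⟨⟨hx0, D, hD, hx⟩, ?_⟩
    rintro ⟨t, ht, rfl⟩
    have ht' : 0 < t := lt_of_le_of_ne ht fun h => hx0 (by simp [← h])
    exact hnle (Φ.le_of_mem_core hC hD (smul_mem_core ht' hp.1) hx)
  have hX : Φ.cellSpace \ {p} =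
      (puncturedSupport Φ.cones \ closedRay p) ∩ Metric.sphere 0 1 := by
    rw [Φ.cellSpace_eq]
    ext x
    constructor
    · rintro ⟨⟨hx, hs⟩, hne⟩
      refine ⟨⟨hx, ?_⟩, hs⟩
      rintro ⟨t, ht, rfl⟩
      refine hne ?_
      rw [mem_sphere_zero_iff_norm, norm_smul, mem_sphere_zero_iff_norm.1 hp.2, mul_one,
        Real.norm_of_nonneg ht] at hs
      rw [hs, one_smul]
      rfl
    · rintro ⟨⟨hx, hne⟩, hs⟩
      refine ⟨⟨hx, hs⟩, ?_⟩
      rintro rfl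
      exact hne ⟨1, zero_le_one, (one_smul _ _).symm⟩
  -- The cells outside the star fill a retract of the punctured support without the ray of `p`;
  -- radial projection then gives the cell space without `p`, because that ray meets the sphere only
  -- in `p`.
  have h₁ := RelAcyclic.coneDifferential_right (p := cellBoundary K ε) (f := φ)
    (T := Finsupp.supported K K {D ∈ (Φ.cones : Set (RealCone d)) | ¬ C ≤ D})
    (fun x hx => hφ.map_mem hS hx) (Φ.isSubfan_cones.relAcyclic_away (K := K) hC hC0 hp.1)
  have h₂ := RelAcyclic.trans hdd bot_le (Submodule.prod_mono le_rfl (chainsIn_mono hsub))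
    (hφ.relAcyclic hS hbot) h₁
  have h₃ : RelAcyclic (coneDifferential (cellBoundary K ε) (boundary K E) φ) ⊥
      ((Finsupp.supported K K {D ∈ (Φ.cones : Set (RealCone d)) | ¬ C ≤ D}).prod
        (chainsIn K (Φ.cellSpace \ {p}))) := by
    rw [hX]
    refine RelAcyclic.cancel_right hdd bot_le
      (Submodule.prod_mono le_rfl (chainsIn_mono Set.inter_subset_left))
      (RelAcyclic.coneDifferential_right (fun x hx => chainsIn_mono
        (Set.inter_subset_inter_left _ hsub) (hφ.map_mem_inter_sphere hS hx))
        (relAcyclic_inter_sphere (fun h => h.1.1 rfl) ?_)) h₂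
    rintro x ⟨⟨hx0, D, hD, hx⟩, hne⟩ c hc
    refine ⟨⟨smul_ne_zero hc.ne' hx0, D, hD, D.smul_mem hc.le hx⟩, ?_⟩
    rintro ⟨t, ht, he⟩
    refine hne ⟨c⁻¹ * t, by positivity, ?_⟩
    rw [mul_smul, ← he, inv_smul_smul₀ hc.ne']
  exact RelAcyclic.cancel_left hdd bot_le (Submodule.prod_mono
    (Finsupp.supported_mono fun _ h => h.1) (chainsIn_mono Set.sdiff_subset)) h₃
    hφ.relAcyclic_cellSpace

/-- A cell map factors through the chains of the cell space. -/
lemma IsCellMap.exists_lift {φ : (RealCone d →₀ K) →ₗ[K] SingularChain K E}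
    (hφ : IsCellMap ε φ) :
    ∃ ψ : (RealCone d →₀ K) →ₗ[K] SingularChain K Φ.cellSpace,
      ∀ x ∈ Finsupp.supported K K (Φ.cones : Set (RealCone d)),
        map K (inclusion Φ.cellSpace) (ψ x) = φ x := by
  have h : ∀ D : RealCone d, ∃ y : SingularChain K Φ.cellSpace, D ∈ Φ.cones →
      map K (inclusion Φ.cellSpace) y = φ (Finsupp.single D 1) := by
    intro D
    by_cases hD : D ∈ Φ.cones
    · have := hφ.map_mem_inter_sphere Φ.isSubfan_cones (Finsupp.single_mem_supported K 1 hD)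
      rw [← Φ.cellSpace_eq] at this
      obtain ⟨y, hy⟩ := exists_map_inclusion this
      exact ⟨y, fun _ => hy⟩
    · exact ⟨0, fun h => absurd h hD⟩
  choose f hf using h
  refine ⟨Finsupp.linearCombination K f, fun x hx => ?_⟩
  have := Finsupp.forall_mem_of_supported (N := ⊥)
    (map K (inclusion Φ.cellSpace) ∘ₗ Finsupp.linearCombination K f - φ) (fun D hD => ?_) hx
  · simpa [sub_eq_zero] using this
  · simp [hf D hD]

/-- Chains of the subspace are exactly the ambient chains supported in it, so acyclicity established
in the vector space transfers. -/
lemma relAcyclic_comap_inclusion {φ : (RealCone d →₀ K) →ₗ[K] SingularChain K E}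
    {ψ : (RealCone d →₀ K) →ₗ[K] SingularChain K Φ.cellSpace}
    {T₀ T : Submodule K (RealCone d →₀ K)} {A : Submodule K (SingularChain K E)}
    (hψ : ∀ x ∈ T, map K (inclusion Φ.cellSpace) (ψ x) = φ x)
    (h : RelAcyclic (coneDifferential (cellBoundary K ε) (boundary K E) φ) (T₀.prod A)
      (T.prod (chainsIn K Φ.cellSpace))) :
    RelAcyclic (coneDifferential (cellBoundary K ε) (boundary K Φ.cellSpace) ψ)
      (T₀.prod (A.comap (map K (inclusion Φ.cellSpace)))) (T.prod ⊤) := by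
  rintro ⟨b, w⟩ ⟨hb, -⟩ ⟨h₁, h₂⟩
  have hmem : ∀ w, map K (inclusion Φ.cellSpace) w ∈ chainsIn K Φ.cellSpace := fun w =>
    map_mem_chainsIn (A := Set.univ) _ (fun x _ => x.2) (by simp [chainsIn])
  obtain ⟨⟨b', y'⟩, ⟨hb', hy'⟩, h₃, h₄⟩ := h (b, map K (inclusion Φ.cellSpace) w) ⟨hb, hmem w⟩
    ⟨h₁, by simpa [hψ b hb, boundary_map] using h₂⟩
  obtain ⟨y, rfl⟩ := exists_map_inclusion hy'
  exact ⟨(b', y), ⟨hb', trivial⟩, h₃, by simpa [hψ b' hb', boundary_map] using h₄⟩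

end RationalPointedFan

end

noncomputable section

open CategoryTheory Limits AlgebraicTopology

/-! ### Homology of complexes of vector spaces by elements -/

section Elements

variable {K : Type u} [Field K]

/-- The homology of a short complex of modules agrees with that of any three-term sequence mapping
to it so that cycles and boundaries correspond. -/
lemma CategoryTheory.ShortComplex.nonempty_homology_equiv (S : ShortComplex (ModuleCat.{u} K))
    {U V W : Type*} [AddCommGroup U] [Module K U] [AddCommGroup V] [Module K V] [AddCommGroup W]
    [Module K W] (a : U →ₗ[K] V) (b : V →ₗ[K] W) (ψ : V →ₗ[K] S.X₂)
    (hcycle : ∀ v, b v = 0 → S.g (ψ v) = 0)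
    (hsurj : ∀ z, S.g z = 0 → ∃ v, b v = 0 ∧ ∃ y, z - ψ v = S.f y)
    (hinj : ∀ v, b v = 0 → (∃ y, ψ v = S.f y) → ∃ u, a u = v)
    (hbdry : ∀ u, ∃ y, ψ (a u) = S.f y) :
    Nonempty (S.homology ≃ₗ[K]
      LinearMap.ker b ⧸ (LinearMap.range a).submoduleOf (LinearMap.ker b)) := by
  let q : LinearMap.ker b →ₗ[K]
      LinearMap.ker S.g.hom ⧸ LinearMap.range S.moduleCatToCycles :=
    (LinearMap.range S.moduleCatToCycles).mkQ ∘ₗ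
      (ψ ∘ₗ (LinearMap.ker b).subtype).codRestrict (LinearMap.ker S.g.hom)
        fun v => hcycle v.1 v.2
  have hrange : ∀ z : LinearMap.ker S.g.hom,
      z ∈ LinearMap.range S.moduleCatToCycles ↔ ∃ y, z.1 = S.f y := by
    intro z
    constructor
    · rintro ⟨y, rfl⟩
      exact ⟨y, rfl⟩
    · rintro ⟨y, hy⟩
      exact ⟨y, Subtype.ext hy.symm⟩
  have hq : Function.Surjective q := by
    intro x
    obtain ⟨z, rfl⟩ := Submodule.mkQ_surjective _ x
    obtain ⟨v, hv, y, hy⟩ := hsurj z.1 z.2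
    refine ⟨⟨v, hv⟩, ?_⟩
    refine (Submodule.Quotient.eq _).2 ((hrange _).2 ⟨-y, ?_⟩)
    rw [map_neg]
    change ψ v - z.1 = _
    rw [← hy, neg_sub]
  have hker : LinearMap.ker q = (LinearMap.range a).submoduleOf (LinearMap.ker b) := by
    ext v
    rw [LinearMap.mem_ker, Submodule.submoduleOf, Submodule.mem_comap]
    refine ((Submodule.Quotient.mk_eq_zero _).trans (hrange _)).trans ?_
    constructor
    · intro h
      exact hinj v.1 v.2 h
    · rintro ⟨u, hu⟩
      obtain ⟨y, hy⟩ := hbdry u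
      exact ⟨y, by rw [← hy, hu]; rfl⟩
  exact ⟨S.moduleCatHomologyIso.toLinearEquiv.trans
    ((q.quotKerEquivOfSurjective hq).symm.trans (Submodule.quotEquivOfEq _ _ hker))⟩

/-- Cycles are tested against every `j` with `j + 1 = n`; in degree zero there is none and every
element is a cycle. -/
lemma ChainComplex.nonempty_homology_equiv (A : ChainComplex (ModuleCat.{u} K) ℕ) (n : ℕ)
    {U V W : Type*} [AddCommGroup U] [Module K U] [AddCommGroup V] [Module K V] [AddCommGroup W]
    [Module K W] (a : U →ₗ[K] V) (b : V →ₗ[K] W) (ψ : V →ₗ[K] A.X n)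
    (hcycle : ∀ v, b v = 0 → ∀ j, j + 1 = n → A.d n j (ψ v) = 0)
    (hsurj : ∀ z, (∀ j, j + 1 = n → A.d n j z = 0) → ∃ v, b v = 0 ∧ ∃ y, z - ψ v = A.d (n + 1) n y)
    (hinj : ∀ v, b v = 0 → (∃ y, ψ v = A.d (n + 1) n y) → ∃ u, a u = v)
    (hbdry : ∀ u, ∃ y, ψ (a u) = A.d (n + 1) n y) :
    Nonempty (A.homology n ≃ₗ[K]
      LinearMap.ker b ⧸ (LinearMap.range a).submoduleOf (LinearMap.ker b)) := by
  have hf : ∀ z : A.X n, (∃ y, z = (A.sc n).f y) ↔ ∃ y, z = A.d (n + 1) n y := by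
    intro z
    have : ∀ j, j = n + 1 → ((∃ y, z = A.d j n y) ↔ ∃ y, z = A.d (n + 1) n y) := by
      rintro _ rfl
      rfl
    exact this _ (ChainComplex.prev ℕ n)
  have hg : ∀ z : A.X n, (A.sc n).g z = 0 ↔ ∀ j, j + 1 = n → A.d n j z = 0 := by
    intro z
    constructor
    · rintro h j rfl
      have : ∀ i, i = j → A.d (j + 1) i z = 0 → A.d (j + 1) j z = 0 := by
        rintro _ rfl h
        exact h
      exact this _ (ChainComplex.next_nat_succ j) h
    · intro h
      by_cases hr : (ComplexShape.down ℕ).next n + 1 = n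
      · exact h _ hr
      · have : (A.sc n).g = 0 := A.shape _ _ hr
        rw [this]
        rfl
  exact (A.sc n).nonempty_homology_equiv a b ψ (fun v hv => (hg _).2 (hcycle v hv))
    (fun z hz => by
      obtain ⟨v, hv, h⟩ := hsurj z ((hg z).1 hz)
      exact ⟨v, hv, (hf _).2 h⟩)
    (fun v hv h => hinj v hv ((hf _).1 h)) fun u => (hf _).2 (hbdry u)

lemma LinearMap.finrank_homology {U V W : Type*} [AddCommGroup U] [Module K U] [AddCommGroup V]
    [Module K V] [AddCommGroup W] [Module K W] [FiniteDimensional K V] (a : U →ₗ[K] V)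
    (b : V →ₗ[K] W) (h : ∀ u, b (a u) = 0) :
    Module.finrank K (LinearMap.ker b ⧸ (LinearMap.range a).submoduleOf (LinearMap.ker b)) +
      Module.finrank K (LinearMap.range a) + Module.finrank K (LinearMap.range b) =
        Module.finrank K V := by
  have hle : LinearMap.range a ≤ LinearMap.ker b := by
    rintro _ ⟨u, rfl⟩
    exact h u
  have h₁ := ((LinearMap.range a).submoduleOf (LinearMap.ker b)).finrank_quotient_add_finrank
  rw [(Submodule.submoduleOfEquivOfLe hle).finrank_eq] at h₁
  have h₂ := b.finrank_range_add_finrank_ker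
  omega

/-- Transposing a three-term complex of matrices preserves its homology. -/
lemma Matrix.nonempty_homology_transpose_equiv {α β γ : Type*} [Fintype α] [Fintype β] [Fintype γ]
    (M : Matrix γ β K) (N : Matrix β α K) (h : M * N = 0) :
    Nonempty ((LinearMap.ker N.transpose.mulVecLin ⧸
      (LinearMap.range M.transpose.mulVecLin).submoduleOf (LinearMap.ker N.transpose.mulVecLin))
      ≃ₗ[K] (LinearMap.ker M.mulVecLin ⧸
      (LinearMap.range N.mulVecLin).submoduleOf (LinearMap.ker M.mulVecLin))) := by
  classical
  have h₁ := LinearMap.finrank_homology N.mulVecLin M.mulVecLin fun u => by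
    rw [Matrix.mulVecLin_apply, Matrix.mulVecLin_apply, Matrix.mulVec_mulVec, h, Matrix.zero_mulVec]
  have h₂ := LinearMap.finrank_homology M.transpose.mulVecLin N.transpose.mulVecLin fun u => by
    rw [Matrix.mulVecLin_apply, Matrix.mulVecLin_apply, Matrix.mulVec_mulVec,
      ← Matrix.transpose_mul, h, Matrix.transpose_zero, Matrix.zero_mulVec]
  -- Row rank equals column rank, so both homology spaces have dimension `dim V - rank M - rank N`.
  have h₃ : Module.finrank K (LinearMap.range M.transpose.mulVecLin) =
    Module.finrank K (LinearMap.range M.mulVecLin) := Matrix.rank_transpose M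
  have h₄ : Module.finrank K (LinearMap.range N.transpose.mulVecLin) =
    Module.finrank K (LinearMap.range N.mulVecLin) := Matrix.rank_transpose N
  exact ⟨LinearEquiv.ofFinrankEq _ _ (by omega)⟩

end Elements

end

/-! ### Chain models and the star complex -/

noncomputable section

open CategoryTheory Limits AlgebraicTopology

namespace SingularChain

variable {K : Type*} [Field K] {X Y : Type*} [TopologicalSpace X] [TopologicalSpace Y]

lemma degreeProj_eq_zero {m n : ℕ} (h : m ≠ n) {x : SingularChain K X}
    (hx : x ∈ degreePart K X m) : degreeProj K X n x = 0 := by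
  refine (Submodule.mem_bot K).1 (Finsupp.forall_mem_of_supported (degreeProj K X n)
    (fun σ hσ => ?_) hx)
  rw [show (Finsupp.single σ (1 : K)) = of K σ.2 from rfl, degreeProj_of,
    if_neg (fun he => h ((show σ.1 = m from hσ).symm.trans he))]
  exact Submodule.zero_mem _

lemma degreeProj_map (f : C(X, Y)) (n : ℕ) (x : SingularChain K X) :
    degreeProj K Y n (map K f x) = map K f (degreeProj K X n x) := by
  suffices h : degreeProj K Y n ∘ₗ map K f = map K f ∘ₗ degreeProj K X n from
    LinearMap.congr_fun h x
  refine LinearMap.ext (hom_ext fun m σ => ?_)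
  rw [LinearMap.comp_apply, LinearMap.comp_apply, map_of, degreeProj_of, degreeProj_of]
  split_ifs
  · rw [map_of]
  · rw [map_zero]

lemma mem_degreePart_of_map {f : C(X, Y)} (hf : Function.Injective f) {n : ℕ}
    {x : SingularChain K X} (hx : map K f x ∈ degreePart K Y n) : x ∈ degreePart K X n := by
  have h : degreeProj K X n x = x := map_injective hf (by
    rw [← degreeProj_map, degreeProj_eq_self hx])
  rw [← h]
  exact degreeProj_mem_degreePart n x

end SingularChain

open SingularChain

/-- `θ` exhibits the complex `A` as the part of the quotient of the augmented singular chain complex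
of `X` by `N` that starts with the simplices with `s` vertices. -/
structure IsChainModel {K : Type u} [Field K] {X : Type} [TopologicalSpace X]
    (A : ChainComplex (ModuleCat.{u} K) ℕ) (N : Submodule K (SingularChain K X)) (s : ℕ)
    (θ : ∀ m, SingularChain K X →ₗ[K] A.X m) : Prop where
  surjective : ∀ m, Function.Surjective (θ m)
  eq_zero_iff : ∀ m x, θ m x = 0 ↔ degreeProj K X (m + s) x ∈ N
  comm : ∀ m x, A.d (m + 1) m (θ (m + 1) x) = θ m (boundary K X x)
  degreeProj_mem : ∀ n, ∀ x ∈ N, degreeProj K X n x ∈ N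
  boundary_mem : ∀ x ∈ degreePart K X s, boundary K X x ∈ N

namespace RationalPointedFan

variable {d : ℕ} {Φ : RationalPointedFan d} {K : Type u} [Field K]

/-- The matrix of the differential of the complex of a star. -/
abbrev starMatrix (K : Type u) [Field K] (ε : Φ.IncidenceFunction) (C : RealCone d) (i j : ℤ) :
    Matrix (Φ.starBasis C j) (Φ.starBasis C i) K :=
  Matrix.of fun D F => (ε.toFun D.1 F.1 : K)

/-- The cone underlying a basis element of the complex of a star. -/
def starCone (C : RealCone d) (i : ℤ) (D : Φ.starBasis C i) : RealCone d := D.1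

lemma starCone_injective (C : RealCone d) (i : ℤ) :
    Function.Injective (starCone (Φ := Φ) C i) := Subtype.val_injective

/-- The cellular chain with given coefficients at the cones of a star. -/
def starInclusion (K : Type u) [Field K] (Φ : RationalPointedFan d) (C : RealCone d) (i : ℤ) :
    (Φ.starBasis C i → K) →ₗ[K] (RealCone d →₀ K) :=
  Finsupp.lmapDomain K K (starCone C i) ∘ₗ
    (Finsupp.linearEquivFunOnFinite K K (Φ.starBasis C i)).symm.toLinearMap

/-- The coefficients of a cellular chain at the cones of a star. -/
def starRestrict (K : Type u) [Field K] (Φ : RationalPointedFan d) (C : RealCone d) (i : ℤ) :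
    (RealCone d →₀ K) →ₗ[K] (Φ.starBasis C i → K) :=
  LinearMap.pi fun D => Finsupp.lapply D.1

@[simp] lemma starRestrict_apply (C : RealCone d) (i : ℤ) (x : RealCone d →₀ K)
    (D : Φ.starBasis C i) : starRestrict K Φ C i x D = x D.1 := rfl

lemma starInclusion_apply (C : RealCone d) (i : ℤ) (v : Φ.starBasis C i → K)
    (D : Φ.starBasis C i) : starInclusion K Φ C i v D.1 = v D := by
  change starInclusion K Φ C i v (starCone C i D) = v D
  rw [starInclusion, LinearMap.comp_apply, Finsupp.lmapDomain_apply,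
    Finsupp.mapDomain_apply (starCone_injective C i)]
  rfl

lemma starInclusion_mem (C : RealCone d) (i : ℤ) (v : Φ.starBasis C i → K) :
    starInclusion K Φ C i v ∈ Finsupp.supported K K {D | D ∈ Φ.star C ∧ (D.dim : ℤ) = i + 1} := by
  rw [Finsupp.mem_supported']
  intro D hD
  rw [starInclusion, LinearMap.comp_apply, Finsupp.lmapDomain_apply]
  refine Finsupp.mapDomain_of_notMem_range _ _ ?_
  rintro ⟨D', rfl⟩
  exact hD D'.2

lemma starRestrict_starInclusion (C : RealCone d) (i : ℤ) (v : Φ.starBasis C i → K) :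
    starRestrict K Φ C i (starInclusion K Φ C i v) = v :=
  funext fun D => starInclusion_apply C i v D

lemma starInclusion_mem_cones (C : RealCone d) (i : ℤ) (v : Φ.starBasis C i → K) :
    starInclusion K Φ C i v ∈ Finsupp.supported K K (Φ.cones : Set (RealCone d)) :=
  Finsupp.supported_mono (fun _ h => h.1.1) (starInclusion_mem C i v)

lemma starRestrict_eq_zero (C : RealCone d) (i : ℤ) {x : RealCone d →₀ K}
    (hx : x ∈ Finsupp.supported K K {D ∈ (Φ.cones : Set (RealCone d)) | ¬ C ≤ D}) :
    starRestrict K Φ C i x = 0 :=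
  funext fun D => (Finsupp.mem_supported' K x).1 hx D.1 fun h => h.2 D.2.1.2

lemma starInclusion_starRestrict_single (C : RealCone d) (i : ℤ) {D : RealCone d}
    (hD : D ∈ Φ.star C ∧ (D.dim : ℤ) = i + 1) :
    starInclusion K Φ C i (starRestrict K Φ C i (Finsupp.single D 1)) = Finsupp.single D 1 := by
  ext F
  by_cases hF : F ∈ Φ.star C ∧ (F.dim : ℤ) = i + 1
  · exact starInclusion_apply C i _ ⟨F, hF⟩
  · rw [(Finsupp.mem_supported' K _).1 (starInclusion_mem C i _) F hF, Finsupp.single_eq_of_ne]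
    rintro rfl
    exact hF hD

lemma starRestrict_single_eq_zero (C : RealCone d) (i : ℤ) {D : RealCone d}
    (hD : ¬ (D ∈ Φ.star C ∧ (D.dim : ℤ) = i + 1)) :
    starRestrict K Φ C i (Finsupp.single D 1) = 0 := by
  funext F
  rw [starRestrict_apply, Finsupp.single_eq_of_ne]
  · rfl
  · rintro h
    exact hD (h ▸ F.2)

/-- A coface of a cone above `C` is again above `C`, so the cones outside the star contribute
nothing to these coefficients. This identifies the quotient cellular complex with the transposed
star complex. -/
lemma starRestrict_cellBoundary (ε : Φ.IncidenceFunction) (C : RealCone d) {i j : ℤ}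
    (hij : j = i + 1) {x : RealCone d →₀ K}
    (hx : x ∈ Finsupp.supported K K (Φ.cones : Set (RealCone d))) :
    starRestrict K Φ C i (cellBoundary K ε x) =
      (starMatrix K ε C i j).transpose.mulVec (starRestrict K Φ C j x) := by
  classical
  have := Finsupp.forall_mem_of_supported (N := ⊥) (starRestrict K Φ C i ∘ₗ cellBoundary K ε -
    (starMatrix K ε C i j).transpose.mulVecLin ∘ₗ starRestrict K Φ C j) (fun D hD => ?_) hx
  · exact sub_eq_zero.1 ((Submodule.mem_bot K).1 this)
  rw [Submodule.mem_bot, LinearMap.sub_apply, sub_eq_zero, LinearMap.comp_apply,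
    LinearMap.comp_apply, Matrix.mulVecLin_apply]
  funext F
  rw [starRestrict_apply]
  have hFd := F.2.2
  by_cases h : D ∈ Φ.star C ∧ (D.dim : ℤ) = j + 1
  · rw [cellBoundary_single_apply ε hD F.2.1.1 (by omega)]
    obtain ⟨D, rfl⟩ : ∃ D₀ : Φ.starBasis C j, D₀.1 = D := ⟨⟨D, h⟩, rfl⟩
    refine Eq.symm ((Finset.sum_eq_single D (fun D' _ hne => ?_) fun h => ?_).trans ?_)
    · change (ε.toFun D'.1 F.1 : K) * Finsupp.single D.1 1 D'.1 = 0
      rw [Finsupp.single_eq_of_ne (fun he => hne (Subtype.ext he)), mul_zero]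
    · exact absurd (Finset.mem_univ _) h
    · change (ε.toFun D.1 F.1 : K) * Finsupp.single D.1 1 D.1 = _
      rw [Finsupp.single_eq_same, mul_one]
  · rw [starRestrict_single_eq_zero C j h, Matrix.mulVec_zero, Pi.zero_apply]
    by_cases hdim : D.dim = F.1.dim + 1
    · rw [cellBoundary_single_apply ε hD F.2.1.1 hdim]
      have : ε.toFun D F.1 = 0 := by
        by_contra hne
        have hle := ((ε.ne_zero_iff D hD F.1 F.2.1.1 hdim).1 hne).le
        exact h ⟨⟨hD, F.2.1.2.trans hle⟩, by omega⟩
      rw [this, Int.cast_zero]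
    · exact cellBoundary_single_apply_eq_zero ε hdim

/-- After transposition this is the vanishing of the square of the cellular boundary, read off on
the star. -/
lemma starMatrix_mul_starMatrix (ε : Φ.IncidenceFunction) (C : RealCone d) (i : ℤ) :
    starMatrix K ε C i (i + 1) * starMatrix K ε C (i - 1) i = 0 := by
  classical
  refine Matrix.transpose_injective ?_
  refine Matrix.ext_iff_mulVec.2 fun v => ?_
  rw [Matrix.transpose_mul, ← Matrix.mulVec_mulVec, ← starRestrict_starInclusion C (i + 1) v,
    ← starRestrict_cellBoundary ε C rfl (starInclusion_mem_cones C _ _),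
    ← starRestrict_cellBoundary ε C (by omega)
      (Φ.isSubfan_cones.cellBoundary_mem ε (starInclusion_mem_cones C _ _)),
    cellBoundary_cellBoundary]
  simp

/-- A complex modelled on singular chains has the cohomology of the complex of a star if the
cellular chains of the star map quasi-isomorphically to it. -/
theorem nonempty_homology_equiv_starCohomology {X : Type} [TopologicalSpace X]
    {ε : Φ.IncidenceFunction} {A : ChainComplex (ModuleCat.{u} K) ℕ}
    {N : Submodule K (SingularChain K X)} {s : ℕ} {θ : ∀ m, SingularChain K X →ₗ[K] A.X m}
    (hθ : IsChainModel A N s θ) {ψ : (RealCone d →₀ K) →ₗ[K] SingularChain K X} {C : RealCone d}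
    (hcomm : ∀ x ∈ Finsupp.supported K K (Φ.cones : Set (RealCone d)),
      boundary K X (ψ x) = ψ (cellBoundary K ε x))
    (hdeg : ∀ D ∈ Φ.cones, ψ (Finsupp.single D 1) ∈ degreePart K X D.dim)
    (hN : ∀ x ∈ Finsupp.supported K K {D ∈ (Φ.cones : Set (RealCone d)) | ¬ C ≤ D}, ψ x ∈ N)
    (hacyc : RelAcyclic (coneDifferential (cellBoundary K ε) (boundary K X) ψ)
      ((Finsupp.supported K K {D ∈ (Φ.cones : Set (RealCone d)) | ¬ C ≤ D}).prod N)
      ((Finsupp.supported K K (Φ.cones : Set (RealCone d))).prod ⊤))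
    (m : ℕ) (i : ℤ) (hi : (m : ℤ) + s = i + 1) :
    Nonempty (A.homology m ≃ₗ[K] Φ.StarCohomology K ε C i) := by
  classical
  have hzero : ∀ m, ∀ x ∈ N, θ m x = 0 := fun m x hx =>
    (hθ.eq_zero_iff m x).2 (hθ.degreeProj_mem _ x hx)
  -- Cones not above `C` go into `N`, and cones of another dimension go to another degree; `θ m`
  -- kills both, so only the star in dimension `i + 1` matters.
  have hkill : ∀ x ∈ Finsupp.supported K K (Φ.cones : Set (RealCone d)),
      θ m (ψ (starInclusion K Φ C i (starRestrict K Φ C i x))) = θ m (ψ x) := by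
    intro x hx
    have := Finsupp.forall_mem_of_supported (N := ⊥) ((θ m ∘ₗ ψ) ∘ₗ
      (starInclusion K Φ C i ∘ₗ starRestrict K Φ C i - LinearMap.id)) (fun D hD => ?_) hx
    · rw [Submodule.mem_bot, LinearMap.comp_apply, LinearMap.sub_apply, map_sub,
        sub_eq_zero] at this
      exact this
    rw [Submodule.mem_bot, LinearMap.comp_apply, LinearMap.sub_apply, map_sub, sub_eq_zero,
      LinearMap.id_apply]
    by_cases h : D ∈ Φ.star C ∧ (D.dim : ℤ) = i + 1
    · rw [LinearMap.comp_apply (starInclusion K Φ C i), starInclusion_starRestrict_single C i h]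
    · rw [LinearMap.comp_apply (starInclusion K Φ C i), starRestrict_single_eq_zero C i h, map_zero,
        map_zero, eq_comm]
      by_cases hCD : C ≤ D
      · rw [LinearMap.comp_apply, hθ.eq_zero_iff, degreeProj_eq_zero _ (hdeg D hD)]
        · exact N.zero_mem
        · intro hd
          exact h ⟨⟨hD, hCD⟩, by omega⟩
      · exact hzero m _ (hN _ (Finsupp.single_mem_supported K 1 ⟨hD, hCD⟩))
  have hdegree : ∀ v, ψ (starInclusion K Φ C i v) ∈ degreePart K X (m + s) := fun v =>
    Finsupp.forall_mem_of_supported ψ (fun D hD => by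
      have : D.dim = m + s := by
        have := hD.2
        omega
      exact this ▸ hdeg D hD.1.1) (starInclusion_mem C i v)
  -- A cycle of the transposed star complex is a cellular chain whose boundary uses only cones not
  -- above `C`.
  have hmem : ∀ v, (starMatrix K ε C (i - 1) i).transpose.mulVecLin v = 0 →
      cellBoundary K ε (starInclusion K Φ C i v) ∈
        Finsupp.supported K K {D ∈ (Φ.cones : Set (RealCone d)) | ¬ C ≤ D} := by
    intro v hv
    have hcones := Φ.isSubfan_cones.cellBoundary_mem ε (starInclusion_mem_cones C i v)
    rw [Finsupp.mem_supported']
    intro F hF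
    by_cases hFΦ : F ∈ Φ.cones
    swap
    · exact (Finsupp.mem_supported' K _).1 hcones F hFΦ
    have hCF : C ≤ F := by
      by_contra h
      exact hF ⟨hFΦ, h⟩
    by_cases hdim : (F.dim : ℤ) = i - 1 + 1
    · have := starRestrict_cellBoundary ε C (i := i - 1) (j := i) (by omega)
        (starInclusion_mem_cones C i v)
      rw [starRestrict_starInclusion, ← Matrix.mulVecLin_apply, hv] at this
      exact congrFun this ⟨F, ⟨hFΦ, hCF⟩, hdim⟩
    · refine (Submodule.mem_bot K).1 (Finsupp.forall_mem_of_supported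
        (Finsupp.lapply F ∘ₗ cellBoundary K ε) (fun D hD => ?_) (starInclusion_mem C i v))
      rw [Submodule.mem_bot, LinearMap.comp_apply, Finsupp.lapply_apply]
      refine cellBoundary_single_apply_eq_zero ε fun h => hdim ?_
      have := hD.2
      omega
  have he := A.nonempty_homology_equiv m (starMatrix K ε C i (i + 1)).transpose.mulVecLin
    (starMatrix K ε C (i - 1) i).transpose.mulVecLin (θ m ∘ₗ ψ ∘ₗ starInclusion K Φ C i)
    ?_ ?_ ?_ ?_
  · obtain ⟨e⟩ := he
    obtain ⟨e'⟩ := Matrix.nonempty_homology_transpose_equiv (starMatrix K ε C i (i + 1))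
      (starMatrix K ε C (i - 1) i) (starMatrix_mul_starMatrix ε C i)
    exact ⟨e.trans e'⟩
  · rintro v hv j rfl
    change A.d (j + 1) j (θ (j + 1) _) = 0
    rw [hθ.comm]
    change θ j (boundary K X (ψ (starInclusion K Φ C i v))) = 0
    rw [hcomm _ (starInclusion_mem_cones C i v)]
    exact hzero j _ (hN _ (hmem v hv))
  · intro z hz
    obtain ⟨w', rfl⟩ := hθ.surjective m z
    set w := degreeProj K X (m + s) w' with hw
    have hwd : w ∈ degreePart K X (m + s) := degreeProj_mem_degreePart _ _
    have hθw : θ m w' = θ m w := by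
      rw [← sub_eq_zero, ← map_sub, hθ.eq_zero_iff, map_sub, degreeProj_eq_self hwd, sub_self]
      exact N.zero_mem
    have hbw : boundary K X w ∈ N := by
      rcases m with _ | m
      -- In degree zero being a cycle is no condition on `z`; the model guarantees instead that
      -- boundaries from the lowest degree fall into `N`.
      · exact hθ.boundary_mem w (by simpa using hwd)
      · have := hz m rfl
        rw [hθ.comm, hθ.eq_zero_iff, degreeProj_boundary] at this
        rwa [hw, show m + 1 + s = m + s + 1 by omega]
    -- Bounding `(0, w)` in the mapping cone yields a relative cellular cycle `b` whose image is
    -- homologous to `w` modulo `N`.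
    obtain ⟨⟨b, y⟩, ⟨hb, -⟩, h₁, h₂⟩ := hacyc (0, w) ⟨Submodule.zero_mem _, trivial⟩
      ⟨by simp, by simpa using hbw⟩
    simp only [coneDifferential_apply, Prod.fst_sub, Prod.snd_sub, zero_sub, neg_neg] at h₁ h₂
    refine ⟨starRestrict K Φ C i b, ?_, θ (m + 1) y, ?_⟩
    · rw [Matrix.mulVecLin_apply, ← starRestrict_cellBoundary ε C (by omega) hb]
      exact starRestrict_eq_zero C _ h₁
    · rw [hθ.comm, hθw]
      change θ m w - θ m (ψ (starInclusion K Φ C i (starRestrict K Φ C i b))) = _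
      rw [hkill b hb, ← map_sub, ← sub_eq_zero, ← map_sub, sub_sub]
      exact hzero m _ h₂
  · rintro v hv ⟨y', hy'⟩
    obtain ⟨y, rfl⟩ := hθ.surjective _ y'
    rw [hθ.comm] at hy'
    change θ m (ψ (starInclusion K Φ C i v)) = _ at hy'
    rw [← sub_eq_zero, ← map_sub, hθ.eq_zero_iff, map_sub, degreeProj_eq_self (hdegree v),
      degreeProj_boundary] at hy'
    -- If the image of `v` bounds `y`, the pair of `v` and `-y` is a relative cycle of the mapping
    -- cone. The first component of a bounding pair shows that `v` is a cellular boundary modulo the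
    -- cones outside the star.
    obtain ⟨⟨b, z⟩, ⟨hb, -⟩, h₁, -⟩ := hacyc
      (starInclusion K Φ C i v, -degreeProj K X (m + s + 1) y)
      ⟨starInclusion_mem_cones C i v, trivial⟩
      ⟨by simpa using hmem v hv, by simpa [← sub_eq_add_neg] using hy'⟩
    simp only [coneDifferential_apply, Prod.fst_sub, sub_neg_eq_add] at h₁
    have h₂ := starRestrict_eq_zero C i h₁
    rw [map_add, starRestrict_starInclusion, starRestrict_cellBoundary ε C rfl hb] at h₂
    refine ⟨-starRestrict K Φ C (i + 1) b, ?_⟩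
    rw [Matrix.mulVecLin_apply, Matrix.mulVec_neg]
    exact (eq_neg_of_add_eq_zero_left h₂).symm
  · intro u
    refine ⟨θ (m + 1) (ψ (starInclusion K Φ C (i + 1) u)), ?_⟩
    have hu := starInclusion_mem_cones C (i + 1) u
    rw [hθ.comm, hcomm _ hu, ← hkill _ (Φ.isSubfan_cones.cellBoundary_mem ε hu),
      starRestrict_cellBoundary ε C rfl hu, starRestrict_starInclusion]
    rfl

end RationalPointedFan

end

noncomputable section

open CategoryTheory Limits AlgebraicTopology Simplicial

/-! ### Comparison with the singular chain complex -/

section SimplicialChains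

variable (K : Type u) [Field K] (S : SSet.{0}) (n : ℕ)

/-- The chain of a linear combination of simplices. -/
def simplexChain : (S _⦋n⦌ →₀ K) →ₗ[K] (S.chainComplex (ModuleCat.of K K)).X n :=
  Finsupp.linearCombination K fun x => (S.ιChainComplex (R := ModuleCat.of K K) x).hom 1

lemma simplexChain_single (x : S _⦋n⦌) :
    simplexChain K S n (Finsupp.single x 1) =
      (S.ιChainComplex (R := ModuleCat.of K K) x).hom 1 := by
  simp [simplexChain]

/-- The chain object is a coproduct of copies of `K` indexed by simplices; its universal property
supplies the inverse. -/
lemma simplexChain_bijective : Function.Bijective (simplexChain K S n) := by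
  let g : (S.chainComplex (ModuleCat.of K K)).X n ⟶ ModuleCat.of K (S _⦋n⦌ →₀ K) :=
    (S.isColimitChainComplexXCofan (ModuleCat.of K K) n).desc
      (Cofan.mk _ fun x => ModuleCat.ofHom (Finsupp.lsingle x))
  have hg : ∀ x, S.ιChainComplex (R := ModuleCat.of K K) x ≫ g =
      ModuleCat.ofHom (Finsupp.lsingle x) := fun x =>
    (S.isColimitChainComplexXCofan (ModuleCat.of K K) n).fac
      (Cofan.mk _ fun x => ModuleCat.ofHom (Finsupp.lsingle x)) ⟨x⟩
  have h₁ : g.hom ∘ₗ simplexChain K S n = LinearMap.id := by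
    refine Finsupp.lhom_ext' fun x => LinearMap.ext_ring ?_
    have := congrArg (fun f => f.hom (1 : K)) (hg x)
    simpa [simplexChain_single] using this
  have h₂ : g ≫ ModuleCat.ofHom (simplexChain K S n) = 𝟙 _ := by
    refine SSet.chainComplex_hom_ext fun x => ?_
    rw [← Category.assoc, hg, Category.comp_id]
    refine ModuleCat.hom_ext (LinearMap.ext_ring ?_)
    exact simplexChain_single K S n x
  refine Function.bijective_iff_has_inverse.2 ⟨g.hom, fun x => LinearMap.congr_fun h₁ x,
    fun x => ?_⟩
  exact congrArg (fun f => f.hom x) h₂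

lemma simplexChain_d (x : S _⦋n + 1⦌) :
    (S.chainComplex (ModuleCat.of K K)).d (n + 1) n
      (simplexChain K S (n + 1) (Finsupp.single x 1)) =
      ∑ i : Fin (n + 2), (-1 : K) ^ (i : ℕ) • simplexChain K S n (Finsupp.single (S.δ i x) 1) := by
  have h := congrArg (fun f => f.hom (1 : K)) (S.ιChainComplex_d (ModuleCat.of K K) x)
  rw [simplexChain_single]
  refine h.trans ?_
  simp only [simplexChain_single]
  rw [ModuleCat.hom_sum, LinearMap.sum_apply]
  refine Finset.sum_congr rfl fun i _ => ?_
  rcases Nat.even_or_odd (i : ℕ) with h | h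
  · simp [h.neg_one_pow]
  · simp [h.neg_one_pow]

lemma simplexChain_map {S T : SSet.{0}} (f : S ⟶ T) (x : S _⦋n⦌) :
    (SSet.chainComplexMap f (ModuleCat.of K K)).f n (simplexChain K S n (Finsupp.single x 1)) =
      simplexChain K T n (Finsupp.single (f.app _ x) 1) := by
  rw [simplexChain_single, simplexChain_single]
  exact congrArg (fun f => f.hom (1 : K)) (SSet.ι_chainComplexMap_f S T f (ModuleCat.of K K) x)

end SimplicialChains

namespace SingularChain

variable (K : Type u) [Field K] {X Y : Type} [TopologicalSpace X] [TopologicalSpace Y]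

/-- The simplices with `n + 1` vertices among all simplices. -/
def simplexOfDim (X : Type) [TopologicalSpace X] (n : ℕ)
    (x : TopCat.toSSet.obj (TopCat.of X) _⦋n⦌) : SingularSimplex X :=
  ⟨n + 1, (TopCat.of X).toSSetObjEquiv _ x⟩

lemma simplexOfDim_injective (n : ℕ) : Function.Injective (simplexOfDim X n) := by
  intro x y h
  simp only [simplexOfDim, Sigma.mk.injEq, heq_eq_eq, true_and] at h
  exact ((TopCat.of X).toSSetObjEquiv _).injective h

lemma exists_simplexOfDim {n : ℕ} (σ : C(stdSimplex ℝ (Fin (n + 1)), X)) :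
    ∃ x, simplexOfDim X n x = ⟨n + 1, σ⟩ :=
  ⟨((TopCat.of X).toSSetObjEquiv _).symm σ, by simp [simplexOfDim]⟩

/-- The component in degree `n` of a chain, in the singular chain complex. -/
def toSingularChains (X : Type) [TopologicalSpace X] (n : ℕ) :
    SingularChain K X →ₗ[K] (singularChains K (TopCat.of X)).X n :=
  simplexChain K (TopCat.toSSet.obj (TopCat.of X)) n ∘ₗ
    Finsupp.lcomapDomain (simplexOfDim X n) (simplexOfDim_injective n)

lemma toSingularChains_single (n : ℕ) (x : TopCat.toSSet.obj (TopCat.of X) _⦋n⦌) :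
    toSingularChains K X n (Finsupp.single (simplexOfDim X n x) 1) =
      simplexChain K (TopCat.toSSet.obj (TopCat.of X)) n (Finsupp.single x 1) :=
  congrArg (simplexChain K (TopCat.toSSet.obj (TopCat.of X)) n)
    (Finsupp.comapDomain_single (simplexOfDim X n) x 1 (simplexOfDim_injective n).injOn)

lemma degreeProj_apply {K : Type*} [Field K] {X : Type*} [TopologicalSpace X] (n : ℕ)
    (x : SingularChain K X) (σ : SingularSimplex X) :
    degreeProj K X n x σ = if σ.1 = n then x σ else 0 := by
  classical
  by_cases h : σ.1 = n
  · rw [if_pos h]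
    suffices hs : Finsupp.lapply σ ∘ₗ degreeProj K X n = Finsupp.lapply σ from
      LinearMap.congr_fun hs x
    refine LinearMap.ext (hom_ext fun m τ => ?_)
    rw [LinearMap.comp_apply, degreeProj_of]
    split_ifs with hm
    · rfl
    · rw [map_zero, Finsupp.lapply_apply, Finsupp.single_eq_of_ne]
      rintro rfl
      exact hm h
  · rw [if_neg h]
    exact (Finsupp.mem_supported' K _).1 (degreeProj_mem_degreePart n x) σ h

lemma toSingularChains_eq_zero_iff (n : ℕ) (x : SingularChain K X) :
    toSingularChains K X n x = 0 ↔ degreeProj K X (n + 1) x = 0 := by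
  refine (map_eq_zero_iff _ (simplexChain_bijective K _ n).1).trans ?_
  constructor
  · intro h
    ext σ
    rw [degreeProj_apply, Finsupp.coe_zero, Pi.zero_apply]
    split_ifs with hσ
    · obtain ⟨m, σ⟩ := σ
      obtain rfl : m = n + 1 := hσ
      obtain ⟨y, hy⟩ := exists_simplexOfDim σ
      rw [← hy]
      exact DFunLike.congr_fun h y
    · rfl
  · intro h
    ext y
    have := DFunLike.congr_fun h (simplexOfDim X n y)
    rw [degreeProj_apply, if_pos (show (simplexOfDim X n y).1 = n + 1 from rfl)] at this
    exact this

lemma toSingularChains_surjective (n : ℕ) : Function.Surjective (toSingularChains K X n) := by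
  refine (simplexChain_bijective K _ n).2.comp fun x => ⟨Finsupp.mapDomain (simplexOfDim X n) x, ?_⟩
  exact Finsupp.leftInverse_lcomapDomain_mapDomain (R := K) _ (simplexOfDim_injective n) x

lemma toSingularChains_of_ne {n m : ℕ} (h : m ≠ n + 1) (σ : C(stdSimplex ℝ (Fin m), X)) :
    toSingularChains K X n (of K σ) = 0 := by
  rw [toSingularChains_eq_zero_iff, degreeProj_of, if_neg h]

lemma simplexOfDim_δ {n : ℕ} (i : Fin (n + 2))
    (x : TopCat.toSSet.obj (TopCat.of X) _⦋n + 1⦌) :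
    simplexOfDim X n ((TopCat.toSSet.obj (TopCat.of X)).δ i x) =
      ⟨n + 1, ((TopCat.of X).toSSetObjEquiv _ x).comp (stdFace i)⟩ := by
  rw [simplexOfDim]
  congr 1
  ext1 t
  refine (TopCat.toSSetObjEquiv_δ_apply x i t).trans (congrArg _ (Subtype.ext (funext fun j => ?_)))
  change FunOnFinite.linearMap ℝ ℝ i.succAbove t.1 j =
    (∑ k, t.1 k • (Pi.single (i.succAbove k) 1 : Fin (n + 2) → ℝ)) j
  rw [FunOnFinite.linearMap_apply_apply, Finset.sum_filter, Finset.sum_apply]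
  refine Finset.sum_congr rfl fun k _ => ?_
  rw [Pi.smul_apply, Pi.single_apply, smul_eq_mul, mul_ite, mul_one, mul_zero]
  simp only [eq_comm]

lemma toSingularChains_boundary (n : ℕ) (x : SingularChain K X) :
    (singularChains K (TopCat.of X)).d (n + 1) n (toSingularChains K X (n + 1) x) =
      toSingularChains K X n (boundary K X x) := by
  suffices h : ((singularChains K (TopCat.of X)).d (n + 1) n).hom ∘ₗ toSingularChains K X (n + 1) =
      toSingularChains K X n ∘ₗ boundary K X from LinearMap.congr_fun h x
  refine LinearMap.ext (hom_ext fun m σ => ?_)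
  rw [LinearMap.comp_apply, LinearMap.comp_apply]
  by_cases hm : m = n + 2
  · subst hm
    obtain ⟨y, hy⟩ := exists_simplexOfDim σ
    obtain rfl : (TopCat.of X).toSSetObjEquiv _ y = σ := by
      simpa [simplexOfDim] using hy
    rw [boundary_of_succ, map_sum]
    refine (congrArg _ (toSingularChains_single K (n + 1) y)).trans
      ((simplexChain_d K _ n y).trans (Finset.sum_congr rfl fun i _ => ?_))
    rw [map_smul, ← toSingularChains_single, simplexOfDim_δ]
    rfl
  · rw [toSingularChains_of_ne K hm, map_zero]
    rcases m with _ | m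
    · rw [boundary_of_zero, map_zero]
    · rw [boundary_of_succ, map_sum]
      refine (Finset.sum_eq_zero fun i _ => ?_).symm
      rw [map_smul, toSingularChains_of_ne K (by omega), smul_zero]

lemma toSingularChains_map (f : C(X, Y)) (n : ℕ) (x : SingularChain K X) :
    (((singularChainComplexFunctor.{0} (ModuleCat.{u} K)).obj (ModuleCat.of K K)).map
      (TopCat.ofHom f)).f n (toSingularChains K X n x) =
      toSingularChains K Y n (map K f x) := by
  suffices h : ((((singularChainComplexFunctor.{0} (ModuleCat.{u} K)).obj (ModuleCat.of K K)).map
      (TopCat.ofHom f)).f n).hom ∘ₗ toSingularChains K X n = toSingularChains K Y n ∘ₗ map K f from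
    LinearMap.congr_fun h x
  refine LinearMap.ext (hom_ext fun m σ => ?_)
  rw [LinearMap.comp_apply, LinearMap.comp_apply, map_of]
  by_cases hm : m = n + 1
  · subst hm
    obtain ⟨y, hy⟩ := exists_simplexOfDim σ
    obtain rfl : (TopCat.of X).toSSetObjEquiv _ y = σ := by
      simpa [simplexOfDim] using hy
    refine (congrArg _ (toSingularChains_single K n y)).trans
      ((simplexChain_map K n (TopCat.toSSet.map (TopCat.ofHom f)) y).trans ?_)
    rw [← toSingularChains_single]
    rfl
  · rw [toSingularChains_of_ne K hm, toSingularChains_of_ne K hm, map_zero]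

end SingularChain

end

/-! ### The augmented and relative singular complexes as chain models -/

noncomputable section

open CategoryTheory Limits AlgebraicTopology

namespace SingularChain

variable (K : Type u) [Field K] (X : Type) [TopologicalSpace X]

lemma isEmpty_stdSimplex_zero : IsEmpty (stdSimplex ℝ (Fin 0)) :=
  ⟨fun t => by simpa using t.2.2⟩

/-- The empty simplex of a space. -/
def emptySimplex : SingularSimplex X :=
  ⟨0, ⟨isEmpty_stdSimplex_zero.elim, continuous_iff_continuousAt.2 isEmpty_stdSimplex_zero.elim⟩⟩

lemma eq_emptySimplex {X : Type} [TopologicalSpace X] (σ : C(stdSimplex ℝ (Fin 0), X)) :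
    ⟨0, σ⟩ = emptySimplex X := by
  rw [emptySimplex]
  congr 1
  ext1 t
  exact isEmpty_stdSimplex_zero.elim t

/-- The components of a chain in the augmented singular chain complex. -/
def toAugmentedSingularChains :
    ∀ m, SingularChain K X →ₗ[K] (augmentedSingularChains K (TopCat.of X)).X m
  | 0 => (Finsupp.lapply (emptySimplex X) : SingularChain K X →ₗ[K] K)
  | m + 1 => toSingularChains K X m

/-- The only face of a one-vertex simplex is the empty simplex, with sign `1`, so the augmentation
is the boundary into the empty simplex. -/
lemma augmentation_toSingularChains (x : SingularChain K X) :
    augmentation K (TopCat.of X) (toSingularChains K X 0 x) = boundary K X x (emptySimplex X) := by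
  suffices h : (augmentation K (TopCat.of X)).hom ∘ₗ toSingularChains K X 0 =
      (Finsupp.lapply (emptySimplex X) : SingularChain K X →ₗ[K] K) ∘ₗ boundary K X from
    LinearMap.congr_fun h x
  refine LinearMap.ext (hom_ext fun m σ => ?_)
  rw [LinearMap.comp_apply, LinearMap.comp_apply, Finsupp.lapply_apply]
  by_cases hm : m = 1
  · subst hm
    obtain ⟨y, hy⟩ := exists_simplexOfDim σ
    have h₁ : of K σ = Finsupp.single (simplexOfDim X 0 y) 1 := by rw [hy]
    have h₂ : (augmentation K (TopCat.of X)).hom (toSingularChains K X 0 (of K σ)) = (1 : K) := by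
      rw [h₁]
      refine (congrArg _ ((toSingularChains_single K 0 y).trans
        (simplexChain_single K _ 0 y))).trans ?_
      have : (TopCat.toSSet.obj (TopCat.of X)).ιChainComplex (R := ModuleCat.of K K) y ≫
          augmentation K (TopCat.of X) = 𝟙 _ := Sigma.ι_desc _ _
      exact congrArg (fun f => f.hom (1 : K)) this
    rw [h₂, boundary_of_succ, Fin.sum_univ_one]
    simp only [Fin.val_zero, pow_zero, one_smul]
    rw [← eq_emptySimplex (σ.comp (stdFace 0))]
    exact Finsupp.single_eq_same.symm
  · rw [toSingularChains_of_ne K (by omega), map_zero]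
    have : degreeProj K X 0 (boundary K X (of K σ)) = 0 := by
      rw [degreeProj_boundary, degreeProj_of, if_neg (by omega), map_zero]
    have h := DFunLike.congr_fun this (emptySimplex X)
    rw [degreeProj_apply, if_pos (show (emptySimplex X).1 = 0 from rfl)] at h
    exact h.symm

lemma boundary_eq_zero_of_mem_degreePart {x : SingularChain K X} (hx : x ∈ degreePart K X 0) :
    boundary K X x = 0 := by
  refine (Submodule.mem_bot K).1 (Finsupp.forall_mem_of_supported (boundary K X) ?_ hx)
  rintro ⟨m, σ⟩ hσ
  obtain rfl : m = 0 := hσ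
  rw [Submodule.mem_bot]
  exact boundary_of_zero σ

lemma isChainModel_augmentedSingularChains :
    IsChainModel (augmentedSingularChains K (TopCat.of X)) ⊥ 0 (toAugmentedSingularChains K X) where
  surjective m := by
    rcases m with _ | m
    · exact fun c => ⟨Finsupp.single (emptySimplex X) c, Finsupp.single_eq_same⟩
    · exact toSingularChains_surjective K m
  eq_zero_iff m x := by
    rw [Submodule.mem_bot]
    rcases m with _ | m
    · change x (emptySimplex X) = 0 ↔ _
      constructor
      · intro h
        ext ⟨m, σ⟩
        rw [degreeProj_apply]
        split_ifs with hm
        · obtain rfl : m = 0 := hm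
          rw [eq_emptySimplex, h]
          rfl
        · rfl
      · intro h
        have h := DFunLike.congr_fun h (emptySimplex X)
        rwa [degreeProj_apply, if_pos (show (emptySimplex X).1 = 0 + 0 from rfl)] at h
    · exact toSingularChains_eq_zero_iff K m x
  comm m x := by
    rcases m with _ | m
    · exact augmentation_toSingularChains K X x
    · exact toSingularChains_boundary K m x
  degreeProj_mem n x hx := by
    rw [(Submodule.mem_bot K).1 hx, map_zero]
    exact Submodule.zero_mem _
  boundary_mem x hx := (Submodule.mem_bot K).2 (boundary_eq_zero_of_mem_degreePart K X hx)

variable {X}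

/-- The components of a chain in the relative singular chain complex. -/
def toRelativeSingularChains (A : Set X) (m : ℕ) :
    SingularChain K X →ₗ[K] (relativeSingularChains K (TopCat.of X) A).X m :=
  ((cokernel.π (((singularChainComplexFunctor.{0} (ModuleCat.{u} K)).obj (ModuleCat.of K K)).map
    (TopCat.ofHom (inclusion A)))).f m).hom ∘ₗ toSingularChains K X m

lemma cokernel_π_f_surjective {C D : ChainComplex (ModuleCat.{u} K) ℕ} (f : C ⟶ D) (m : ℕ) :
    Function.Surjective ((cokernel.π f).f m) :=
  (ModuleCat.epi_iff_surjective _).1 inferInstance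

lemma cokernel_π_f_eq_zero_iff {C D : ChainComplex (ModuleCat.{u} K) ℕ} (f : C ⟶ D) (m : ℕ)
    (x : D.X m) : (cokernel.π f).f m x = 0 ↔ ∃ y, f.f m y = x := by
  have h := (ShortComplex.exact_cokernel f).map (HomologicalComplex.eval (ModuleCat.{u} K) _ m)
  exact ⟨fun hx => (ShortComplex.moduleCat_exact_iff _).1 h x hx, by
    rintro ⟨y, rfl⟩
    exact ShortComplex.moduleCat_zero_apply
      ((ShortComplex.mk _ _ (cokernel.condition f)).map
        (HomologicalComplex.eval (ModuleCat.{u} K) _ m)) y⟩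

lemma isChainModel_relativeSingularChains (A : Set X) :
    IsChainModel (relativeSingularChains K (TopCat.of X) A) (chainsIn K A) 1
      (toRelativeSingularChains K A) where
  surjective m := (cokernel_π_f_surjective K _ m).comp (toSingularChains_surjective K m)
  eq_zero_iff m x := by
    refine (cokernel_π_f_eq_zero_iff K _ m _).trans ?_
    constructor
    · rintro ⟨y', hy'⟩
      obtain ⟨y, rfl⟩ := toSingularChains_surjective K (X := A) m y'
      have h := (toSingularChains_map K (inclusion A) m y).symm.trans hy'
      rw [← sub_eq_zero, ← map_sub, toSingularChains_eq_zero_iff, map_sub, sub_eq_zero,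
        degreeProj_map] at h
      rw [← h]
      exact map_mem_chainsIn (A := Set.univ) _ (fun t _ => t.2) (by simp [chainsIn])
    · intro h
      obtain ⟨y, hy⟩ := exists_map_inclusion h
      refine ⟨toSingularChains K A m y, (toSingularChains_map K (inclusion A) m y).trans ?_⟩
      rw [hy, ← sub_eq_zero, ← map_sub, toSingularChains_eq_zero_iff, map_sub,
        degreeProj_eq_self (degreeProj_mem_degreePart _ _), sub_self]
  comm m x := by
    have h := congrArg (fun f => f.hom (toSingularChains K X (m + 1) x))
      ((cokernel.π (((singularChainComplexFunctor.{0} (ModuleCat.{u} K)).obj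
        (ModuleCat.of K K)).map (TopCat.ofHom (inclusion A)))).comm (m + 1) m)
    exact h.trans (congrArg _ (toSingularChains_boundary K m x))
  degreeProj_mem n x hx := degreeProj_mem_supported n hx
  -- The boundary of a zero-chain is a multiple of the empty simplex, which lies in every `A`. So
  -- relative chains lose their augmentation, and the model starts with one vertex.
  boundary_mem x hx := by
    have h : boundary K X x ∈ degreePart K X 0 := by
      have := degreeProj_boundary 0 x
      rw [degreeProj_eq_self hx] at this
      rw [← this]
      exact degreeProj_mem_degreePart _ _
    refine Finsupp.supported_mono ?_ h
    rintro ⟨m, σ⟩ hσ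
    obtain rfl : m = 0 := hσ
    rintro _ ⟨t, rfl⟩
    exact isEmpty_stdSimplex_zero.elim t

end SingularChain

end

/-! ### The two isomorphisms -/

noncomputable section

open CategoryTheory Limits AlgebraicTopology

namespace RationalPointedFan

open SingularChain

variable {d : ℕ} {Φ : RationalPointedFan d} {K : Type u} [Field K] {ε : Φ.IncidenceFunction}

lemma subsingleton_starCohomology {C : RealCone d} {i : ℤ}
    (h : ∀ D ∈ Φ.star C, (D.dim : ℤ) ≠ i + 1) : Subsingleton (Φ.StarCohomology K ε C i) := by
  have : IsEmpty (Φ.starBasis C i) := ⟨fun D => h D.1 D.2.1 D.2.2⟩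
  have : Subsingleton (Φ.StarCochains K C i) := inferInstanceAs (Subsingleton (_ → K))
  infer_instance

lemma nonempty_intHomology_equiv_negSucc (A : ChainComplex (ModuleCat.{u} K) ℕ) (n : ℕ)
    (V : Type*) [AddCommGroup V] [Module K V] [Subsingleton V] :
    Nonempty (intHomology K A (Int.negSucc n) ≃ₗ[K] V) :=
  ⟨(LinearEquiv.ofSubsingleton PUnit.{u + 1} V : PUnit.{u + 1} ≃ₗ[K] V)⟩

lemma IsCellMap.boundary_lift
    {φ : (RealCone d →₀ K) →ₗ[K] SingularChain K (EuclideanSpace ℝ (Fin d))}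
    (hφ : IsCellMap ε φ) {ψ : (RealCone d →₀ K) →ₗ[K] SingularChain K Φ.cellSpace}
    (hψ : ∀ x ∈ Finsupp.supported K K (Φ.cones : Set (RealCone d)),
      map K (inclusion Φ.cellSpace) (ψ x) = φ x) {x : RealCone d →₀ K}
    (hx : x ∈ Finsupp.supported K K (Φ.cones : Set (RealCone d))) :
    boundary K Φ.cellSpace (ψ x) = ψ (cellBoundary K ε x) := by
  refine map_injective (f := inclusion Φ.cellSpace) Subtype.val_injective ?_
  rw [← boundary_map, hψ x hx, hφ.comm, hψ _ (Φ.isSubfan_cones.cellBoundary_mem ε hx)]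

lemma IsCellMap.lift_mem_degreePart
    {φ : (RealCone d →₀ K) →ₗ[K] SingularChain K (EuclideanSpace ℝ (Fin d))}
    (hφ : IsCellMap ε φ) {ψ : (RealCone d →₀ K) →ₗ[K] SingularChain K Φ.cellSpace}
    (hψ : ∀ x ∈ Finsupp.supported K K (Φ.cones : Set (RealCone d)),
      map K (inclusion Φ.cellSpace) (ψ x) = φ x) {D : RealCone d} (hD : D ∈ Φ.cones) :
    ψ (Finsupp.single D 1) ∈ degreePart K Φ.cellSpace D.dim := by
  refine mem_degreePart_of_map (f := inclusion Φ.cellSpace) Subtype.val_injective ?_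
  rw [hψ _ (Finsupp.single_mem_supported K 1 hD)]
  exact hφ.degree D

theorem nonempty_localHomology_equiv (ε : Φ.IncidenceFunction) {C : RealCone d} (hC : C ∈ Φ.cones)
    (hC0 : C ≠ ⊥) (p : Φ.cellSpace) (hp : p.1 ∈ C.openCell) (i : ℤ) :
    Nonempty (localHomology K (TopCat.of Φ.cellSpace) p i ≃ₗ[K] Φ.StarCohomology K ε C i) := by
  rcases i with m | m
  · obtain ⟨φ, hφ⟩ := exists_isCellMap K ε
    obtain ⟨ψ, hψ⟩ := hφ.exists_lift
    have hinj : Function.Injective (inclusion Φ.cellSpace) := Subtype.val_injective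
    have hN : (chainsIn K (Φ.cellSpace \ {p.1})).comap (map K (inclusion Φ.cellSpace)) =
        chainsIn K ({p}ᶜ : Set Φ.cellSpace) := by
      have hpre : inclusion Φ.cellSpace ⁻¹' (Φ.cellSpace \ {p.1}) = {p}ᶜ := by
        ext q
        exact ⟨fun h hq => h.2 (congrArg Subtype.val hq),
          fun h => ⟨q.2, fun hq => h (Subtype.ext hq)⟩⟩
      refine le_antisymm (fun x hx => hpre ▸ mem_chainsIn_of_map hinj hx) fun x hx => ?_
      exact map_mem_chainsIn (inclusion Φ.cellSpace) (fun q hq => hpre.ge hq) hx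
    have hacyc := relAcyclic_comap_inclusion hψ (hφ.relAcyclic_cellSpace_sdiff hC hC0 hp)
    rw [hN] at hacyc
    refine nonempty_homology_equiv_starCohomology (isChainModel_relativeSingularChains K {p}ᶜ)
      (fun x hx => hφ.boundary_lift hψ hx) (fun D hD => hφ.lift_mem_degreePart hψ hD) ?_ hacyc m m
      rfl
    intro x hx
    rw [← hN, Submodule.mem_comap, hψ x (Finsupp.supported_mono (fun _ h => h.1) hx)]
    refine chainsIn_mono ?_ (hφ.map_mem_inter_sphere (Φ.isSubfan_cones.away C) hx)
    rintro q ⟨⟨hq0, D, ⟨hD, hCD⟩, hq⟩, hs⟩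
    refine ⟨Φ.cellSpace_eq.ge ⟨⟨hq0, D, hD, hq⟩, hs⟩, ?_⟩
    rintro rfl
    rw [Φ.openCell_eq hC] at hp
    exact hCD (Φ.le_of_mem_core hC hD hp.1 hq)
  -- In negative degree a generator would be a cone of dimension at most zero containing `C`, which
  -- is excluded by `C ≠ ⊥`.
  · have : Subsingleton (Φ.StarCohomology K ε C (Int.negSucc m)) := by
      refine subsingleton_starCohomology fun D hD h => hC0 ?_
      have : D = ⊥ := eq_bot_of_dim (by omega)
      exact le_bot_iff.1 (this ▸ hD.2)
    exact nonempty_intHomology_equiv_negSucc _ _ _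

theorem nonempty_reducedHomology_equiv (ε : Φ.IncidenceFunction) (i : ℤ) :
    Nonempty (reducedHomology K (TopCat.of Φ.cellSpace) i ≃ₗ[K] Φ.StarCohomology K ε ⊥ i) := by
  suffices h : ∀ j, j = i + 1 → Nonempty (intHomology K
      (augmentedSingularChains K (TopCat.of Φ.cellSpace)) j ≃ₗ[K] Φ.StarCohomology K ε ⊥ i) from
    h _ rfl
  rintro (m | m) hi
  · obtain ⟨φ, hφ⟩ := exists_isCellMap K ε
    obtain ⟨ψ, hψ⟩ := hφ.exists_lift
    -- Every cone contains the zero cone, so the relative statement becomes the absolute one and the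
    -- subcomplexes divided out are zero.
    have hS : {D ∈ (Φ.cones : Set (RealCone d)) | ¬ ⊥ ≤ D} = ∅ := by simp
    have hN : (⊥ : Submodule K (SingularChain K (EuclideanSpace ℝ (Fin d)))).comap
        (map K (inclusion Φ.cellSpace)) = ⊥ :=
      LinearMap.ker_eq_bot.2 (map_injective Subtype.val_injective)
    have hacyc := hφ.relAcyclic_cellSpace
    rw [← Submodule.prod_bot] at hacyc
    have hacyc' := relAcyclic_comap_inclusion hψ hacyc
    rw [hN] at hacyc'
    refine nonempty_homology_equiv_starCohomology
      (isChainModel_augmentedSingularChains K Φ.cellSpace)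
      (fun x hx => hφ.boundary_lift hψ hx) (fun D hD => hφ.lift_mem_degreePart hψ hD) ?_ ?_ m i ?_
    · intro x hx
      rw [hS, Finsupp.supported_empty] at hx
      rw [(Submodule.mem_bot K).1 hx, map_zero]
      exact Submodule.zero_mem _
    · rw [hS, Finsupp.supported_empty]
      exact hacyc'
    · rw [← hi]
      simp
  · have : Subsingleton (Φ.StarCohomology K ε ⊥ i) :=
      subsingleton_starCohomology fun D _ h => by omega
    exact nonempty_intHomology_equiv_negSucc _ _ _

end RationalPointedFan

end

theorem lemma4p1 {d : ℕ} (K : Type*) [Field K] (Φ : RationalPointedFan d)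
    (ε : Φ.IncidenceFunction) :
    (∀ C ∈ Φ.cones, C ≠ ⊥ → ∀ p : Φ.cellSpace, p.1 ∈ C.openCell → ∀ i : ℤ,
      Nonempty (localHomology K (TopCat.of Φ.cellSpace) p i ≃ₗ[K] Φ.StarCohomology K ε C i)) ∧
    (∀ i : ℤ,
      Nonempty (reducedHomology K (TopCat.of Φ.cellSpace) i ≃ₗ[K] Φ.StarCohomology K ε ⊥ i)) :=
  ⟨fun _ hC hC0 p hp i => Φ.nonempty_localHomology_equiv ε hC hC0 p hp i,
    fun i => Φ.nonempty_reducedHomology_equiv ε i⟩
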